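/- Let $\Omega$ be a finite nonempty set, $n\ge 1$, and let $H:\Omega\to\mathbb R$ take all its values in $\{0,1,\dots,n\}$, or all its values in $\{0,-1,\dots,-n\}$. For $b\in\mathbb R$ put $Z(b)=\sum_{x\in\Omega}e^{-bH(x)}$ and $\pi_b(x)=e^{-bH(x)}/Z(b)$. Let $\beta>0$, $0<\epsilon\le 1/10$, and suppose that an oracle is available which, for any requested $b\in[0,\beta]$, returns an independent exact draw from $\pi_b$. Put $L=2+\ln(2n)$. **A run of TPA.** In the case $H\le 0$, start at $b=\beta$; in the case $H\ge 0$, start at $b=0$. Repeat: draw $X\sim\pi_b$ and $U$ uniform on $[0,1]$; if $H(X)=0$, stop; otherwise replace $b$ by $b-\ln(U)/H(X)$; if the new $b$ is not $>0$ (case $H\le0$), respectively not $<\beta$ (case $H\ge 0$), stop; otherwise add $b$ to the output and continue. **The algorithm.** 1. Run TPA 5 times, and let $N$ be the total number of points produced. Set $\hat q_1=N/c$, where $c=1$ or $c=5$ is fixed. Put $$d=\lceil 22\ln(100L(\hat q_1+1/2))\rceil,\qquad k=\tfrac23\,d\,L .$$ 2. Run TPA $\lceil k\rceil$ times, keep each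 of the points produced independently with probability $k/\lceil k\rceil$, and sort the points that are kept in increasing order. Let $0=\beta_0<\beta_1<\dots<\beta_\ell=\beta$ consist of $0$, of the $d$-th, $2d$-th, $3d$-th, $\dots$ of these points, and of $\beta$. Put $\delta_i=(\beta_{i+1}-\beta_i)/2$ for $0\le i<\ell$. 3. Repeat $\lceil 2e\sqrt{10}\,((1+\epsilon)^{1/2}-1)^{-2}\rceil$ times: draw independently $X_i\sim\pi_{\beta_i}$ for $0\le i\le\ell$, and compute $W=\prod_{i<\ell}e^{-\delta_iH(X_i)}$ and $V=\prod_{i<\ell}e^{\delta_iH(X_{i+1})}$. Let $\bar W$ and $\bar V$ be the averages of the values of $W$ and of $V$ over the repetitions. 4. Output $\bar W/\bar V$. **Theorem.** (i) For $c=1$ ($\hat q_1$ is the number of points produced in step 1) and for $c=5$ ($\hat q_1$ is the corresponding estimate of $|\ln(Z(\beta)/Z(0))|$), the output is within a factor $1+\epsilon$ of $Z(\beta)/Z(0)$ with probability at least $3/4$: $$\mathbb P\left(\frac1{1+\epsilon}\le\frac{\bar W/\bar V}{Z(\beta)/Z(0)}\le 1+\epsilon\right)\ge\frac34 .$$ Hence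 $Z(0)\bar W/\bar V$ is an $(\epsilon,3/4)$-randomized approximation of $Z(\beta)$, that is, it lies between $Z(\beta)/(1+\epsilon)$ and $(1+\epsilon)Z(\beta)$ with probability at least $3/4$. (ii) If moreover $n\ge 4$, then with $c=5$ and $q=|\ln(Z(\beta)/Z(0))|$ the expected total number of oracle draws (over steps 1, 2 and 3) is at most $$(q+1)\left[5+(2+\ln(2n))\left(14.9\,\ln\bigl(100(2+\ln(2n))(q+1)\bigr)+48.2\,\epsilon^{-2}\right)\right].$$ -/

import Mathlib

open MeasureTheory

noncomputable section

namespace PPAA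

/-- The partition function `Z(b) = ∑ x, exp (-b H(x))`. -/
def partitionFunction {Ω : Type*} [Fintype Ω] (H : Ω → ℝ) (b : ℝ) : ℝ :=
  ∑ x, Real.exp (-b * H x)

/-- The Gibbs probability `π_b(x) = exp (-b H(x)) / Z(b)`. -/
def gibbsProb {Ω : Type*} [Fintype Ω] (H : Ω → ℝ) (b : ℝ) (x : Ω) : ℝ :=
  Real.exp (-b * H x) / partitionFunction H b

/-- `draw` is an oracle for exact samples from the Gibbs distributions on `[0, β]`: when fed with a
fresh seed of law `ν`, the answer `draw b seed` to the query `b ∈ [0, β]` has law `π_b`. -/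
structure IsGibbsOracle {Ω S : Type*} [Fintype Ω] [MeasurableSpace S] (H : Ω → ℝ) (β : ℝ)
    (ν : Measure S) (draw : ℝ → S → Ω) : Prop where
  measurable : ∀ x, MeasurableSet {p : ℝ × S | draw p.1 p.2 = x}
  law : ∀ b ∈ Set.Icc (0 : ℝ) β, ∀ x, ν {s | draw b s = x} = ENNReal.ofReal (gibbsProb H b x)

/-- Whether the Hamiltonian is treated as a nonpositive or as a nonnegative one. -/
inductive HamiltonianSign
  | nonpos
  | nonneg

/-- `H` takes values in `{0, -1, …, -n}` (sign `nonpos`) or in `{0, 1, …, n}` (sign `nonneg`). -/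
def HasRange {Ω : Type*} (H : Ω → ℝ) (n : ℕ) : HamiltonianSign → Prop
  | .nonpos => ∀ x, ∃ j : ℕ, j ≤ n ∧ H x = -(j : ℝ)
  | .nonneg => ∀ x, ∃ j : ℕ, j ≤ n ∧ H x = (j : ℝ)

/-! ### Randomness

All random choices are read off independent cells. Each cell holds one oracle seed and one number
that is uniform on `[0, 1]`; an algorithm step may ignore either part. -/

/-- The cells: step `t` of the `j`-th preliminary run of TPA, step `t` of the `j`-th main run of
TPA, the thinning coin of the point found in step `t` of the `j`-th main run, and the draw of `X_i`
in the `a`-th repetition of the estimation phase. -/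
inductive Cell
  | pilot (j t : ℕ)
  | main (j t : ℕ)
  | thin (j t : ℕ)
  | est (a i : ℕ)

/-- An outcome of all the randomness. -/
abbrev Randomness (S : Type*) : Type _ := Cell → S × ℝ

/-- The cells are independent, and in each of them the seed and the uniform are independent. -/
def randomnessLaw {S : Type*} [MeasurableSpace S] (ν : Measure S) [IsProbabilityMeasure ν] :
    Measure (Randomness S) :=
  haveI : IsProbabilityMeasure ((volume : Measure ℝ).restrict (Set.Icc 0 1)) := ⟨by simp⟩
  Measure.infinitePi fun _ : Cell => ν.prod ((volume : Measure ℝ).restrict (Set.Icc 0 1))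

/-! ### TPA -/

/-- The parameter value at which TPA starts. -/
def tpaStart (β : ℝ) : HamiltonianSign → ℝ
  | .nonpos => β
  | .nonneg => 0

/-- TPA goes on as long as the parameter value has not left the interval. -/
def tpaContinues (β b : ℝ) : HamiltonianSign → Prop
  | .nonpos => 0 < b
  | .nonneg => b < β

section TPA

variable {Ω S : Type*} (H : Ω → ℝ) (σ : HamiltonianSign) (β : ℝ) (draw : ℝ → S → Ω)

open Classical in
/-- One step of TPA at the parameter value `b`: draw `X` from `π_b` and `U` uniform, move to
`b - ln U / H X`; `none` means that the run stops (because `H X = 0`, or because the new value is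
outside the interval). -/
def tpaStep (b : ℝ) (cell : S × ℝ) : Option ℝ :=
  let h := H (draw b cell.1)
  let b' := b - Real.log cell.2 / h
  if h = 0 then none else if tpaContinues β b' σ then some b' else none

/-- The parameter value of a run of TPA after `t` steps, `none` once the run has stopped. -/
def tpaState (cells : ℕ → S × ℝ) : ℕ → Option ℝ
  | 0 => some (tpaStart β σ)
  | t + 1 => (tpaState cells t).bind fun b => tpaStep H σ β draw b (cells t)

open Classical in
/-- The number of oracle draws that a run of TPA makes (`⊤` if it never stops). -/
def tpaDraws (cells : ℕ → S × ℝ) : ℕ∞ :=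
  if h : ∃ t, tpaState H σ β draw cells t = none then (Nat.find h : ℕ∞) else ⊤

/-- The points which a run of TPA returns, each one with the number `t` of the step which found it,
in the order in which they are found. (A run that never stops has no output; this has
probability zero.) -/
def tpaPoints (cells : ℕ → S × ℝ) : List (ℕ × ℝ) :=
  (List.range ((tpaDraws H σ β draw cells).toNat - 1)).filterMap fun t =>
    (tpaState H σ β draw cells (t + 1)).map fun b => (t, b)

end TPA

/-! ### The paired product approximation algorithm -/

section Algorithm

variable {Ω S : Type*} (H : Ω → ℝ) (σ : HamiltonianSign) (n : ℕ) (β ε c : ℝ) (draw : ℝ → S → Ω)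
  (ω : Randomness S)

/-- The number of points produced by the five preliminary runs of TPA. -/
def pilotSize : ℕ :=
  ∑ j ∈ Finset.range 5, (tpaPoints H σ β draw fun t => ω (.pilot j t)).length

/-- The value `q̂₁`, which is the number of points of the preliminary runs divided by `c`. -/
def pilotEstimate : ℝ :=
  pilotSize H σ β draw ω / c

/-- `d = ⌈22 ln (100 (2 + ln (2n)) (q̂₁ + 1/2))⌉`. -/
def spacing : ℕ :=
  ⌈22 * Real.log (100 * (2 + Real.log (2 * n)) * (pilotEstimate H σ β c draw ω + 1 / 2))⌉₊

/-- `k = (2/3) d (2 + ln (2n))`, the rate of the point process of the second step. -/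
def rate : ℝ :=
  2 / 3 * spacing H σ n β c draw ω * (2 + Real.log (2 * n))

/-- The number `⌈k⌉` of main runs of TPA. -/
def numRuns : ℕ :=
  ⌈rate H σ n β c draw ω⌉₊

open Classical in
/-- The points of the `j`-th main run that survive the thinning, in which every point is kept
independently with probability `k / ⌈k⌉`. -/
def thinnedRun (j : ℕ) : List ℝ :=
  ((tpaPoints H σ β draw fun t => ω (.main j t)).filter fun p =>
    decide ((ω (.thin j p.1)).2 ≤ rate H σ n β c draw ω / numRuns H σ n β c draw ω)).map Prod.snd

/-- All surviving points of the `⌈k⌉` main runs, in increasing order. -/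
def sortedPoints : List ℝ :=
  ((List.range (numRuns H σ n β c draw ω)).flatMap (thinnedRun H σ n β c draw ω)).insertionSort
    (· ≤ ·)

/-- The entries number `d`, `2 d`, `3 d`, … of a list (the first entry has number `1`). -/
def everyNth (d : ℕ) (l : List ℝ) : List ℝ :=
  (List.range (l.length / d)).map fun i => l.getD ((i + 1) * d - 1) 0

/-- The cooling schedule `0 = β_0 < β_1 < ⋯ < β_ℓ = β`. -/
def schedule : List ℝ :=
  0 :: (everyNth (spacing H σ n β c draw ω) (sortedPoints H σ n β c draw ω) ++ [β])

/-- The number `ℓ` of intervals of the schedule. -/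
def numIntervals : ℕ :=
  (schedule H σ n β c draw ω).length - 1

/-- The parameter value `β_i`, for `i ≤ ℓ`. -/
def param (i : ℕ) : ℝ :=
  (schedule H σ n β c draw ω).getD i 0

/-- The half length `δ_i` of the interval `[β_i, β_{i+1}]`. -/
def halfLength (i : ℕ) : ℝ :=
  (param H σ n β c draw ω (i + 1) - param H σ n β c draw ω i) / 2

/-- The number `⌈2 e √10 ((1 + ε)^{1/2} - 1)⁻²⌉` of repetitions of the estimation step. -/
def numReps (ε : ℝ) : ℕ :=
  ⌈2 * Real.exp 1 * √10 / (√(1 + ε) - 1) ^ 2⌉₊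

/-- The draw `X_i` from `π_{β_i}` in repetition `a`. -/
def estSample (a i : ℕ) : Ω :=
  draw (param H σ n β c draw ω i) (ω (.est a i)).1

/-- `W = ∏ exp (-δ_i H(X_i))` in repetition `a`. -/
def prodW (a : ℕ) : ℝ :=
  ∏ i ∈ Finset.range (numIntervals H σ n β c draw ω),
    Real.exp (-halfLength H σ n β c draw ω i * H (estSample H σ n β c draw ω a i))

/-- `V = ∏ exp (δ_i H(X_{i+1}))` in repetition `a`. -/
def prodV (a : ℕ) : ℝ :=
  ∏ i ∈ Finset.range (numIntervals H σ n β c draw ω),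
    Real.exp (halfLength H σ n β c draw ω i * H (estSample H σ n β c draw ω a (i + 1)))

/-- The sample average of the `W` values. -/
def meanW : ℝ :=
  (∑ a ∈ Finset.range (numReps ε), prodW H σ n β c draw ω a) / numReps ε

/-- The sample average of the `V` values. -/
def meanV : ℝ :=
  (∑ a ∈ Finset.range (numReps ε), prodV H σ n β c draw ω a) / numReps ε

/-- The output of the algorithm, an estimate of `Z(β) / Z(0)`. -/
def output : ℝ :=
  meanW H σ n β ε c draw ω / meanV H σ n β ε c draw ω

/-- The total number of oracle draws: those of the five preliminary runs of TPA, those of the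
`⌈k⌉` main runs, and `X_0, …, X_ℓ` in every repetition of the estimation step. -/
def totalDraws : ℕ∞ :=
  ∑ j ∈ Finset.range 5, tpaDraws H σ β draw (fun t => ω (.pilot j t))
    + ∑ j ∈ Finset.range (numRuns H σ n β c draw ω), tpaDraws H σ β draw (fun t => ω (.main j t))
    + ((numReps ε * (numIntervals H σ n β c draw ω + 1) : ℕ) : ℕ∞)

end Algorithm

/-- A random variable `Zhat` on a probability space is within a factor `1 + ε` of the value `Z`
with probability at least `3/4`. -/
def IsApproximation {R : Type*} [MeasurableSpace R] (P : Measure R) (Zhat : R → ℝ) (Z ε : ℝ) :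
    Prop :=
  3 / 4 ≤ P {ω | 1 / (1 + ε) ≤ Zhat ω / Z ∧ Zhat ω / Z ≤ 1 + ε}

end PPAA

end

set_option linter.unusedSectionVars false

noncomputable section

namespace PPAA

open scoped ENNReal
open Filter Topology

/-! ### Splitting a product measure -/

section Splitting

variable {ι E : Type*}

/-! Everything is measured on the logarithmic scale. Let q = |ln(Z(β)/Z(0))| and L = 2 + ln(2n), and
let `remaining` be the distance from ln Z(b) to ln Z at the end of the run. Since the mean of
exp(-(a-b)H(X)) under π_b is Z(a)/Z(b), a step of TPA lowers this distance by a standard exponential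
amount, cut off at 0 (`map_remaining_tpaNext`). So the points of a run form a rate-one Poisson
process on (0, q), and the thinned union of the main runs one of rate k. Only two consequences are
needed, both from supermartingales carried along the steps: a run makes at most 1 + q draws on
average (`lintegral_tpaDraws_le`), and the number of points kept with probability κ in a block of
length l has generating function at most exp(-κ(1-s)l) (`lintegral_pow_countP_keptPoints_le`).

Schedule. A gap of logarithmic length above η = 5/(2L) contains a block of a fixed grid hit by fewer
than d points. A Chernoff bound and a union bound over the grid make this unlikely
(`measure_compl_shortGaps_le`). The bound involves q, but d is set from the preliminary runs, so it
is averaged over their size; the result is 0.01 (`lintegral_schedule_failure_le`).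

Estimation. For a fixed schedule, W and V both have relative second moment exp(∑ D_i), where D_i =
f(β_i) + f(β_{i+1}) - 2 f(midpoint) and f = ln Z. Each D_i is at most the change of f over its
interval, and also at most η/2 times the change of ln M, where M = |f'| is the mean of |H|. Here M ≤
n, and integrality of H gives M ≥ 1 - e^{-u} at logarithmic distance u from the end of TPA. The
first bound near that end and the second one elsewhere give ∑ D_i ≤ 3/2 for gaps at most η
(`sum_log_partitionFunction_curvature_le`). Chebyshev's inequality then bounds the failure by 0.24,
and 0.24 + 0.01 = 1/4.

Cost. The number of main runs is independent of their lengths (a Wald identity), its mean is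
controlled by the concavity of ln, and the mean number of intervals is at most (2/3)Lq + 1 because
the spacing d cancels against the rate. -/

open Classical in
/-- The outcome that is read off `p.1` in the cells of `T` and off `p.2` elsewhere. -/
def splice (T : Set ι) (p : (ι → E) × (ι → E)) : ι → E := T.piecewise p.1 p.2

variable {T : Set ι} {x y : ι → E} {i : ι}

theorem splice_of_mem (hi : i ∈ T) : splice T (x, y) i = x i := by
  classical simp [splice, hi]

theorem splice_of_notMem (hi : i ∉ T) : splice T (x, y) i = y i := by
  classical simp [splice, hi]

theorem DependsOn.splice_left {α : Type*} {f : (ι → E) → α} (hf : DependsOn f T) :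
    f (splice T (x, y)) = f x :=
  hf fun _ hi => splice_of_mem hi

theorem DependsOn.splice_right {α : Type*} {f : (ι → E) → α} (hf : DependsOn f Tᶜ) :
    f (splice T (x, y)) = f y :=
  hf fun _ hi => splice_of_notMem hi

variable [MeasurableSpace E] (ρ : Measure E) [IsProbabilityMeasure ρ]

variable (T) in
theorem measurable_splice : Measurable (splice T : (ι → E) × (ι → E) → ι → E) := by
  refine measurable_pi_lambda _ fun i => ?_
  by_cases hi : i ∈ T
  · simp only [splice, Set.piecewise, hi, if_true]; fun_prop
  · simp only [splice, Set.piecewise, hi, if_false]; fun_prop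

variable (T) in
-- The probability of a box factors into its cells in `T` and the others. Conditioning on the cells
-- of `T` thereby becomes Fubini: freeze `x`, integrate over `y`.
theorem map_splice :
    ((Measure.infinitePi fun _ : ι => ρ).prod (Measure.infinitePi fun _ : ι => ρ)).map (splice T)
      = Measure.infinitePi fun _ : ι => ρ := by
  classical
  refine Measure.eq_infinitePi _ fun s t ht => ?_
  have hs : MeasurableSet ((s : Set ι).pi t) := .pi s.countable_toSet fun i _ => ht i
  rw [Measure.map_apply (measurable_splice T) hs]
  have : splice T ⁻¹' ((s : Set ι).pi t)
      = ((s.filter (· ∈ T) : Finset ι) : Set ι).pi t ×ˢ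
        ((s.filter (· ∉ T) : Finset ι) : Set ι).pi t := by
    ext ⟨x, y⟩
    simp only [Set.mem_preimage, Set.mem_pi, Finset.mem_coe, Set.mem_prod, Finset.mem_filter]
    constructor
    · refine fun h => ⟨fun i hi => ?_, fun i hi => ?_⟩
      · simpa [splice_of_mem hi.2] using h i hi.1
      · simpa [splice_of_notMem hi.2] using h i hi.1
    · rintro ⟨h1, h2⟩ i hi
      by_cases hT : i ∈ T
      · simpa [splice_of_mem hT] using h1 i ⟨hi, hT⟩
      · simpa [splice_of_notMem hT] using h2 i ⟨hi, hT⟩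
  rw [this, Measure.prod_prod, Measure.infinitePi_pi _ fun i _ => ht i,
    Measure.infinitePi_pi _ fun i _ => ht i, Finset.prod_filter_mul_prod_filter_not]

variable (T) in
theorem lintegral_splice {f : (ι → E) → ℝ≥0∞} (hf : Measurable f) :
    ∫⁻ x, f x ∂(Measure.infinitePi fun _ : ι => ρ)
      = ∫⁻ x, ∫⁻ y, f (splice T (x, y)) ∂(Measure.infinitePi fun _ : ι => ρ)
          ∂(Measure.infinitePi fun _ : ι => ρ) := by
  conv_lhs => rw [← map_splice T ρ]
  rw [lintegral_map hf (measurable_splice T), lintegral_prod]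
  exact (hf.comp (measurable_splice T)).aemeasurable

theorem lintegral_mul_of_dependsOn {f g : (ι → E) → ℝ≥0∞} (hf : Measurable f) (hg : Measurable g)
    (hfT : DependsOn f T) (hgT : DependsOn g Tᶜ) :
    ∫⁻ x, f x * g x ∂(Measure.infinitePi fun _ : ι => ρ)
      = (∫⁻ x, f x ∂(Measure.infinitePi fun _ : ι => ρ))
        * ∫⁻ x, g x ∂(Measure.infinitePi fun _ : ι => ρ) := by
  rw [lintegral_splice T ρ (f := fun x => f x * g x) (hf.mul hg)]
  simp only [DependsOn.splice_left hfT, DependsOn.splice_right hgT]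
  simp only [lintegral_const_mul _ hg]
  rw [lintegral_mul_const _ hf]

theorem lintegral_prod_of_dependsOn {κ : Type*} (s : Finset κ) {f : κ → (ι → E) → ℝ≥0∞}
    {T : κ → Set ι} (hT : Pairwise (Function.onFun Disjoint T))
    (hf : ∀ k, Measurable (f k)) (hfT : ∀ k, DependsOn (f k) (T k)) :
    ∫⁻ x, ∏ k ∈ s, f k x ∂(Measure.infinitePi fun _ : ι => ρ)
      = ∏ k ∈ s, ∫⁻ x, f k x ∂(Measure.infinitePi fun _ : ι => ρ) := by
  classical
  induction s using Finset.induction_on with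
  | empty => simp
  | insert a s ha ih =>
    simp only [Finset.prod_insert ha]
    rw [lintegral_mul_of_dependsOn (T := T a) ρ (hf a)
      (Finset.measurable_prod _ fun k _ => hf k) (hfT a), ih]
    intro x y hxy
    refine Finset.prod_congr rfl fun k hk => hfT k fun i hi => hxy i ?_
    have : Disjoint (T k) (T a) := hT fun h => ha (h ▸ hk)
    exact fun h => Set.disjoint_left.1 this hi h

end Splitting

/-! ### The oracle and the partition function -/

/-- The uniform distribution on `[0, 1]`. -/
def unif : Measure ℝ := volume.restrict (Set.Icc 0 1)

instance : IsProbabilityMeasure unif := ⟨by simp [unif]⟩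

/-- The law of one cell. -/
def cellLaw {S : Type*} [MeasurableSpace S] (ν : Measure S) : Measure (S × ℝ) := ν.prod unif

instance {S : Type*} [MeasurableSpace S] (ν : Measure S) [IsProbabilityMeasure ν] :
    IsProbabilityMeasure (cellLaw ν) := by unfold cellLaw; infer_instance

theorem randomnessLaw_eq {S : Type*} [MeasurableSpace S] (ν : Measure S) [IsProbabilityMeasure ν] :
    randomnessLaw ν = Measure.infinitePi fun _ : Cell => cellLaw ν := rfl

instance {S : Type*} [MeasurableSpace S] (ν : Measure S) [IsProbabilityMeasure ν] :
    IsProbabilityMeasure (randomnessLaw ν) := by rw [randomnessLaw_eq]; infer_instance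

theorem ae_unif_mem : ∀ᵐ u ∂unif, u ∈ Set.Ioc (0 : ℝ) 1 := by
  rw [unif, ← restrict_Ioc_eq_restrict_Icc]
  exact ae_restrict_mem measurableSet_Ioc

theorem ae_cellLaw_mem {S : Type*} [MeasurableSpace S] (ν : Measure S) [IsProbabilityMeasure ν] :
    ∀ᵐ p ∂cellLaw ν, p.2 ∈ Set.Ioc (0 : ℝ) 1 :=
  Measure.quasiMeasurePreserving_snd.ae ae_unif_mem

section Oracle

variable {Ω S : Type*} [Fintype Ω] [MeasurableSpace S] {H : Ω → ℝ} {β : ℝ}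
  {ν : Measure S} {draw : ℝ → S → Ω}

open Classical in
theorem comp_draw_eq_sum {M : Type*} [AddCommMonoid M] (f : Ω → M) (b : ℝ) (s : S) :
    f (draw b s) = ∑ x, if draw b s = x then f x else 0 := by
  simp

theorem IsGibbsOracle.measurable_comp {M : Type*} [AddCommMonoid M] [MeasurableSpace M]
    [MeasurableAdd₂ M] (hdraw : IsGibbsOracle H β ν draw)
    (f : Ω → M) : Measurable fun p : ℝ × S => f (draw p.1 p.2) := by
  classical
  simp_rw [comp_draw_eq_sum f]
  exact Finset.measurable_sum _ fun x _ =>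
    Measurable.ite (hdraw.measurable x) measurable_const measurable_const

theorem IsGibbsOracle.lintegral_comp (hdraw : IsGibbsOracle H β ν draw) {b : ℝ}
    (hb : b ∈ Set.Icc 0 β) (f : Ω → ℝ≥0∞) :
    ∫⁻ s, f (draw b s) ∂ν = ∑ x, ENNReal.ofReal (gibbsProb H b x) * f x := by
  classical
  simp_rw [comp_draw_eq_sum f]
  have hm : ∀ x, MeasurableSet {s | draw b s = x} := fun x =>
    measurable_prodMk_left (hdraw.measurable x)
  rw [lintegral_finsetSum _ fun x _ => Measurable.ite (hm x) measurable_const measurable_const]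
  refine Finset.sum_congr rfl fun x _ => ?_
  have : (fun s => if draw b s = x then f x else 0)
      = {s | draw b s = x}.indicator fun _ => f x := by
    ext s; simp [Set.indicator]
  rw [this, lintegral_indicator (hm x), setLIntegral_const, hdraw.law b hb, mul_comm]

variable [Nonempty Ω]


theorem partitionFunction_pos (H : Ω → ℝ) (b : ℝ) : 0 < partitionFunction H b :=
  Finset.sum_pos (fun _ _ => Real.exp_pos _) Finset.univ_nonempty

theorem gibbsProb_nonneg (H : Ω → ℝ) (b : ℝ) (x : Ω) : 0 ≤ gibbsProb H b x :=
  div_nonneg (Real.exp_nonneg _) (partitionFunction_pos H b).le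

/-- Reweighting from `b` to `a`. Both the law of a TPA step and the means of `W` and `V` come from
this identity. -/
theorem sum_gibbsProb_mul_exp (H : Ω → ℝ) (a b : ℝ) :
    ∑ x, gibbsProb H b x * Real.exp (-(a - b) * H x)
      = partitionFunction H a / partitionFunction H b := by
  simp only [gibbsProb, div_mul_eq_mul_div, ← Real.exp_add, ← Finset.sum_div]
  congr 1
  exact Finset.sum_congr rfl fun x _ => by ring_nf

theorem IsGibbsOracle.lintegral_exp (hdraw : IsGibbsOracle H β ν draw) {b : ℝ}
    (hb : b ∈ Set.Icc 0 β) (a : ℝ) :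
    ∫⁻ s, ENNReal.ofReal (Real.exp (-(a - b) * H (draw b s))) ∂ν
      = ENNReal.ofReal (partitionFunction H a / partitionFunction H b) := by
  rw [hdraw.lintegral_comp hb fun x => ENNReal.ofReal (Real.exp (-(a - b) * H x)),
    ← sum_gibbsProb_mul_exp,
    ENNReal.ofReal_sum_of_nonneg fun x _ => mul_nonneg (gibbsProb_nonneg H b x) (Real.exp_nonneg _)]
  exact Finset.sum_congr rfl fun x _ => (ENNReal.ofReal_mul (gibbsProb_nonneg H b x)).symm

theorem continuous_log_partitionFunction (H : Ω → ℝ) :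
    Continuous fun b => Real.log (partitionFunction H b) := by
  refine Continuous.log ?_ fun b => (partitionFunction_pos H b).ne'
  unfold partitionFunction
  fun_prop

end Oracle

/-! ### The direction of TPA -/

/-- The value `1` or `-1` that has the sign of the Hamiltonian. -/
def HamiltonianSign.toReal : HamiltonianSign → ℝ
  | .nonpos => -1
  | .nonneg => 1

/-- The parameter value towards which TPA moves. -/
def tpaEnd (β : ℝ) : HamiltonianSign → ℝ
  | .nonpos => 0
  | .nonneg => β

theorem HamiltonianSign.toReal_mul_self (σ : HamiltonianSign) : σ.toReal * σ.toReal = 1 := by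
  cases σ <;> norm_num [HamiltonianSign.toReal]

theorem HasRange.nonneg {Ω : Type*} {H : Ω → ℝ} {n : ℕ} {σ : HamiltonianSign}
    (hH : HasRange H n σ) (x : Ω) : 0 ≤ σ.toReal * H x := by
  cases σ <;> obtain ⟨j, -, hj⟩ := hH x <;> simp [HamiltonianSign.toReal, hj]

/-- Multiplication by the sign gives "towards the end" the same form in both cases, so that the two
directions of TPA share their proofs. -/
theorem tpaContinues_iff {β b : ℝ} {σ : HamiltonianSign} :
    tpaContinues β b σ ↔ 0 < σ.toReal * (tpaEnd β σ - b) := by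
  cases σ <;> simp [tpaContinues, HamiltonianSign.toReal, tpaEnd]

theorem mem_Icc_iff_toReal {β b : ℝ} {σ : HamiltonianSign} :
    b ∈ Set.Icc 0 β ↔ 0 ≤ σ.toReal * (tpaEnd β σ - b) ∧ 0 ≤ σ.toReal * (b - tpaStart β σ) := by
  cases σ <;> simp [HamiltonianSign.toReal, tpaEnd, tpaStart, and_comm]

theorem tpaEnd_mem {β : ℝ} (hβ : 0 < β) (σ : HamiltonianSign) : tpaEnd β σ ∈ Set.Icc 0 β := by
  cases σ <;> simp [tpaEnd, hβ.le]

theorem tpaStart_mem {β : ℝ} (hβ : 0 < β) (σ : HamiltonianSign) : tpaStart β σ ∈ Set.Icc 0 β := by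
  cases σ <;> simp [tpaStart, hβ.le]

theorem tpaStart_ne_tpaEnd {β : ℝ} (hβ : 0 < β) (σ : HamiltonianSign) :
    tpaStart β σ ≠ tpaEnd β σ := by
  cases σ <;> simp [tpaStart, tpaEnd, hβ.ne, hβ.ne']

/-- The logarithmic distance of `b` from the end of the run. -/
def remaining {Ω : Type*} [Fintype Ω] (H : Ω → ℝ) (σ : HamiltonianSign) (β b : ℝ) : ℝ :=
  Real.log (partitionFunction H b) - Real.log (partitionFunction H (tpaEnd β σ))

section Direction

variable {Ω : Type*} [Fintype Ω] [Nonempty Ω] {H : Ω → ℝ} {σ : HamiltonianSign} {n : ℕ} {β : ℝ}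

theorem partitionFunction_le (hH : HasRange H n σ) {a b : ℝ} (hab : 0 ≤ σ.toReal * (a - b)) :
    partitionFunction H a ≤ partitionFunction H b := by
  refine Finset.sum_le_sum fun x _ => Real.exp_le_exp.2 ?_
  have := mul_nonneg hab (hH.nonneg x)
  have h2 : σ.toReal * (a - b) * (σ.toReal * H x) = (a - b) * H x := by
    linear_combination ((a - b) * H x) * σ.toReal_mul_self
  linarith

theorem partitionFunction_lt (hH : HasRange H n σ) {a b : ℝ} (hab : 0 < σ.toReal * (a - b))
    (hne : ∃ x, H x ≠ 0) : partitionFunction H a < partitionFunction H b := by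
  have key : ∀ x, σ.toReal * (a - b) * (σ.toReal * H x) = (a - b) * H x := fun x => by
    linear_combination ((a - b) * H x) * σ.toReal_mul_self
  obtain ⟨x, hx⟩ := hne
  refine Finset.sum_lt_sum (fun x _ => Real.exp_le_exp.2 ?_) ⟨x, Finset.mem_univ x,
    Real.exp_lt_exp.2 ?_⟩
  · have := mul_nonneg hab.le (hH.nonneg x)
    have h2 := key x
    linarith
  · have h0 : σ.toReal * H x ≠ 0 := mul_ne_zero (fun h => by
      have := σ.toReal_mul_self; simp [h] at this) hx
    have := mul_pos hab ((hH.nonneg x).lt_of_ne' h0)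
    have h2 := key x
    linarith

theorem remaining_le (hH : HasRange H n σ) {a b : ℝ} (hab : 0 ≤ σ.toReal * (a - b)) :
    remaining H σ β a ≤ remaining H σ β b :=
  sub_le_sub_right (Real.log_le_log (partitionFunction_pos H a) (partitionFunction_le hH hab)) _

theorem remaining_lt (hH : HasRange H n σ) {a b : ℝ} (hab : 0 < σ.toReal * (a - b))
    (hne : ∃ x, H x ≠ 0) : remaining H σ β a < remaining H σ β b :=
  sub_lt_sub_right (Real.log_lt_log (partitionFunction_pos H a) (partitionFunction_lt hH hab hne)) _

theorem remaining_tpaEnd : remaining H σ β (tpaEnd β σ) = 0 := sub_self _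

theorem remaining_nonneg (hH : HasRange H n σ) {b : ℝ} (hb : b ∈ Set.Icc 0 β) :
    0 ≤ remaining H σ β b := by
  rw [← remaining_tpaEnd (H := H) (σ := σ) (β := β)]
  exact remaining_le hH (mem_Icc_iff_toReal.1 hb).1

theorem remaining_le_start (hH : HasRange H n σ) {b : ℝ} (hb : b ∈ Set.Icc 0 β) :
    remaining H σ β b ≤ remaining H σ β (tpaStart β σ) :=
  remaining_le hH (mem_Icc_iff_toReal.1 hb).2

theorem remaining_le_remaining_iff (hH : HasRange H n σ) (hne : ∃ x, H x ≠ 0) {a b : ℝ} :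
    remaining H σ β a ≤ remaining H σ β b ↔ 0 ≤ σ.toReal * (a - b) := by
  refine ⟨fun h => ?_, remaining_le hH⟩
  by_contra! h'
  exact absurd (remaining_lt hH (β := β) (a := b) (b := a) (by linarith) hne) (not_lt.2 h)

theorem continuous_remaining : Continuous (remaining H σ β) :=
  (continuous_log_partitionFunction H).sub continuous_const

theorem abs_log_div_eq (hH : HasRange H n σ) (hβ : 0 < β) :
    |Real.log (partitionFunction H β / partitionFunction H 0)|
      = remaining H σ β (tpaStart β σ) := by
  have h := remaining_nonneg hH (tpaStart_mem hβ σ)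
  rw [Real.log_div (partitionFunction_pos H β).ne' (partitionFunction_pos H 0).ne']
  cases σ
  · exact abs_of_nonneg h
  · rw [abs_sub_comm]; exact abs_of_nonneg h

theorem exists_remaining_eq {b y : ℝ} (hb : b ∈ Set.Icc 0 β) (hy : 0 ≤ y)
    (hyb : y ≤ remaining H σ β b) :
    ∃ a, 0 ≤ σ.toReal * (a - b) ∧ 0 ≤ σ.toReal * (tpaEnd β σ - a) ∧ remaining H σ β a = y := by
  have hc : ContinuousOn (remaining H σ β) (Set.uIcc (tpaEnd β σ) b) :=
    continuous_remaining.continuousOn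
  obtain ⟨a, ha, hay⟩ := intermediate_value_uIcc hc
    (Set.mem_uIcc.2 (Or.inl ⟨remaining_tpaEnd.trans_le hy, hyb⟩))
  refine ⟨a, ?_, ?_, hay⟩
  all_goals
    cases σ
    · simp only [HamiltonianSign.toReal, tpaEnd, Set.uIcc_of_le hb.1, Set.mem_Icc] at ha ⊢
      linarith
    · simp only [HamiltonianSign.toReal, tpaEnd, Set.uIcc_of_ge hb.2, Set.mem_Icc] at ha ⊢
      linarith

end Direction

/-! ### One step of TPA -/

section Step

variable {Ω S : Type*} (H : Ω → ℝ) (σ : HamiltonianSign) (β : ℝ) (draw : ℝ → S → Ω)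

/-- The parameter value after one step, where a run that stops moves to the end. -/
def tpaNext (b : ℝ) (cell : S × ℝ) : ℝ := (tpaStep H σ β draw b cell).getD (tpaEnd β σ)

variable {H σ β draw}

theorem tpaNext_ne_end {b : ℝ} {cell : S × ℝ} :
    tpaNext H σ β draw b cell ≠ tpaEnd β σ ↔ tpaStep H σ β draw b cell ≠ none := by
  unfold tpaNext tpaStep
  dsimp only
  split_ifs with h1 h2
  · simp
  · rw [tpaContinues_iff] at h2
    simp only [Option.getD_some, ne_eq, reduceCtorEq, not_false_eq_true, iff_true]
    intro h
    rw [h] at h2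
    simp at h2
  · simp

theorem exists_ne_zero_of_tpaNext_ne {b : ℝ} {cell : S × ℝ}
    (h : tpaNext H σ β draw b cell ≠ tpaEnd β σ) : ∃ x, H x ≠ 0 := by
  refine ⟨draw b cell.1, fun h0 => h ?_⟩
  simp [tpaNext, tpaStep, h0]

variable {n : ℕ}

/-- Moving by -ln U / H(X) passes `a` exactly when ln U ≤ -(a-b)H(X). A run that stops is sent to
the end, which is beyond every admissible `a`; for H(X) = 0 this agrees with the right side, which
reads U ≤ 1. -/
theorem tpaNext_beyond_iff (hH : HasRange H n σ) {a b : ℝ} {cell : S × ℝ}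
    (hc : cell.2 ∈ Set.Ioc (0 : ℝ) 1) (ha : 0 ≤ σ.toReal * (tpaEnd β σ - a)) :
    0 ≤ σ.toReal * (tpaNext H σ β draw b cell - a) ↔
      cell.2 ≤ Real.exp (-(a - b) * H (draw b cell.1)) := by
  unfold tpaNext tpaStep
  dsimp only
  set h := H (draw b cell.1) with hh
  set s := σ.toReal with hs
  have hss : s * s = 1 := σ.toReal_mul_self
  by_cases h0 : h = 0
  · simp [h0, ha, hc.2]
  have hsh : 0 < s * h := lt_of_le_of_ne (hH.nonneg _) fun h' => by
    have : s * s * h = 0 := by rw [mul_assoc, ← h', mul_zero]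
    exact h0 (by simpa [hss] using this)
  have key : s * h * (s * (b - Real.log cell.2 / h - a)) = -(a - b) * h - Real.log cell.2 := by
    have : s * h * (s * (b - Real.log cell.2 / h - a))
        = s * s * ((b - a) * h - Real.log cell.2 * (h / h)) := by ring
    rw [this, hss, div_self h0]; ring
  have h1 : 0 ≤ s * (b - Real.log cell.2 / h - a) ↔ cell.2 ≤ Real.exp (-(a - b) * h) := by
    rw [← Real.log_le_iff_le_exp hc.1, ← sub_nonneg (b := Real.log cell.2), ← key,
      mul_nonneg_iff_of_pos_left hsh]
  rw [if_neg h0]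
  split_ifs with h2
  · simpa using h1
  · rw [tpaContinues_iff, not_lt] at h2
    simp only [Option.getD_none]
    rw [← h1]
    refine iff_of_true ha ?_
    have := add_nonneg (neg_nonneg.2 h2) ha
    linarith

theorem tpaNext_mem (hH : HasRange H n σ) {b : ℝ} (hb : b ∈ Set.Icc 0 β)
    {cell : S × ℝ} (hc : cell.2 ∈ Set.Ioc (0 : ℝ) 1) :
    tpaNext H σ β draw b cell ∈ Set.Icc 0 β ∧
      0 ≤ σ.toReal * (tpaNext H σ β draw b cell - b) := by
  have hb' := (mem_Icc_iff_toReal (σ := σ)).1 hb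
  have h1 : 0 ≤ σ.toReal * (tpaNext H σ β draw b cell - b) := by
    rw [tpaNext_beyond_iff hH hc hb'.1]
    simpa using hc.2
  refine ⟨(mem_Icc_iff_toReal (σ := σ)).2 ⟨?_, ?_⟩, h1⟩
  · unfold tpaNext tpaStep
    dsimp only
    split_ifs with h1 h2
    · simp
    · exact (tpaContinues_iff.1 h2).le
    · simp
  · linarith [hb'.2]

variable [Fintype Ω] [MeasurableSpace S] {ν : Measure S}

theorem IsGibbsOracle.measurable_tpaNext (hdraw : IsGibbsOracle H β ν draw) :
    Measurable fun p : ℝ × (S × ℝ) => tpaNext H σ β draw p.1 p.2 := by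
  have hh : Measurable fun p : ℝ × (S × ℝ) => H (draw p.1 p.2.1) :=
    (hdraw.measurable_comp H).comp (by fun_prop : Measurable fun p : ℝ × (S × ℝ) => (p.1, p.2.1))
  have hb' : Measurable fun p : ℝ × (S × ℝ) => p.1 - Real.log p.2.2 / H (draw p.1 p.2.1) :=
    measurable_fst.sub (Measurable.div (by fun_prop) hh)
  have : (fun p : ℝ × (S × ℝ) => tpaNext H σ β draw p.1 p.2) = fun p =>
      if H (draw p.1 p.2.1) = 0 then tpaEnd β σ
      else if 0 < σ.toReal * (tpaEnd β σ - (p.1 - Real.log p.2.2 / H (draw p.1 p.2.1))) then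
        p.1 - Real.log p.2.2 / H (draw p.1 p.2.1) else tpaEnd β σ := by
    ext p
    simp only [tpaNext, tpaStep, tpaContinues_iff]
    split_ifs <;> rfl
  rw [this]
  refine Measurable.ite (hh (measurableSet_singleton 0)) measurable_const
    (Measurable.ite ?_ hb' measurable_const)
  exact measurableSet_lt measurable_const (by fun_prop)

variable [Nonempty Ω] [IsProbabilityMeasure ν]

theorem unif_Iic {c : ℝ} (h1 : c ≤ 1) : unif (Set.Iic c) = ENNReal.ofReal c := by
  rw [unif, Measure.restrict_apply measurableSet_Iic]
  have : Set.Iic c ∩ Set.Icc 0 1 = Set.Icc 0 c := by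
    ext x; simp only [Set.mem_inter_iff, Set.mem_Iic, Set.mem_Icc]; constructor
    · rintro ⟨h, h', -⟩; exact ⟨h', h⟩
    · rintro ⟨h, h'⟩; exact ⟨h', h, h'.trans h1⟩
  rw [this, Real.volume_Icc, sub_zero]

/-- Given X, the uniform lies below the exponential with probability equal to that exponential,
which is at most 1 as `a` is ahead of `b`. Averaging over X gives the ratio. -/
theorem cellLaw_beyond (hH : HasRange H n σ) (hdraw : IsGibbsOracle H β ν draw) {a b : ℝ}
    (hb : b ∈ Set.Icc 0 β) (hab : 0 ≤ σ.toReal * (a - b)) :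
    cellLaw ν {p | p.2 ≤ Real.exp (-(a - b) * H (draw b p.1))}
      = ENNReal.ofReal (partitionFunction H a / partitionFunction H b) := by
  have hm : Measurable fun s : S => H (draw b s) :=
    (hdraw.measurable_comp H).comp (by fun_prop : Measurable fun s : S => (b, s))
  have hms : MeasurableSet {p : S × ℝ | p.2 ≤ Real.exp (-(a - b) * H (draw b p.1))} :=
    measurableSet_le measurable_snd
      (Real.measurable_exp.comp ((hm.comp measurable_fst).const_mul _))
  rw [cellLaw, Measure.prod_apply hms, ← hdraw.lintegral_exp hb]
  refine lintegral_congr fun s =>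
    unif_Iic (c := Real.exp (-(a - b) * H (draw b s))) (Real.exp_le_one_iff.2 ?_)
  have h1 := mul_nonneg hab (hH.nonneg (draw b s))
  have h2 : σ.toReal * (a - b) * (σ.toReal * H (draw b s)) = (a - b) * H (draw b s) := by
    linear_combination ((a - b) * H (draw b s)) * σ.toReal_mul_self
  linarith

/-- In logarithmic scale a step of TPA moves by an exponentially distributed amount. -/
theorem map_remaining_tpaNext (hH : HasRange H n σ)
    (hdraw : IsGibbsOracle H β ν draw) {b : ℝ} (hb : b ∈ Set.Icc 0 β) :
    (cellLaw ν).map (fun c => remaining H σ β (tpaNext H σ β draw b c))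
      = unif.map fun u => max (remaining H σ β b + Real.log u) 0 := by
  have hm1 : Measurable fun c => remaining H σ β (tpaNext H σ β draw b c) :=
    continuous_remaining.measurable.comp
      (hdraw.measurable_tpaNext.comp (by fun_prop : Measurable fun c : S × ℝ => (b, c)))
  have hm2 : Measurable fun u => max (remaining H σ β b + Real.log u) 0 := by fun_prop
  have := Measure.isProbabilityMeasure_map (μ := cellLaw ν) hm1.aemeasurable
  have := Measure.isProbabilityMeasure_map (μ := unif) hm2.aemeasurable
  -- Distribution functions are compared at y. Outside [0, r), with r the current distance, both are
  -- 0 or 1. Inside, y is the distance of some parameter a by the intermediate value theorem, and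
  -- both equal Z(a)/Z(b) = e^{y-r}.
  refine Measure.ext_of_Iic _ _ fun y => ?_
  rw [Measure.map_apply hm1 measurableSet_Iic, Measure.map_apply hm2 measurableSet_Iic]
  have hr := remaining_nonneg hH (β := β) hb
  rcases lt_or_ge y 0 with hy | hy
  · have h2 : (fun u => max (remaining H σ β b + Real.log u) 0) ⁻¹' Set.Iic y = ∅ := by
      ext u; simp [hy]
    rw [h2, measure_empty]
    refine measure_mono_null (t := {c | ¬ c.2 ∈ Set.Ioc (0 : ℝ) 1}) (fun c hc hc' => ?_)
      (ae_cellLaw_mem ν)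
    have := remaining_nonneg hH (tpaNext_mem (draw := draw) hH hb hc').1
    exact absurd (this.trans hc) (not_le.2 hy)
  rcases le_or_gt (remaining H σ β b) y with hy' | hy'
  · trans 1
    · rw [prob_compl_eq_zero_iff (hm1 measurableSet_Iic) |>.symm]
      refine measure_mono_null (t := {c | ¬ c.2 ∈ Set.Ioc (0 : ℝ) 1}) (fun c hc hc' => hc ?_)
        (ae_cellLaw_mem ν)
      exact (remaining_le hH (tpaNext_mem (draw := draw) hH hb hc').2).trans hy'
    · symm
      rw [prob_compl_eq_zero_iff (hm2 measurableSet_Iic) |>.symm]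
      refine measure_mono_null (t := {c | ¬ c ∈ Set.Ioc (0 : ℝ) 1}) (fun c hc hc' => hc ?_)
        ae_unif_mem
      have := Real.log_nonpos hc'.1.le hc'.2
      simp only [Set.mem_preimage, Set.mem_Iic, max_le_iff]
      exact ⟨by linarith, hy⟩
  · have hne : ∃ x, H x ≠ 0 := by
      by_contra! h0
      have : remaining H σ β b = 0 := by simp [remaining, partitionFunction, h0]
      linarith
    obtain ⟨a, hab, hae, hay⟩ := exists_remaining_eq (H := H) hb hy hy'.le
    have e1 : cellLaw ν ((fun c => remaining H σ β (tpaNext H σ β draw b c)) ⁻¹' Set.Iic y)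
        = cellLaw ν {p | p.2 ≤ Real.exp (-(a - b) * H (draw b p.1))} := by
      refine measure_congr ?_
      filter_upwards [ae_cellLaw_mem ν] with c hc
      refine propext ?_
      change remaining H σ β (tpaNext H σ β draw b c) ≤ y ↔ _
      rw [← hay, remaining_le_remaining_iff hH hne, tpaNext_beyond_iff hH hc hae]
      rfl
    have e2 : unif ((fun u => max (remaining H σ β b + Real.log u) 0) ⁻¹' Set.Iic y)
        = unif (Set.Iic (Real.exp (y - remaining H σ β b))) := by
      refine measure_congr ?_
      filter_upwards [ae_unif_mem] with u hu
      refine propext ?_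
      change max (remaining H σ β b + Real.log u) 0 ≤ y ↔ u ≤ _
      rw [max_le_iff, ← Real.log_le_iff_le_exp hu.1]
      constructor
      · rintro ⟨h, -⟩; linarith
      · intro h; exact ⟨by linarith, hy⟩
    rw [e1, e2, cellLaw_beyond hH hdraw hb hab, unif_Iic (Real.exp_le_one_iff.2 (by linarith))]
    congr 1
    rw [← hay, remaining, remaining, sub_sub_sub_cancel_right, Real.exp_sub,
      Real.exp_log (partitionFunction_pos H a), Real.exp_log (partitionFunction_pos H b)]

theorem lintegral_comp_tpaNext (hH : HasRange H n σ)
    (hdraw : IsGibbsOracle H β ν draw) {b : ℝ} (hb : b ∈ Set.Icc 0 β) {f : ℝ → ℝ≥0∞}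
    (hf : Measurable f) :
    ∫⁻ c, f (remaining H σ β (tpaNext H σ β draw b c)) ∂cellLaw ν
      = ∫⁻ u in Set.Icc (0 : ℝ) 1, f (max (remaining H σ β b + Real.log u) 0) := by
  have hm1 : Measurable fun c => remaining H σ β (tpaNext H σ β draw b c) :=
    continuous_remaining.measurable.comp
      (hdraw.measurable_tpaNext.comp (by fun_prop : Measurable fun c : S × ℝ => (b, c)))
  rw [← lintegral_map hf hm1, map_remaining_tpaNext hH hdraw hb, lintegral_map hf (by fun_prop)]
  rfl

end Step

/-! ### Integrals over an exponential step -/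

section ExponentialStep

/-- The fundamental theorem of calculus along an exponential step: if `G' + G = f` on `(0, ∞)` up
to a countable set and `G 0 = f 0`, then `f` has mean `G r` after a step from `r`. -/
theorem lintegral_exponential_step {r : ℝ} (hr : 0 ≤ r) {f G : ℝ → ℝ} (hf : Measurable f)
    (hf0 : ∀ y, 0 ≤ f y) {C : ℝ} (hfC : ∀ y ≤ r, f y ≤ C) (hG : Continuous G) (hG0 : G 0 = f 0)
    {s : Set ℝ} (hs : s.Countable)
    (hderiv : ∀ y, 0 < y → y ∉ s → HasDerivAt G (f y - G y) y) :
    ∫⁻ u in Set.Icc (0 : ℝ) 1, ENNReal.ofReal (f (max (r + Real.log u) 0))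
      = ENNReal.ofReal (G r) := by
  have hint : IntervalIntegrable (fun u => f (max (r + Real.log u) 0)) volume 0 1 := by
    rw [intervalIntegrable_iff_integrableOn_Ioc_of_le zero_le_one]
    refine Integrable.of_bound (C := C) (hf.comp (by fun_prop)).aestronglyMeasurable ?_
    filter_upwards [ae_restrict_mem measurableSet_Ioc] with u hu
    rw [Real.norm_of_nonneg (hf0 _)]
    refine hfC _ (max_le ?_ hr)
    linarith [Real.log_nonpos hu.1.le hu.2]
  -- The antiderivative is u G(max(r + ln u, 0)): its derivative is G + G' = f while r + ln u > 0,
  -- and G 0 = f 0 below. It vanishes at u = 0 and equals G r at u = 1.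
  have hcont : ContinuousOn (fun u => u * G (max (r + Real.log u) 0)) (Set.Icc 0 1) := by
    intro u hu
    refine ContinuousAt.continuousWithinAt ?_
    rcases eq_or_lt_of_le hu.1 with rfl | h0
    -- Near 0 the maximum is 0. The convention ln 0 = 0 spoils this at u = 0 itself, where the
    -- factor u removes the damage.
    · have : (fun u => u * G (max (r + Real.log u) 0)) =ᶠ[𝓝 0] fun u => u * G 0 := by
        filter_upwards [Metric.ball_mem_nhds (0 : ℝ) (Real.exp_pos (-r))] with u hu
        rcases eq_or_ne u 0 with rfl | hne
        · simp
        rw [max_eq_right]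
        have h1 : Real.log |u| < -r := by
          rw [Real.log_lt_iff_lt_exp (abs_pos.2 hne)]; simpa using hu
        rw [Real.log_abs] at h1; linarith
      exact ContinuousAt.congr (by fun_prop) this.symm
    · have := Real.continuousAt_log h0.ne'
      have h2 : ContinuousAt (fun u => max (r + Real.log u) 0) u :=
        (this.const_add r).max continuousAt_const
      exact continuousAt_id.mul (hG.continuousAt.comp h2)
  have hd : ∀ u ∈ Set.Ioo (0 : ℝ) 1 \ ((fun y => Real.exp (y - r)) '' (insert 0 s)),
      HasDerivAt (fun u => u * G (max (r + Real.log u) 0)) (f (max (r + Real.log u) 0)) u := by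
    rintro u ⟨hu, hus⟩
    have hne : ∀ y ∈ insert 0 s, r + Real.log u ≠ y := by
      rintro y hy rfl
      exact hus ⟨_, hy, by simp [Real.exp_log hu.1]⟩
    have hlog : HasDerivAt (fun u => r + Real.log u) u⁻¹ u :=
      (Real.hasDerivAt_log hu.1.ne').const_add r
    rcases lt_or_gt_of_ne (hne 0 (by simp)) with h | h
    · have : (fun u => u * G (max (r + Real.log u) 0)) =ᶠ[𝓝 u] fun u => u * f 0 := by
        filter_upwards [hlog.continuousAt.eventually_lt continuousAt_const h] with v hv
        rw [max_eq_right hv.le, hG0]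
      rw [max_eq_right h.le]
      simpa using ((hasDerivAt_id u).mul_const (f 0)).congr_of_eventuallyEq this
    · have : (fun u => u * G (max (r + Real.log u) 0)) =ᶠ[𝓝 u]
          fun u => u * G (r + Real.log u) := by
        filter_upwards [continuousAt_const.eventually_lt hlog.continuousAt h] with v hv
        rw [max_eq_left hv.le]
      rw [max_eq_left h.le]
      have h1 := (hderiv _ h fun hy => hne _ (by simp [hy]) rfl).comp u hlog
      have h2 := ((hasDerivAt_id u).mul h1).congr_of_eventuallyEq this
      refine h2.congr_deriv ?_
      have := hu.1.ne'
      simp only [Function.comp, id]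
      field_simp
      ring
  have := integral_eq_of_hasDerivAt_off_countable_of_le _ _ zero_le_one
    ((hs.insert 0).image _) hcont hd hint
  rw [← restrict_Ioc_eq_restrict_Icc, ← ofReal_integral_eq_lintegral_ofReal
    ((intervalIntegrable_iff_integrableOn_Ioc_of_le zero_le_one).1 hint)
    (Eventually.of_forall fun u => hf0 _), ← intervalIntegral.integral_of_le zero_le_one, this]
  simp [hr]

/-- Here G = id, so G + G' = 1 + y: on average the distance lost in a step equals the probability of
finding a point. -/
theorem lintegral_exponential_step_count {r : ℝ} (hr : 0 ≤ r) :
    ∫⁻ u in Set.Icc (0 : ℝ) 1, ENNReal.ofReal (if 0 < max (r + Real.log u) 0 then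
      1 + max (r + Real.log u) 0 else 0) = ENNReal.ofReal r := by
  refine lintegral_exponential_step (f := fun y => if 0 < y then 1 + y else 0) (G := id)
    (s := ∅) (C := 1 + r) hr ?_ (fun y => ?_) (fun y hy => ?_) continuous_id (by simp)
    Set.countable_empty fun y hy _ => ?_
  · exact Measurable.ite measurableSet_Ioi (by fun_prop) measurable_const
  · split_ifs with h
    · linarith
    · exact le_rfl
  · split_ifs <;> linarith
  · simpa [hy] using hasDerivAt_id y

/-- The length of the part of `(α, α + l]` below `y`. -/
def overlap (α l y : ℝ) : ℝ := min (max (y - α) 0) l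

theorem continuous_overlap (α l : ℝ) : Continuous (overlap α l) := by
  unfold overlap; fun_prop

theorem overlap_nonneg {α l : ℝ} (hl : 0 ≤ l) (y : ℝ) : 0 ≤ overlap α l y :=
  le_min (le_max_right _ _) hl

/-- With G = exp(-θ · overlap), G' = -θG inside the block and G' = 0 off it, so G + G' is G with a
factor 1 - θ exactly on the block. The kinks at the ends of the block form the exceptional set. -/
theorem lintegral_exponential_step_exp {r α l θ : ℝ} (hr : 0 ≤ r) (hα : 0 ≤ α) (hl : 0 ≤ l)
    (hθ : 0 ≤ θ) (hθ' : θ ≤ 1) :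
    ∫⁻ u in Set.Icc (0 : ℝ) 1, ENNReal.ofReal
      ((if max (r + Real.log u) 0 ∈ Set.Ioc α (α + l) then 1 - θ else 1)
        * Real.exp (-θ * overlap α l (max (r + Real.log u) 0)))
      = ENNReal.ofReal (Real.exp (-θ * overlap α l r)) := by
  refine lintegral_exponential_step
    (f := fun y => (if y ∈ Set.Ioc α (α + l) then 1 - θ else 1) * Real.exp (-θ * overlap α l y))
    (G := fun y => Real.exp (-θ * overlap α l y))
    (s := {α, α + l}) (C := 1) hr ?_ (fun y => ?_) (fun y hy => ?_) ?_ ?_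
    (by simp) fun y hy hys => ?_
  · exact (Measurable.ite measurableSet_Ioc measurable_const measurable_const).mul
      (Real.measurable_exp.comp ((continuous_overlap α l).measurable.const_mul _))
  · refine mul_nonneg ?_ (Real.exp_nonneg _)
    split_ifs <;> linarith
  · refine mul_le_one₀ ?_ (Real.exp_nonneg _) (Real.exp_le_one_iff.2 ?_)
    · split_ifs <;> linarith
    · have := mul_nonneg hθ (overlap_nonneg (α := α) hl y)
      linarith
  · have := continuous_overlap α l
    fun_prop
  · simp [not_lt.2 hα]
  · simp only [Set.mem_insert_iff, Set.mem_singleton_iff, not_or] at hys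
    rcases lt_or_gt_of_ne hys.1 with h | h
    · have h1 : (fun y => Real.exp (-θ * overlap α l y)) =ᶠ[𝓝 y] fun _ => 1 := by
        filter_upwards [eventually_lt_nhds h] with z hz
        rw [overlap, max_eq_right (by linarith), min_eq_left hl]; simp
      have h2 : y ∉ Set.Ioc α (α + l) := fun h' => absurd h'.1 (by linarith)
      simpa [h2] using (hasDerivAt_const y (1 : ℝ)).congr_of_eventuallyEq h1
    rcases lt_or_gt_of_ne hys.2 with h' | h'
    · have h1 : (fun y => Real.exp (-θ * overlap α l y)) =ᶠ[𝓝 y]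
          fun y => Real.exp (-θ * (y - α)) := by
        filter_upwards [eventually_lt_nhds h', eventually_gt_nhds h] with z hz hz'
        rw [overlap, max_eq_left (by linarith), min_eq_left (by linarith)]
      have h2 : y ∈ Set.Ioc α (α + l) := ⟨h, h'.le⟩
      have h3 : HasDerivAt (fun y => Real.exp (-θ * (y - α)))
          (Real.exp (-θ * (y - α)) * (-θ * 1)) y :=
        (((hasDerivAt_id y).sub_const α).const_mul (-θ)).exp
      refine (h3.congr_of_eventuallyEq h1).congr_deriv ?_
      simp only [h2, if_true, h1.eq_of_nhds]
      ring
    · have h1 : (fun y => Real.exp (-θ * overlap α l y)) =ᶠ[𝓝 y] fun _ => Real.exp (-θ * l) := by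
        filter_upwards [eventually_gt_nhds h'] with z hz
        rw [overlap, max_eq_left (by linarith), min_eq_right (by linarith)]
      have h2 : y ∉ Set.Ioc α (α + l) := fun h'' => absurd h''.2 (by linarith)
      simpa [h2] using (hasDerivAt_const y _).congr_of_eventuallyEq h1

end ExponentialStep

/-! ### The course of a run of TPA -/

section Run

variable {Ω S : Type*} (H : Ω → ℝ) (σ : HamiltonianSign) (β : ℝ) (draw : ℝ → S → Ω)

/-- The parameter value after `t` steps, which stays at the end once the run has stopped. -/
def tpaValue (cells : ℕ → S × ℝ) (t : ℕ) : ℝ :=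
  (tpaState H σ β draw cells t).getD (tpaEnd β σ)

/-- The points of a run whose coin does not exceed `κ`. -/
def keptPoints (κ : ℝ) (cells : ℕ → S × ℝ) (coins : ℕ → ℝ) : List ℝ :=
  ((tpaPoints H σ β draw cells).filter fun p => decide (coins p.1 ≤ κ)).map Prod.snd

variable {H σ β draw} {cells : ℕ → S × ℝ} {coins : ℕ → ℝ} {κ : ℝ}

theorem tpaState_continues (hβ : 0 < β) {t : ℕ} {b : ℝ}
    (h : tpaState H σ β draw cells t = some b) : b ≠ tpaEnd β σ := by
  cases t with
  | zero =>
    simp only [tpaState, Option.some.injEq] at h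
    exact h ▸ tpaStart_ne_tpaEnd hβ σ
  | succ t =>
    simp only [tpaState, Option.bind_eq_some_iff] at h
    obtain ⟨y, -, hy⟩ := h
    have h1 : tpaNext H σ β draw y (cells t) = b := by simp [tpaNext, hy]
    rw [← h1, tpaNext_ne_end, hy]
    simp

theorem tpaValue_ne_iff (hβ : 0 < β) {t : ℕ} :
    tpaValue H σ β draw cells t ≠ tpaEnd β σ ↔ tpaState H σ β draw cells t ≠ none := by
  unfold tpaValue
  cases h : tpaState H σ β draw cells t with
  | none => simp
  | some b => simpa using tpaState_continues hβ h

theorem tpaState_eq_some (hβ : 0 < β) {t : ℕ}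
    (h : tpaValue H σ β draw cells t ≠ tpaEnd β σ) :
    tpaState H σ β draw cells t = some (tpaValue H σ β draw cells t) := by
  obtain ⟨y, hy⟩ := Option.ne_none_iff_exists'.1 ((tpaValue_ne_iff hβ).1 h)
  simp [tpaValue, hy]

theorem tpaValue_zero : tpaValue H σ β draw cells 0 = tpaStart β σ := rfl

theorem tpaValue_succ (hβ : 0 < β) (t : ℕ) :
    tpaValue H σ β draw cells (t + 1) = if tpaValue H σ β draw cells t = tpaEnd β σ then
      tpaEnd β σ else tpaNext H σ β draw (tpaValue H σ β draw cells t) (cells t) := by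
  split_ifs with h
  · have : tpaState H σ β draw cells t = none := by
      by_contra h'; exact (tpaValue_ne_iff hβ).2 h' h
    simp [tpaValue, tpaState, this]
  · rw [tpaValue, tpaState, tpaState_eq_some hβ h]; rfl

theorem tpaValue_eq_of_le (hβ : 0 < β) {t u : ℕ} (htu : t ≤ u)
    (h : tpaValue H σ β draw cells t = tpaEnd β σ) :
    tpaValue H σ β draw cells u = tpaEnd β σ := by
  induction u, htu using Nat.le_induction with
  | base => exact h
  | succ u _ ih => rw [tpaValue_succ hβ, if_pos ih]

theorem tpaDraws_ne_top_iff (hβ : 0 < β) :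
    tpaDraws H σ β draw cells ≠ ⊤ ↔ ∃ t, tpaValue H σ β draw cells t = tpaEnd β σ := by
  have : (∃ t, tpaValue H σ β draw cells t = tpaEnd β σ) ↔
      ∃ t, tpaState H σ β draw cells t = none :=
    exists_congr fun t => not_iff_not.1 (tpaValue_ne_iff hβ)
  rw [this, tpaDraws]
  split_ifs with h <;> simp [h]

theorem tpaValue_ne_iff_lt (hβ : 0 < β) (htop : tpaDraws H σ β draw cells ≠ ⊤) {t : ℕ} :
    tpaValue H σ β draw cells t ≠ tpaEnd β σ ↔ t < (tpaDraws H σ β draw cells).toNat := by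
  classical
  have hex := (tpaDraws_ne_top_iff hβ).1 htop
  have hex' : ∃ t, tpaState H σ β draw cells t = none :=
    hex.imp fun t ht => not_not.1 fun h => (tpaValue_ne_iff hβ).2 h ht
  have hD : (tpaDraws H σ β draw cells).toNat = Nat.find hex' := by
    rw [tpaDraws, dif_pos hex']; rfl
  rw [hD]
  constructor
  · intro h
    by_contra! hle
    refine h (tpaValue_eq_of_le hβ hle ?_)
    exact not_not.1 fun h' => (tpaValue_ne_iff hβ).1 h' (Nat.find_spec hex')
  · intro h
    exact (tpaValue_ne_iff hβ).2 (Nat.find_min hex' h)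

theorem one_le_toNat_tpaDraws (hβ : 0 < β) (htop : tpaDraws H σ β draw cells ≠ ⊤) :
    1 ≤ (tpaDraws H σ β draw cells).toNat :=
  (tpaValue_ne_iff_lt hβ htop).1 (tpaStart_ne_tpaEnd hβ σ)

theorem tpaValue_succ_ne_of_lt (hβ : 0 < β) {t : ℕ}
    (ht : t < (tpaDraws H σ β draw cells).toNat - 1) :
    tpaValue H σ β draw cells (t + 1) ≠ tpaEnd β σ := by
  have htop : tpaDraws H σ β draw cells ≠ ⊤ := by
    intro h; simp [h] at ht
  rw [tpaValue_ne_iff_lt hβ htop]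
  omega

theorem tpaPoints_eq (hβ : 0 < β) :
    tpaPoints H σ β draw cells = (List.range ((tpaDraws H σ β draw cells).toNat - 1)).map
      fun t => (t, tpaValue H σ β draw cells (t + 1)) := by
  rw [tpaPoints, ← List.filterMap_eq_map]
  refine List.filterMap_congr fun t ht => ?_
  rw [tpaState_eq_some hβ (tpaValue_succ_ne_of_lt hβ (List.mem_range.1 ht))]
  rfl

theorem length_tpaPoints (hβ : 0 < β) :
    (tpaPoints H σ β draw cells).length = (tpaDraws H σ β draw cells).toNat - 1 := by
  simp [tpaPoints_eq hβ]

theorem length_tpaPoints_add_one (hβ : 0 < β) (htop : tpaDraws H σ β draw cells ≠ ⊤) :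
    (((tpaPoints H σ β draw cells).length + 1 : ℕ) : ℕ∞) = tpaDraws H σ β draw cells := by
  rw [length_tpaPoints hβ, Nat.sub_add_cancel (one_le_toNat_tpaDraws hβ htop),
    ENat.natCast_toNat htop]

open Classical in
theorem countP_keptPoints (hβ : 0 < β) (B : Set ℝ) :
    (keptPoints H σ β draw κ cells coins).countP (fun x => decide (x ∈ B))
      = ∑ t ∈ Finset.range ((tpaDraws H σ β draw cells).toNat - 1),
          if tpaValue H σ β draw cells (t + 1) ∈ B ∧ coins t ≤ κ then 1 else 0 := by
  rw [keptPoints, tpaPoints_eq hβ]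
  generalize (tpaDraws H σ β draw cells).toNat - 1 = m
  induction m with
  | zero => simp
  | succ m ih =>
    rw [List.range_succ, Finset.sum_range_succ, List.map_append, List.filter_append,
      List.map_append, List.countP_append, ih]
    congr 1
    by_cases h1 : coins m ≤ κ <;> by_cases h2 : tpaValue H σ β draw cells (m + 1) ∈ B <;>
      simp [h1, h2]

theorem length_keptPoints (hβ : 0 < β) :
    (keptPoints H σ β draw κ cells coins).length
      = ∑ t ∈ Finset.range ((tpaDraws H σ β draw cells).toNat - 1),
          if coins t ≤ κ then 1 else 0 := by
  classical
  have := countP_keptPoints (H := H) (σ := σ) (draw := draw) (cells := cells) (coins := coins)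
    (κ := κ) hβ Set.univ
  simpa using this

theorem mem_keptPoints (hβ : 0 < β) {x : ℝ} (hx : x ∈ keptPoints H σ β draw κ cells coins) :
    ∃ t, x = tpaValue H σ β draw cells (t + 1) := by
  rw [keptPoints, tpaPoints_eq hβ] at hx
  simp only [List.mem_map, List.mem_filter] at hx
  obtain ⟨p, ⟨⟨t, -, rfl⟩, -⟩, rfl⟩ := hx
  exact ⟨t, rfl⟩

theorem tpaValue_mem {n : ℕ} (hH : HasRange H n σ) (hβ : 0 < β)
    (hcells : ∀ t, (cells t).2 ∈ Set.Ioc (0 : ℝ) 1) (t : ℕ) :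
    tpaValue H σ β draw cells t ∈ Set.Icc 0 β := by
  induction t with
  | zero => exact tpaStart_mem hβ σ
  | succ t ih =>
    rw [tpaValue_succ hβ]
    split_ifs
    · exact tpaEnd_mem hβ σ
    · exact (tpaNext_mem hH ih (hcells t)).1

open Classical in
-- The first draw is always made, and each surviving step causes one more. An infinite sum also
-- covers runs that never stop, so that termination can be deduced from a finite mean.
theorem toENNReal_tpaDraws (hβ : 0 < β) :
    (tpaDraws H σ β draw cells : ℝ≥0∞)
      = 1 + ∑' t, if tpaValue H σ β draw cells (t + 1) ≠ tpaEnd β σ then 1 else 0 := by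
  by_cases htop : tpaDraws H σ β draw cells = ⊤
  · have : ∀ t, tpaValue H σ β draw cells t ≠ tpaEnd β σ := by
      by_contra! h
      exact (tpaDraws_ne_top_iff hβ).2 h htop
    simp [htop, this]
  · obtain ⟨m, hm⟩ := ENat.ne_top_iff_exists.1 htop
    have h1 : ∀ t, tpaValue H σ β draw cells (t + 1) ≠ tpaEnd β σ ↔ t + 1 < m := fun t => by
      rw [tpaValue_ne_iff_lt hβ htop, ← hm]; rfl
    have h2 : 1 ≤ m := by
      have := one_le_toNat_tpaDraws hβ htop
      rwa [← hm] at this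
    simp_rw [h1]
    rw [tsum_eq_sum (s := Finset.range (m - 1)), ← hm]
    · rw [Finset.sum_congr rfl fun t ht => if_pos (by have := Finset.mem_range.1 ht; omega)]
      obtain ⟨k, rfl⟩ := Nat.exists_eq_add_of_le h2
      simp
    · intro t ht
      rw [Finset.mem_range] at ht
      exact if_neg (by omega)

end Run

/-! ### The law of a run of TPA -/

section RunLaw

variable {Ω S : Type*} {H : Ω → ℝ} {σ : HamiltonianSign} {β : ℝ} {draw : ℝ → S → Ω}
  {a a' : ℕ → Cell}

variable (H σ β draw a) in
/-- The value after `t` steps of the run which reads the cells `a 0, a 1, …`. -/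
def runValue (t : ℕ) (ω : Randomness S) : ℝ := tpaValue H σ β draw (fun i => ω (a i)) t

theorem runValue_succ (hβ : 0 < β) (t : ℕ) (ω : Randomness S) :
    runValue H σ β draw a (t + 1) ω = if runValue H σ β draw a t ω = tpaEnd β σ then
      tpaEnd β σ else tpaNext H σ β draw (runValue H σ β draw a t ω) (ω (a t)) :=
  tpaValue_succ hβ t

theorem dependsOn_runValue (hβ : 0 < β) (t : ℕ) :
    DependsOn (runValue H σ β draw a t) (a '' Set.Iio t) := by
  induction t with
  | zero => exact fun _ _ _ => rfl
  | succ t ih =>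
    intro x y hxy
    have h1 := ih fun i hi => hxy i (Set.image_mono (Set.Iio_subset_Iio t.le_succ) hi)
    rw [runValue_succ hβ, runValue_succ hβ, h1,
      hxy (a t) (Set.mem_image_of_mem a (Set.mem_Iio.2 t.lt_succ_self))]

variable [Fintype Ω] [MeasurableSpace S] {ν : Measure S} {n : ℕ}

theorem IsGibbsOracle.measurable_runValue (hdraw : IsGibbsOracle H β ν draw) (hβ : 0 < β)
    (t : ℕ) : Measurable (runValue H σ β draw a t) := by
  induction t with
  | zero => exact measurable_const
  | succ t ih =>
    have : runValue H σ β draw a (t + 1) = fun ω =>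
        if runValue H σ β draw a t ω = tpaEnd β σ then
          tpaEnd β σ else tpaNext H σ β draw (runValue H σ β draw a t ω) (ω (a t)) :=
      funext fun ω => runValue_succ hβ t ω
    rw [this]
    exact Measurable.ite (ih (measurableSet_singleton _)) measurable_const
      (hdraw.measurable_tpaNext.comp (ih.prodMk (measurable_pi_apply _)))

theorem IsGibbsOracle.measurable_tpaDraws (hdraw : IsGibbsOracle H β ν draw) (hβ : 0 < β) :
    Measurable fun ω : Randomness S => tpaDraws H σ β draw fun i => ω (a i) := by
  have hm : ∀ t, MeasurableSet {ω : Randomness S | runValue H σ β draw a t ω = tpaEnd β σ} :=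
    fun t => (hdraw.measurable_runValue hβ t) (measurableSet_singleton _)
  have htop : MeasurableSet {ω : Randomness S |
      tpaDraws H σ β draw (fun i => ω (a i)) ≠ ⊤} := by
    simp only [tpaDraws_ne_top_iff hβ, Set.ofPred_exists]
    exact MeasurableSet.iUnion hm
  have hle : ∀ t : ℕ, {ω : Randomness S | tpaDraws H σ β draw (fun i => ω (a i)) ≤ (t : ℕ∞)}
      = {ω | runValue H σ β draw a t ω = tpaEnd β σ} := fun t => by
    ext ω
    simp only [Set.mem_ofPred_eq]
    by_cases h : tpaDraws H σ β draw (fun i => ω (a i)) = ⊤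
    · rw [h]
      simp only [top_le_iff, ENat.natCast_ne_top, false_iff]
      intro h'
      exact (tpaDraws_ne_top_iff hβ).2 ⟨t, h'⟩ h
    · rw [← not_iff_not, ← ne_eq, runValue, tpaValue_ne_iff_lt hβ h, not_le,
        ← ENat.natCast_toNat h]
      simp
  refine measurable_to_countable' fun m => ?_
  induction m using ENat.recTopCoe with
  | top => convert! htop.compl using 1; ext; simp
  | coe m =>
    cases m with
    | zero => convert! hm 0 using 1; rw [← hle]; ext; simp
    | succ m =>
      convert! (hm (m + 1)).diff (hm m) using 1
      rw [← hle, ← hle]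
      ext ω
      simp only [Set.mem_preimage, Set.mem_singleton_iff, Set.mem_sdiff, Set.mem_ofPred_eq, not_le]
      generalize tpaDraws H σ β draw (fun i => ω (a i)) = D
      induction D using ENat.recTopCoe with
      | top => simpa using (ENat.natCast_ne_top (m + 1)).symm
      | coe D => norm_cast; omega

variable [Nonempty Ω] [IsProbabilityMeasure ν]

theorem ae_randomness_mem :
    ∀ᵐ ω ∂randomnessLaw ν, ∀ c, (ω c).2 ∈ Set.Ioc (0 : ℝ) 1 := by
  have : Countable Cell := by
    let f : Cell → Bool × Bool × ℕ × ℕ := fun c => match c with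
      | .pilot j t => (true, true, j, t)
      | .main j t => (true, false, j, t)
      | .thin j t => (false, true, j, t)
      | .est j t => (false, false, j, t)
    refine Function.Injective.countable (f := f) fun c c' h => ?_
    cases c <;> cases c' <;> simp_all [f]
  refine ae_all_iff.2 fun c => ?_
  rw [randomnessLaw_eq]
  exact (measurePreserving_eval_infinitePi (fun _ : Cell => cellLaw ν) c).quasiMeasurePreserving.ae
    (ae_cellLaw_mem ν)

theorem ae_runValue_mem (hH : HasRange H n σ) (hβ : 0 < β) :
    ∀ᵐ ω ∂randomnessLaw ν, ∀ t, runValue H σ β draw a t ω ∈ Set.Icc 0 β := by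
  filter_upwards [ae_randomness_mem] with ω hω t
  exact tpaValue_mem hH hβ (fun i => hω _) t

/-- Integration over two cells of which the other part of the integrand is independent. -/
theorem lintegral_pair {i i' : Cell} (hi : i ≠ i')
    {f : Randomness S → (S × ℝ) × (S × ℝ) → ℝ≥0∞} (hf : Measurable (Function.uncurry f))
    (hfi : DependsOn f {i, i'}ᶜ) :
    ∫⁻ ω, f ω (ω i, ω i') ∂randomnessLaw ν
      = ∫⁻ ω, ∫⁻ c, ∫⁻ c', f ω (c, c') ∂cellLaw ν ∂cellLaw ν ∂randomnessLaw ν := by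
  rw [randomnessLaw_eq, lintegral_splice {i, i'} (cellLaw ν)
    (f := fun ω => f ω (ω i, ω i')) (hf.comp (by fun_prop : Measurable fun ω : Randomness S => (ω, (ω i, ω i'))))]
  have h1 : ∀ x y : Randomness S,
      f (splice {i, i'} (x, y)) (splice {i, i'} (x, y) i, splice {i, i'} (x, y) i')
        = f y (x i, x i') := fun x y => by
    rw [DependsOn.splice_right hfi, splice_of_mem (by simp), splice_of_mem (by simp)]
  simp only [h1]
  rw [lintegral_lintegral_swap]
  · refine lintegral_congr fun y => ?_
    have h2 : Measurable fun p : (S × ℝ) × (S × ℝ) => f y p :=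
      hf.comp (measurable_const.prodMk measurable_id)
    rw [← lintegral_map (f := fun p => f y p) (g := fun x : Randomness S => (x i, x i')) h2
      (by fun_prop), Measure.infinitePi_map_eval_prod hi, lintegral_prod _ h2.aemeasurable]
  · exact (hf.comp (by fun_prop : Measurable fun p : Randomness S × Randomness S =>
      (p.2, (p.1 i, p.1 i')))).aemeasurable

variable (H σ β draw) in
/-- One step of a run, from a value which is the end if the run has stopped. -/
def tpaMove (y : ℝ) (c : S × ℝ) : ℝ :=
  if y = tpaEnd β σ then tpaEnd β σ else tpaNext H σ β draw y c

theorem IsGibbsOracle.measurable_tpaMove (hdraw : IsGibbsOracle H β ν draw) :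
    Measurable fun p : ℝ × (S × ℝ) => tpaMove H σ β draw p.1 p.2 :=
  Measurable.ite (measurable_fst (measurableSet_singleton _)) measurable_const
    hdraw.measurable_tpaNext

theorem remaining_pos_of_tpaNext_ne (hH : HasRange H n σ) {y : ℝ} (hy : y ∈ Set.Icc 0 β)
    {c : S × ℝ} (hc : c.2 ∈ Set.Ioc (0 : ℝ) 1) (h : tpaNext H σ β draw y c ≠ tpaEnd β σ) :
    0 < remaining H σ β (tpaNext H σ β draw y c) := by
  have h1 := ((mem_Icc_iff_toReal (σ := σ)).1 (tpaNext_mem (draw := draw) hH hy hc).1).1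
  rw [← remaining_tpaEnd (H := H) (σ := σ) (β := β)]
  refine remaining_lt hH (lt_of_le_of_ne h1 fun h0 => ?_) (exists_ne_zero_of_tpaNext_ne h)
  rcases mul_eq_zero.1 h0.symm with h2 | h2
  · have := σ.toReal_mul_self
    simp [h2] at this
  · exact h (sub_eq_zero.1 h2).symm

open Classical in
theorem lintegral_tpaMove_count (hH : HasRange H n σ) (hdraw : IsGibbsOracle H β ν draw)
    {y : ℝ} (hy : y ∈ Set.Icc 0 β) :
    ∫⁻ c, ((if tpaMove H σ β draw y c ≠ tpaEnd β σ then 1 else 0)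
        + ENNReal.ofReal (remaining H σ β (tpaMove H σ β draw y c))) ∂cellLaw ν
      ≤ ENNReal.ofReal (remaining H σ β y) := by
  by_cases h : y = tpaEnd β σ
  · simp [tpaMove, h, remaining_tpaEnd]
  simp only [tpaMove, h, if_false]
  rw [← lintegral_exponential_step_count (remaining_nonneg hH hy),
    ← lintegral_comp_tpaNext (f := fun x => ENNReal.ofReal (if 0 < x then 1 + x else 0))
      hH hdraw hy
      (ENNReal.measurable_ofReal.comp (Measurable.ite measurableSet_Ioi (measurable_id.const_add 1)
        measurable_const))]
  refine lintegral_mono_ae ?_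
  filter_upwards [ae_cellLaw_mem ν] with c hc
  by_cases hne : tpaNext H σ β draw y c = tpaEnd β σ
  · simp [hne, remaining_tpaEnd]
  · have := remaining_pos_of_tpaNext_ne hH hy hc hne
    rw [if_pos hne, if_pos this, ENNReal.ofReal_add zero_le_one this.le, ENNReal.ofReal_one]

theorem cellLaw_coin {κ : ℝ} (hκ : κ ≤ 1) :
    cellLaw ν {c | c.2 ≤ κ} = ENNReal.ofReal κ := by
  have : {c : S × ℝ | c.2 ≤ κ} = Prod.snd ⁻¹' Set.Iic κ := rfl
  rw [this, cellLaw, ← Measure.map_apply measurable_snd measurableSet_Iic,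
    Measure.map_snd_prod, measure_univ, one_smul, unif_Iic hκ]

open Classical in
theorem lintegral_coin {κ s : ℝ} (hκ : 0 ≤ κ) (hκ' : κ ≤ 1) (hs : 0 ≤ s) :
    ∫⁻ c : S × ℝ, (if c.2 ≤ κ then ENNReal.ofReal s else 1) ∂cellLaw ν
      = ENNReal.ofReal (1 - κ * (1 - s)) := by
  have hm : MeasurableSet {c : S × ℝ | c.2 ≤ κ} := measurableSet_le measurable_snd measurable_const
  have : (fun c : S × ℝ => if c.2 ≤ κ then ENNReal.ofReal s else 1)
      = fun c => {c : S × ℝ | c.2 ≤ κ}.indicator (fun _ => ENNReal.ofReal s) c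
        + {c : S × ℝ | c.2 ≤ κ}ᶜ.indicator (fun _ => 1) c := by
    ext c
    by_cases h : c.2 ≤ κ <;> simp [h]
  rw [this, lintegral_add_left (measurable_const.indicator hm), lintegral_indicator_const hm,
    lintegral_indicator_const hm.compl, prob_compl_eq_one_sub hm, cellLaw_coin hκ',
    ← ENNReal.ofReal_mul hs, one_mul, ← ENNReal.ofReal_one, ← ENNReal.ofReal_sub _ hκ,
    ← ENNReal.ofReal_add (mul_nonneg hs hκ) (by linarith)]
  congr 1
  ring

open Classical in
-- The coin turns the mark s into the mean factor 1 - κ(1-s) on the block, which is the exponential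
-- step with θ = κ(1-s). A stopped run sits at distance 0, outside the block and with overlap 0.
theorem lintegral_tpaMove_exp (hH : HasRange H n σ) (hdraw : IsGibbsOracle H β ν draw)
    {y : ℝ} (hy : y ∈ Set.Icc 0 β) {κ s α l : ℝ} (hκ : 0 ≤ κ) (hκ' : κ ≤ 1) (hs : 0 ≤ s)
    (hs' : s ≤ 1) (hα : 0 ≤ α) (hl : 0 ≤ l) :
    ∫⁻ c, ∫⁻ c', (if remaining H σ β (tpaMove H σ β draw y c) ∈ Set.Ioc α (α + l) ∧ c'.2 ≤ κ then
        ENNReal.ofReal s else 1)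
        * ENNReal.ofReal (Real.exp (-(κ * (1 - s))
          * overlap α l (remaining H σ β (tpaMove H σ β draw y c)))) ∂cellLaw ν ∂cellLaw ν
      = ENNReal.ofReal (Real.exp (-(κ * (1 - s)) * overlap α l (remaining H σ β y))) := by
  have h1 : ∀ R : ℝ, ∫⁻ c' : S × ℝ, (if R ∈ Set.Ioc α (α + l) ∧ c'.2 ≤ κ then
        ENNReal.ofReal s else 1)
        * ENNReal.ofReal (Real.exp (-(κ * (1 - s)) * overlap α l R)) ∂cellLaw ν
      = ENNReal.ofReal ((if R ∈ Set.Ioc α (α + l) then 1 - κ * (1 - s) else 1)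
        * Real.exp (-(κ * (1 - s)) * overlap α l R)) := fun R => by
    have hm : Measurable fun c' : S × ℝ =>
        (if R ∈ Set.Ioc α (α + l) ∧ c'.2 ≤ κ then ENNReal.ofReal s else 1) :=
      Measurable.ite ((MeasurableSet.const _).inter
        (measurableSet_le measurable_snd measurable_const)) measurable_const measurable_const
    rw [lintegral_mul_const _ hm, ENNReal.ofReal_mul' (Real.exp_nonneg _)]
    congr 1
    by_cases hR : R ∈ Set.Ioc α (α + l)
    · simp only [hR, true_and, if_true]
      exact lintegral_coin hκ hκ' hs
    · simp [hR]
  simp only [h1]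
  by_cases h : y = tpaEnd β σ
  · have : (0 : ℝ) ∉ Set.Ioc α (α + l) := fun h => absurd h.1 (not_lt.2 hα)
    simp [tpaMove, h, remaining_tpaEnd, this]
  simp only [tpaMove, h, if_false]
  rw [lintegral_comp_tpaNext (f := fun R => ENNReal.ofReal
    ((if R ∈ Set.Ioc α (α + l) then 1 - κ * (1 - s) else 1)
        * Real.exp (-(κ * (1 - s)) * overlap α l R))) hH hdraw hy,
    lintegral_exponential_step_exp (remaining_nonneg hH hy) hα hl
      (mul_nonneg hκ (by linarith)) (mul_le_one₀ hκ' (by linarith) (by linarith))]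
  exact ENNReal.measurable_ofReal.comp
    ((Measurable.ite measurableSet_Ioc measurable_const measurable_const).mul
      (Real.measurable_exp.comp ((continuous_overlap α l).measurable.const_mul _)))

end RunLaw

/-! ### Mean length of a run and block counts of its points -/

section RunBounds

variable {Ω S : Type*} {H : Ω → ℝ} {σ : HamiltonianSign} {β : ℝ} {draw : ℝ → S → Ω}
  {a a' : ℕ → Cell} [Fintype Ω] [MeasurableSpace S] {ν : Measure S} {n : ℕ}
  [Nonempty Ω] [IsProbabilityMeasure ν]

theorem runValue_succ' (hβ : 0 < β) (t : ℕ) (ω : Randomness S) :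
    runValue H σ β draw a (t + 1) ω
      = tpaMove H σ β draw (runValue H σ β draw a t ω) (ω (a t)) :=
  runValue_succ hβ t ω

theorem dependsOn_runValue_compl (hβ : 0 < β) (ha : Function.Injective a)
    (haa' : ∀ i j, a i ≠ a' j) (t : ℕ) :
    DependsOn (runValue H σ β draw a t) {a t, a' t}ᶜ :=
  fun _ _ hxy => dependsOn_runValue hβ t fun i hi => hxy i <| by
    obtain ⟨j, hj, rfl⟩ := hi
    simp only [Set.mem_compl_iff, Set.mem_insert_iff, Set.mem_singleton_iff, not_or]
    exact ⟨fun h => (Set.mem_Iio.1 hj).ne (ha h), haa' j t⟩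

theorem IsGibbsOracle.measurableSet_runValue_ne (hdraw : IsGibbsOracle H β ν draw) (hβ : 0 < β)
    (t : ℕ) : MeasurableSet {ω : Randomness S | runValue H σ β draw a t ω ≠ tpaEnd β σ} :=
  ((hdraw.measurable_runValue hβ t) (measurableSet_singleton _)).compl

theorem measurableSet_coin (κ : ℝ) (c : Cell) :
    MeasurableSet {ω : Randomness S | (ω c).2 ≤ κ} :=
  measurableSet_le (by fun_prop) measurable_const

theorem IsGibbsOracle.measurable_remaining_runValue (hdraw : IsGibbsOracle H β ν draw)
    (hβ : 0 < β) (t : ℕ) :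
    Measurable fun ω : Randomness S => remaining H σ β (runValue H σ β draw a t ω) :=
  continuous_remaining.measurable.comp (hdraw.measurable_runValue hβ t)

open Classical in
-- The number of points found so far plus the remaining distance is a supermartingale, started at
-- the full distance.
theorem lintegral_sum_runValue_ne_add (hH : HasRange H n σ) (hβ : 0 < β)
    (hdraw : IsGibbsOracle H β ν draw) (ha : Function.Injective a) (haa' : ∀ i j, a i ≠ a' j)
    (T : ℕ) :
    ∫⁻ ω, (∑ t ∈ Finset.range T, (if runValue H σ β draw a (t + 1) ω ≠ tpaEnd β σ then 1 else 0)
        + ENNReal.ofReal (remaining H σ β (runValue H σ β draw a T ω))) ∂randomnessLaw ν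
      ≤ ENNReal.ofReal (remaining H σ β (tpaStart β σ)) := by
  induction T with
  | zero => simp [runValue, tpaValue_zero]
  | succ T ih =>
    have hm : ∀ t, Measurable fun ω : Randomness S =>
        (if runValue H σ β draw a (t + 1) ω ≠ tpaEnd β σ then (1 : ℝ≥0∞) else 0) := fun t =>
      Measurable.ite (hdraw.measurableSet_runValue_ne hβ _) measurable_const measurable_const
    have hms : Measurable fun ω : Randomness S => ∑ t ∈ Finset.range T,
        (if runValue H σ β draw a (t + 1) ω ≠ tpaEnd β σ then (1 : ℝ≥0∞) else 0) :=
      Finset.measurable_sum _ fun t _ => hm t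
    refine le_trans ?_ ih
    simp only [Finset.sum_range_succ, add_assoc]
    rw [lintegral_add_left hms, lintegral_add_left hms]
    refine add_le_add_right ?_ _
    -- Only the first of the two cells enters here; the second one is carried along to fit
    -- `lintegral_pair`.
    let f : Randomness S → (S × ℝ) × (S × ℝ) → ℝ≥0∞ := fun ω c =>
      (if tpaMove H σ β draw (runValue H σ β draw a T ω) c.1 ≠ tpaEnd β σ then 1 else 0)
        + ENNReal.ofReal (remaining H σ β (tpaMove H σ β draw (runValue H σ β draw a T ω) c.1))
    have hmove : Measurable fun p : Randomness S × ((S × ℝ) × (S × ℝ)) =>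
        tpaMove H σ β draw (runValue H σ β draw a T p.1) p.2.1 :=
      hdraw.measurable_tpaMove.comp (((hdraw.measurable_runValue hβ T).comp measurable_fst).prodMk
        (by fun_prop))
    have hf : Measurable (Function.uncurry f) :=
      (Measurable.ite (hmove (measurableSet_singleton _)).compl measurable_const
        measurable_const).add
        (ENNReal.measurable_ofReal.comp (continuous_remaining.measurable.comp hmove))
    have hfd : DependsOn f {a T, a' T}ᶜ := fun x y hxy => by
      simp only [f, dependsOn_runValue_compl (H := H) (σ := σ) (draw := draw) hβ ha haa' T hxy]
    have := lintegral_pair (ν := ν) (haa' T T) hf hfd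
    simp only [f] at this
    simp only [runValue_succ' hβ, this]
    refine lintegral_mono_ae ?_
    filter_upwards [ae_runValue_mem (draw := draw) (a := a) hH hβ] with ω hω
    refine (lintegral_mono fun c => ?_).trans (lintegral_tpaMove_count hH hdraw (hω T))
    change ∫⁻ _, ((if tpaMove H σ β draw (runValue H σ β draw a T ω) c ≠ tpaEnd β σ then 1 else 0)
      + ENNReal.ofReal (remaining H σ β (tpaMove H σ β draw (runValue H σ β draw a T ω) c)))
      ∂cellLaw ν ≤ _
    rw [lintegral_const, measure_univ, mul_one]

open Classical in
theorem tsum_lintegral_runValue_ne_le (hH : HasRange H n σ) (hβ : 0 < β)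
    (hdraw : IsGibbsOracle H β ν draw) (ha : Function.Injective a) (haa' : ∀ i j, a i ≠ a' j) :
    ∑' t, ∫⁻ ω, (if runValue H σ β draw a (t + 1) ω ≠ tpaEnd β σ then 1 else 0) ∂randomnessLaw ν
      ≤ ENNReal.ofReal (remaining H σ β (tpaStart β σ)) := by
  refine ENNReal.tsum_le_of_sum_range_le fun T => ?_
  rw [← lintegral_finsetSum _ fun t _ => Measurable.ite (hdraw.measurableSet_runValue_ne hβ _)
    measurable_const measurable_const]
  exact (lintegral_mono fun ω => le_self_add).trans
    (lintegral_sum_runValue_ne_add hH hβ hdraw ha haa' T)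

theorem lintegral_tpaDraws_le (hH : HasRange H n σ) (hβ : 0 < β)
    (hdraw : IsGibbsOracle H β ν draw) (ha : Function.Injective a) (haa' : ∀ i j, a i ≠ a' j) :
    ∫⁻ ω, (tpaDraws H σ β draw (fun i => ω (a i)) : ℝ≥0∞) ∂randomnessLaw ν
      ≤ 1 + ENNReal.ofReal (remaining H σ β (tpaStart β σ)) := by
  classical
  simp only [toENNReal_tpaDraws hβ]
  change ∫⁻ ω, 1 + ∑' t, (if runValue H σ β draw a (t + 1) ω ≠ tpaEnd β σ then 1 else 0)
    ∂randomnessLaw ν ≤ _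
  rw [lintegral_add_left measurable_const, lintegral_const, measure_univ, mul_one,
    lintegral_tsum fun t => (Measurable.ite (hdraw.measurableSet_runValue_ne (a := a) hβ (t + 1))
    measurable_const measurable_const).aemeasurable]
  exact add_le_add_right (tsum_lintegral_runValue_ne_le hH hβ hdraw ha haa') _

theorem ae_tpaDraws_ne_top (hH : HasRange H n σ) (hβ : 0 < β)
    (hdraw : IsGibbsOracle H β ν draw) (ha : Function.Injective a) (haa' : ∀ i j, a i ≠ a' j) :
    ∀ᵐ ω ∂randomnessLaw ν, tpaDraws H σ β draw (fun i => ω (a i)) ≠ ⊤ := by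
  have hm : Measurable fun ω : Randomness S =>
      (tpaDraws H σ β draw (fun i => ω (a i)) : ℝ≥0∞) :=
    Measurable.of_discrete.comp (hdraw.measurable_tpaDraws hβ)
  filter_upwards [ae_lt_top hm ((lintegral_tpaDraws_le hH hβ hdraw ha haa').trans_lt
    (ENNReal.add_lt_top.2 ⟨ENNReal.one_lt_top, ENNReal.ofReal_lt_top⟩)).ne] with ω hω h
  simp [h] at hω

theorem lintegral_length_keptPoints_le (hH : HasRange H n σ) (hβ : 0 < β)
    (hdraw : IsGibbsOracle H β ν draw) (ha : Function.Injective a) (haa' : ∀ i j, a i ≠ a' j)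
    {κ : ℝ} (hκ : κ ≤ 1) :
    ∫⁻ ω, ((keptPoints H σ β draw κ (fun i => ω (a i)) fun i => (ω (a' i)).2).length : ℝ≥0∞)
        ∂randomnessLaw ν
      ≤ ENNReal.ofReal κ * ENNReal.ofReal (remaining H σ β (tpaStart β σ)) := by
  classical
  have h1 : ∀ ω : Randomness S,
      ((keptPoints H σ β draw κ (fun i => ω (a i)) fun i => (ω (a' i)).2).length : ℝ≥0∞)
        ≤ ∑' t, (if (ω (a' t)).2 ≤ κ then 1 else 0)
          * if runValue H σ β draw a (t + 1) ω ≠ tpaEnd β σ then 1 else 0 := fun ω => by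
    rw [length_keptPoints hβ]
    push_cast
    refine le_trans (Finset.sum_le_sum fun t ht => ?_) (ENNReal.sum_le_tsum
      (Finset.range ((tpaDraws H σ β draw fun i => ω (a i)).toNat - 1)))
    have : runValue H σ β draw a (t + 1) ω ≠ tpaEnd β σ :=
      tpaValue_succ_ne_of_lt hβ (Finset.mem_range.1 ht)
    simp [this]
  have hm1 : ∀ t, Measurable fun ω : Randomness S =>
      (if (ω (a' t)).2 ≤ κ then (1 : ℝ≥0∞) else 0) := fun t =>
    Measurable.ite (measurableSet_coin κ _) measurable_const measurable_const
  have hm2 : ∀ t, Measurable fun ω : Randomness S =>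
      (if runValue H σ β draw a (t + 1) ω ≠ tpaEnd β σ then (1 : ℝ≥0∞) else 0) := fun t =>
    Measurable.ite (hdraw.measurableSet_runValue_ne hβ _) measurable_const measurable_const
  refine (lintegral_mono h1).trans ?_
  rw [lintegral_tsum (f := fun t (ω : Randomness S) => (if (ω (a' t)).2 ≤ κ then 1 else 0)
    * if runValue H σ β draw a (t + 1) ω ≠ tpaEnd β σ then 1 else 0)
    fun t => ((hm1 t).mul (hm2 t)).aemeasurable]
  -- The coin of step t lies in a cell that the run does not read, so its probability κ factors out.
  have h2 : ∀ t, ∫⁻ ω : Randomness S, (if (ω (a' t)).2 ≤ κ then 1 else 0)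
        * (if runValue H σ β draw a (t + 1) ω ≠ tpaEnd β σ then 1 else 0) ∂randomnessLaw ν
      = ENNReal.ofReal κ * ∫⁻ ω : Randomness S,
        (if runValue H σ β draw a (t + 1) ω ≠ tpaEnd β σ then 1 else 0) ∂randomnessLaw ν :=
      fun t => by
    rw [randomnessLaw_eq, lintegral_mul_of_dependsOn (T := {a' t}) (cellLaw ν) (hm1 t) (hm2 t)
      (fun x y hxy => by simp only [hxy (a' t) rfl])
      (fun x y hxy => by
        have := dependsOn_runValue (H := H) (σ := σ) (draw := draw) (a := a) hβ (t + 1)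
          (x := x) (y := y) fun i hi => hxy i (by
            obtain ⟨j, -, rfl⟩ := hi
            exact haa' j t)
        simp only [this])]
    congr 1
    have h3 : ∀ ω : Randomness S, (if (ω (a' t)).2 ≤ κ then (1 : ℝ≥0∞) else 0)
        = (fun c : S × ℝ => {c : S × ℝ | c.2 ≤ κ}.indicator (fun _ => (1 : ℝ≥0∞)) c) (ω (a' t)) :=
      fun ω => by by_cases h : (ω (a' t)).2 ≤ κ <;> simp [h]
    have hmS : MeasurableSet {c : S × ℝ | c.2 ≤ κ} :=
      measurableSet_le (by fun_prop) measurable_const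
    simp only [h3]
    rw [← lintegral_map (g := fun ω : Randomness S => ω (a' t)) (measurable_const.indicator hmS)
      (measurable_pi_apply _), Measure.infinitePi_map_eval, lintegral_indicator_const hmS, one_mul,
      cellLaw_coin hκ]
  simp only [h2, ENNReal.tsum_mul_left]
  gcongr
  exact tsum_lintegral_runValue_ne_le hH hβ hdraw ha haa'

/-- The weight in the generating function of the number of kept points in a block. -/
def markWeight (H : Ω → ℝ) (σ : HamiltonianSign) (β : ℝ) (draw : ℝ → S → Ω) (a a' : ℕ → Cell)
    (κ s α l : ℝ) (t : ℕ) (ω : Randomness S) : ℝ≥0∞ :=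
  open Classical in
  if remaining H σ β (runValue H σ β draw a (t + 1) ω) ∈ Set.Ioc α (α + l) ∧ (ω (a' t)).2 ≤ κ then
    ENNReal.ofReal s else 1

theorem IsGibbsOracle.measurable_markWeight (hdraw : IsGibbsOracle H β ν draw) (hβ : 0 < β)
    (κ s α l : ℝ) (t : ℕ) : Measurable (markWeight H σ β draw a a' κ s α l t) :=
  Measurable.ite (((hdraw.measurable_remaining_runValue hβ _) measurableSet_Ioc).inter
    (measurableSet_coin κ _)) measurable_const measurable_const

/-- The product of the marks so far times exp(-κ(1-s) · overlap) is a supermartingale: the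
exponential accounts for the marks that the rest of the block will contribute. -/
theorem lintegral_prod_markWeight_mul_le (hH : HasRange H n σ) (hβ : 0 < β)
    (hdraw : IsGibbsOracle H β ν draw) (ha : Function.Injective a) (haa' : ∀ i j, a i ≠ a' j)
    (ha' : Function.Injective a') {κ s α l : ℝ} (hκ : 0 ≤ κ) (hκ' : κ ≤ 1) (hs : 0 ≤ s)
    (hs' : s ≤ 1) (hα : 0 ≤ α) (hl : 0 ≤ l) (T : ℕ) :
    ∫⁻ ω, (∏ t ∈ Finset.range T, markWeight H σ β draw a a' κ s α l t ω)
        * ENNReal.ofReal (Real.exp (-(κ * (1 - s))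
          * overlap α l (remaining H σ β (runValue H σ β draw a T ω)))) ∂randomnessLaw ν
      ≤ ENNReal.ofReal (Real.exp (-(κ * (1 - s))
          * overlap α l (remaining H σ β (tpaStart β σ)))) := by
  classical
  induction T with
  | zero => simp [runValue, tpaValue_zero]
  | succ T ih =>
    refine le_trans ?_ ih
    let g : ℝ → ℝ≥0∞ := fun R => ENNReal.ofReal (Real.exp (-(κ * (1 - s)) * overlap α l R))
    have hg : Measurable g := ENNReal.measurable_ofReal.comp
      (Real.measurable_exp.comp ((continuous_overlap α l).measurable.const_mul _))
    let p : Randomness S → ℝ≥0∞ := fun ω =>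
      ∏ t ∈ Finset.range T, markWeight H σ β draw a a' κ s α l t ω
    have hp : Measurable p :=
      Finset.measurable_prod _ fun t _ => hdraw.measurable_markWeight hβ κ s α l t
    let f : Randomness S → (S × ℝ) × (S × ℝ) → ℝ≥0∞ := fun ω c =>
      p ω * ((if remaining H σ β (tpaMove H σ β draw (runValue H σ β draw a T ω) c.1)
          ∈ Set.Ioc α (α + l) ∧ c.2.2 ≤ κ then ENNReal.ofReal s else 1)
        * g (remaining H σ β (tpaMove H σ β draw (runValue H σ β draw a T ω) c.1)))
    have hmove : Measurable fun p : Randomness S × ((S × ℝ) × (S × ℝ)) =>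
        remaining H σ β (tpaMove H σ β draw (runValue H σ β draw a T p.1) p.2.1) :=
      continuous_remaining.measurable.comp (hdraw.measurable_tpaMove.comp
        (((hdraw.measurable_runValue hβ T).comp measurable_fst).prodMk (by fun_prop)))
    have hcoin : MeasurableSet {p : Randomness S × ((S × ℝ) × (S × ℝ)) | p.2.2.2 ≤ κ} :=
      measurableSet_le (by fun_prop) measurable_const
    have hf : Measurable (Function.uncurry f) :=
      (hp.comp measurable_fst).mul ((Measurable.ite ((hmove measurableSet_Ioc).inter hcoin)
        measurable_const measurable_const).mul (hg.comp hmove))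
    have hpd : DependsOn p {a T, a' T}ᶜ := fun x y hxy => by
      refine Finset.prod_congr rfl fun t ht => ?_
      have htT := Finset.mem_range.1 ht
      have h1 : runValue H σ β draw a (t + 1) x = runValue H σ β draw a (t + 1) y :=
        dependsOn_runValue hβ (t + 1) fun i hi => hxy i <| by
          obtain ⟨j, hj, rfl⟩ := hi
          simp only [Set.mem_compl_iff, Set.mem_insert_iff, Set.mem_singleton_iff, not_or]
          exact ⟨fun h => absurd (ha h) (by have := Set.mem_Iio.1 hj; omega), haa' j T⟩
      have h2 : x (a' t) = y (a' t) := hxy _ <| by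
        simp only [Set.mem_compl_iff, Set.mem_insert_iff, Set.mem_singleton_iff, not_or]
        exact ⟨(haa' T t).symm, fun h => htT.ne (ha' h)⟩
      simp only [markWeight, h1, h2]
    have hfd : DependsOn f {a T, a' T}ᶜ := fun x y hxy => by
      simp only [f, dependsOn_runValue_compl (H := H) (σ := σ) (draw := draw) hβ ha haa' T hxy,
        hpd hxy]
    have hpair := lintegral_pair (ν := ν) (haa' T T) hf hfd
    have heq : ∀ ω : Randomness S, (∏ t ∈ Finset.range (T + 1),
          markWeight H σ β draw a a' κ s α l t ω)
        * ENNReal.ofReal (Real.exp (-(κ * (1 - s))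
          * overlap α l (remaining H σ β (runValue H σ β draw a (T + 1) ω))))
        = f ω (ω (a T), ω (a' T)) := fun ω => by
      simp only [Finset.prod_range_succ, f, g, p, markWeight, runValue_succ' hβ T, mul_assoc]
    simp only [heq, hpair]
    refine lintegral_mono_ae ?_
    filter_upwards [ae_runValue_mem (draw := draw) (a := a) hH hβ] with ω hω
    have hmove' : Measurable fun q : S × ℝ =>
        remaining H σ β (tpaMove H σ β draw (runValue H σ β draw a T ω) q) :=
      continuous_remaining.measurable.comp (hdraw.measurable_tpaMove.comp
        (measurable_const.prodMk measurable_id))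
    have hin : ∀ c : S × ℝ, Measurable fun c' : S × ℝ =>
        (if remaining H σ β (tpaMove H σ β draw (runValue H σ β draw a T ω) c)
          ∈ Set.Ioc α (α + l) ∧ c'.2 ≤ κ then ENNReal.ofReal s else 1)
        * g (remaining H σ β (tpaMove H σ β draw (runValue H σ β draw a T ω) c)) := fun c =>
      (Measurable.ite ((MeasurableSet.const _).inter
        (measurableSet_le measurable_snd measurable_const)) measurable_const
        measurable_const).mul measurable_const
    have hjoint : Measurable fun q : (S × ℝ) × (S × ℝ) =>
        (if remaining H σ β (tpaMove H σ β draw (runValue H σ β draw a T ω) q.1)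
          ∈ Set.Ioc α (α + l) ∧ q.2.2 ≤ κ then ENNReal.ofReal s else 1)
        * g (remaining H σ β (tpaMove H σ β draw (runValue H σ β draw a T ω) q.1)) :=
      (Measurable.ite (((hmove'.comp measurable_fst) measurableSet_Ioc).inter
        (measurableSet_le (measurable_snd.comp measurable_snd) measurable_const)) measurable_const
        measurable_const).mul (hg.comp (hmove'.comp measurable_fst))
    simp only [f, lintegral_const_mul _ (hin _)]
    rw [lintegral_const_mul _ hjoint.lintegral_prod_right']
    gcongr
    exact (lintegral_tpaMove_exp hH hdraw (hω T) hκ hκ' hs hs' hα hl).le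

open Classical in
theorem prod_markWeight_eq (hβ : 0 < β) {κ s α l : ℝ} (hα : 0 ≤ α) {ω : Randomness S}
    (htop : tpaDraws H σ β draw (fun i => ω (a i)) ≠ ⊤) {T : ℕ}
    (hT : (tpaDraws H σ β draw fun i => ω (a i)).toNat - 1 ≤ T) :
    ∏ t ∈ Finset.range T, markWeight H σ β draw a a' κ s α l t ω
      = ENNReal.ofReal s ^ (keptPoints H σ β draw κ (fun i => ω (a i)) fun i =>
          (ω (a' i)).2).countP fun x => decide (x ∈ remaining H σ β ⁻¹' Set.Ioc α (α + l)) := by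
  rw [countP_keptPoints hβ, ← Finset.prod_pow_eq_pow_sum]
  symm
  have h0 : (0 : ℝ) ∉ Set.Ioc α (α + l) := fun h => absurd h.1 (not_lt.2 hα)
  rw [Finset.prod_subset (Finset.range_subset_range.2 hT)]
  · refine Finset.prod_congr rfl fun t _ => ?_
    rw [markWeight, runValue]
    by_cases h : remaining H σ β (tpaValue H σ β draw (fun i => ω (a i)) (t + 1)) ∈
      Set.Ioc α (α + l) ∧ (ω (a' t)).2 ≤ κ
    · rw [if_pos h, if_pos (by exact h), pow_one]
    · rw [if_neg h, if_neg (by exact h), pow_zero]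
  · intro t _ ht
    have h1 : tpaValue H σ β draw (fun i => ω (a i)) (t + 1) = tpaEnd β σ := by
      by_contra h
      rw [← ne_eq, tpaValue_ne_iff_lt hβ htop] at h
      rw [Finset.mem_range] at ht
      omega
    rw [if_neg, pow_zero]
    rw [h1, Set.mem_preimage, remaining_tpaEnd]
    exact fun h => h0 h.1

open Classical in
/-- The generating function of the number of kept points in a block of a run. -/
theorem lintegral_pow_countP_keptPoints_le (hH : HasRange H n σ) (hβ : 0 < β)
    (hdraw : IsGibbsOracle H β ν draw) (ha : Function.Injective a) (haa' : ∀ i j, a i ≠ a' j)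
    (ha' : Function.Injective a') {κ s α l : ℝ} (hκ : 0 ≤ κ) (hκ' : κ ≤ 1) (hs : 0 ≤ s)
    (hs' : s ≤ 1) (hα : 0 ≤ α) (hl : 0 ≤ l) (hq : α + l ≤ remaining H σ β (tpaStart β σ)) :
    ∫⁻ ω, ENNReal.ofReal s ^ (keptPoints H σ β draw κ (fun i => ω (a i)) fun i =>
        (ω (a' i)).2).countP (fun x => decide (x ∈ remaining H σ β ⁻¹' Set.Ioc α (α + l)))
        ∂randomnessLaw ν
      ≤ ENNReal.ofReal (Real.exp (-(κ * (1 - s)) * l)) := by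
  have hov : overlap α l (remaining H σ β (tpaStart β σ)) = l := by
    rw [overlap, max_eq_left (by linarith), min_eq_right (by linarith)]
  let F : ℕ → Randomness S → ℝ≥0∞ := fun T ω =>
    (∏ t ∈ Finset.range T, markWeight H σ β draw a a' κ s α l t ω)
      * ENNReal.ofReal (Real.exp (-(κ * (1 - s))
        * overlap α l (remaining H σ β (runValue H σ β draw a T ω))))
  have hF : ∀ T, Measurable (F T) := fun T =>
    (Finset.measurable_prod _ fun t _ => hdraw.measurable_markWeight hβ κ s α l t).mul
      (ENNReal.measurable_ofReal.comp (Real.measurable_exp.comp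
        (((continuous_overlap α l).measurable.comp
          (hdraw.measurable_remaining_runValue hβ T)).const_mul _)))
  -- Fatou's lemma. Once the run has stopped, the overlap is 0 and no further mark differs from 1,
  -- since the value 0 is outside the block; `F T` is then constantly s to the number of kept points
  -- in the block.
  calc _ ≤ ∫⁻ ω, liminf (fun T => F T ω) atTop ∂randomnessLaw ν := by
        refine lintegral_mono_ae ?_
        filter_upwards [ae_tpaDraws_ne_top hH hβ hdraw ha haa'] with ω hω
        refine (Tendsto.liminf_eq ?_).ge
        refine tendsto_const_nhds.congr' ?_
        filter_upwards [eventually_ge_atTop (tpaDraws H σ β draw fun i => ω (a i)).toNat]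
          with T hT
        have h1 : runValue H σ β draw a T ω = tpaEnd β σ := by
          by_contra h
          rw [runValue, ← ne_eq, tpaValue_ne_iff_lt hβ hω] at h
          omega
        simp only [F]
        rw [prod_markWeight_eq hβ hα hω (by omega), h1, remaining_tpaEnd, overlap,
          max_eq_right (by linarith), min_eq_left hl]
        simp
    _ ≤ liminf (fun T => ∫⁻ ω, F T ω ∂randomnessLaw ν) atTop := lintegral_liminf_le hF
    _ ≤ liminf (fun _ : ℕ => ENNReal.ofReal (Real.exp (-(κ * (1 - s)) * l))) atTop :=
        liminf_le_liminf (Eventually.of_forall fun T => hov ▸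
          lintegral_prod_markWeight_mul_le hH hβ hdraw ha haa' ha' hκ hκ' hs hs' hα hl T)
    _ = _ := liminf_const _

end RunBounds

/-! ### Schedules from sorted lists -/

section Lists

/-- The entry number `i` of the schedule with spacing `d` that is made of the list `l`. -/
def scheduleEntry (β : ℝ) (d : ℕ) (l : List ℝ) (i : ℕ) : ℝ :=
  (0 :: (everyNth d l ++ [β])).getD i 0

variable {β : ℝ} {d : ℕ} {l : List ℝ}

theorem length_everyNth : (everyNth d l).length = l.length / d := by simp [everyNth]

theorem scheduleEntry_zero : scheduleEntry β d l 0 = 0 := rfl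

theorem scheduleEntry_succ {i : ℕ} (hi : i < l.length / d) :
    scheduleEntry β d l (i + 1) = l.getD ((i + 1) * d - 1) 0 := by
  rw [scheduleEntry, List.getD_cons_succ, List.getD_append _ _ _ _ (by rwa [length_everyNth])]
  simp [everyNth, List.getD_eq_getElem?_getD, hi]

theorem scheduleEntry_last : scheduleEntry β d l (l.length / d + 1) = β := by
  rw [scheduleEntry, List.getD_cons_succ, List.getD_append_right _ _ _ _ length_everyNth.le,
    length_everyNth]
  simp

/-- The default value 0 beyond the end lies in [0, β], so entries may be queried at every index. -/
theorem scheduleEntry_of_gt {i : ℕ} (hi : l.length / d + 1 < i) : scheduleEntry β d l i = 0 := by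
  rw [scheduleEntry, List.getD_eq_default]
  simp [length_everyNth]
  omega

theorem mul_sub_one_lt_length (hd : 1 ≤ d) {i : ℕ} (hi : i < l.length / d) :
    (i + 1) * d - 1 < l.length := by
  have h1 : (i + 1) * d ≤ l.length := (Nat.le_div_iff_mul_le hd).1 hi
  have h2 : d ≤ (i + 1) * d := Nat.le_mul_of_pos_left d i.succ_pos
  omega

theorem scheduleEntry_mem (hβ : 0 ≤ β) (hd : 1 ≤ d) (hl : ∀ x ∈ l, x ∈ Set.Icc 0 β) (i : ℕ) :
    scheduleEntry β d l i ∈ Set.Icc 0 β := by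
  rcases i with _ | i
  · simp [scheduleEntry_zero, hβ]
  rcases lt_trichotomy i (l.length / d) with h | rfl | h
  · rw [scheduleEntry_succ h, List.getD_eq_getElem _ _ (mul_sub_one_lt_length hd h)]
    exact hl _ (List.getElem_mem _)
  · simp [scheduleEntry_last, hβ]
  · rw [scheduleEntry_of_gt (by omega)]
    simp [hβ]

theorem getElem_le_getElem_of_pairwise (hs : l.Pairwise (· ≤ ·)) {i j : ℕ} (hij : i ≤ j)
    (hj : j < l.length) : l[i] ≤ l[j] := by
  rcases hij.eq_or_lt with rfl | h
  · exact le_rfl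
  · exact List.pairwise_iff_getElem.1 hs i j _ hj h

theorem scheduleEntry_le_succ (hd : 1 ≤ d) (hs : l.Pairwise (· ≤ ·))
    (hl : ∀ x ∈ l, x ∈ Set.Icc 0 β) (hβ : 0 ≤ β) {i : ℕ} (hi : i < l.length / d + 1) :
    scheduleEntry β d l i ≤ scheduleEntry β d l (i + 1) := by
  rcases i with _ | i
  · exact (scheduleEntry_mem hβ hd hl 1).1
  rcases lt_or_ge (i + 1) (l.length / d) with h | h
  · rw [scheduleEntry_succ (by omega), scheduleEntry_succ h,
      List.getD_eq_getElem _ _ (mul_sub_one_lt_length hd (by omega)),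
      List.getD_eq_getElem _ _ (mul_sub_one_lt_length hd h)]
    refine getElem_le_getElem_of_pairwise hs (Nat.sub_le_sub_right ?_ 1) _
    exact Nat.mul_le_mul_right d (by omega)
  · have : i + 1 + 1 = l.length / d + 1 := by omega
    rw [this, scheduleEntry_last]
    exact (scheduleEntry_mem hβ hd hl _).2

/-- Strictly between two neighbours of the schedule there are fewer than `d` points. -/
theorem countP_lt_of_between (hd : 1 ≤ d) (hs : l.Pairwise (· ≤ ·)) {i : ℕ}
    (hi : i < l.length / d + 1) {p : ℝ → Bool}
    (hp : ∀ x ∈ l, p x → x ∈ Set.Ioo (scheduleEntry β d l i) (scheduleEntry β d l (i + 1))) :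
    l.countP p < d := by
  -- The first i d points are at most entry i of the schedule, and those from index (i+1)d - 1 on
  -- are at least entry i+1. Only d - 1 positions remain between. For the last interval the tail is
  -- empty.
  have h1 : (l.take (i * d)).countP p = 0 := by
    rw [List.countP_eq_zero]
    intro x hx hpx
    obtain ⟨k, hk, rfl⟩ := List.mem_take_iff_getElem.1 hx
    have hkl : k < i * d ∧ k < l.length := by simpa using hk
    rcases i with _ | i
    · simp at hkl
    have hlt := (hp _ (List.getElem_mem hkl.2) hpx).1
    rw [scheduleEntry_succ (by omega),
      List.getD_eq_getElem _ _ (mul_sub_one_lt_length hd (by omega))] at hlt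
    refine absurd hlt (not_lt.2 (getElem_le_getElem_of_pairwise hs ?_ _))
    omega
  have h2 : ((l.drop (i * d)).drop (d - 1)).countP p = 0 := by
    rw [List.countP_eq_zero, List.drop_drop]
    intro x hx hpx
    obtain ⟨k, hk, rfl⟩ := List.mem_drop_iff_getElem.1 hx
    have hlt := (hp _ (List.getElem_mem (by omega)) hpx).2
    have hid : (i + 1) * d = i * d + d := by ring
    rcases (Nat.lt_succ_iff.1 hi).lt_or_eq with h | h
    · rw [scheduleEntry_succ h, List.getD_eq_getElem _ _ (mul_sub_one_lt_length hd h)] at hlt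
      refine absurd hlt (not_lt.2 (getElem_le_getElem_of_pairwise hs ?_ _))
      omega
    · have := Nat.lt_mul_div_succ l.length hd
      rw [← h, mul_comm] at this
      omega
  rw [← List.take_append_drop (i * d) l, List.countP_append, h1,
    ← List.take_append_drop (d - 1) (l.drop (i * d)), List.countP_append, h2]
  have := (List.countP_le_length (p := p) (l := (l.drop (i * d)).take (d - 1))).trans
    (List.length_take_le _ _)
  omega

/-- An order statistic is expressed through counts, which reduces the measurability of the schedule
to that of the counts. -/
theorem getElem_le_iff_lt_countP (hs : l.Pairwise (· ≤ ·)) {k : ℕ} (hk : k < l.length) (x : ℝ) :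
    l[k] ≤ x ↔ k < l.countP fun y => decide (y ≤ x) := by
  constructor
  · intro h
    rw [← List.take_append_drop (k + 1) l, List.countP_append]
    have : (l.take (k + 1)).countP (fun y => decide (y ≤ x)) = (l.take (k + 1)).length := by
      rw [List.countP_eq_length]
      intro y hy
      obtain ⟨j, hj, rfl⟩ := List.mem_take_iff_getElem.1 hy
      have hj' : j < k + 1 ∧ j < l.length := by simpa using hj
      simpa using (getElem_le_getElem_of_pairwise hs (by omega) hk).trans h
    rw [this, List.length_take]
    omega
  · intro h
    by_contra! h'
    rw [← List.take_append_drop k l, List.countP_append] at h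
    have : (l.drop k).countP (fun y => decide (y ≤ x)) = 0 := by
      rw [List.countP_eq_zero]
      intro y hy
      obtain ⟨j, hj, rfl⟩ := List.mem_drop_iff_getElem.1 hy
      have := h'.trans_le (getElem_le_getElem_of_pairwise hs (by omega : k ≤ k + j) (by omega))
      simpa using this
    have h3 := (List.countP_le_length (p := fun y => decide (y ≤ x)) (l := l.take k)).trans
      (List.length_take_le _ _)
    omega

end Lists

/-! ### The merged point process of the main runs -/

section Merged

variable {Ω S : Type*} (H : Ω → ℝ) (σ : HamiltonianSign) (β : ℝ) (draw : ℝ → S → Ω)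

/-- The points kept with probability `κ` in the first `K` main runs. -/
def mergedPoints (K : ℕ) (κ : ℝ) (ω : Randomness S) : List ℝ :=
  (List.range K).flatMap fun j =>
    keptPoints H σ β draw κ (fun t => ω (.main j t)) fun t => (ω (.thin j t)).2

/-- The merged points in increasing order. -/
def sortedMerged (K : ℕ) (κ : ℝ) (ω : Randomness S) : List ℝ :=
  (mergedPoints H σ β draw K κ ω).insertionSort (· ≤ ·)

variable {H σ β draw}

theorem pairwise_sortedMerged (K : ℕ) (κ : ℝ) (ω : Randomness S) :
    (sortedMerged H σ β draw K κ ω).Pairwise (· ≤ ·) :=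
  List.pairwise_insertionSort _ _

theorem perm_sortedMerged (K : ℕ) (κ : ℝ) (ω : Randomness S) :
    (sortedMerged H σ β draw K κ ω).Perm (mergedPoints H σ β draw K κ ω) :=
  List.perm_insertionSort _ _

theorem countP_sortedMerged (K : ℕ) (κ : ℝ) (ω : Randomness S) (p : ℝ → Bool) :
    (sortedMerged H σ β draw K κ ω).countP p = ∑ j ∈ Finset.range K,
      (keptPoints H σ β draw κ (fun t => ω (.main j t)) fun t => (ω (.thin j t)).2).countP p := by
  rw [(perm_sortedMerged K κ ω).countP_eq, mergedPoints, List.countP_flatMap]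
  rfl

theorem length_sortedMerged (K : ℕ) (κ : ℝ) (ω : Randomness S) :
    (sortedMerged H σ β draw K κ ω).length = ∑ j ∈ Finset.range K,
      (keptPoints H σ β draw κ (fun t => ω (.main j t)) fun t => (ω (.thin j t)).2).length := by
  simpa using countP_sortedMerged (H := H) (σ := σ) (β := β) (draw := draw) K κ ω fun _ => true

/-- The cells that the `j`-th main run and its thinning read. -/
def runCells (j : ℕ) : Set Cell := {c | ∃ t, c = .main j t ∨ c = .thin j t}

theorem pairwise_disjoint_runCells : Pairwise (Function.onFun Disjoint runCells) := by
  intro i j hij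
  refine Set.disjoint_left.2 ?_
  rintro c ⟨t, rfl | rfl⟩ ⟨u, h | h⟩
  all_goals first | exact hij (Cell.main.inj h).1 | exact hij (Cell.thin.inj h).1 | cases h

theorem dependsOn_keptPoints (κ : ℝ) (j : ℕ) :
    DependsOn (fun ω : Randomness S =>
      keptPoints H σ β draw κ (fun t => ω (.main j t)) fun t => (ω (.thin j t)).2) (runCells j) := by
  intro x y hxy
  have h1 : ∀ t, x (.main j t) = y (.main j t) := fun t => hxy _ ⟨t, Or.inl rfl⟩
  have h2 : ∀ t, x (.thin j t) = y (.thin j t) := fun t => hxy _ ⟨t, Or.inr rfl⟩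
  simp only [h1, h2]

theorem mem_sortedMerged {n : ℕ} (hH : HasRange H n σ) (hβ : 0 < β) {K : ℕ} {κ : ℝ}
    {ω : Randomness S} (hω : ∀ c, (ω c).2 ∈ Set.Ioc (0 : ℝ) 1) :
    ∀ x ∈ sortedMerged H σ β draw K κ ω, x ∈ Set.Icc 0 β := by
  intro x hx
  rw [(perm_sortedMerged K κ ω).mem_iff, mergedPoints, List.mem_flatMap] at hx
  obtain ⟨j, -, hx⟩ := hx
  obtain ⟨t, rfl⟩ := mem_keptPoints hβ hx
  exact tpaValue_mem hH hβ (fun i => hω _) _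

/-- The spacing, the rate and the number of runs are random only through the size of the preliminary
runs, so measurability may be checked for each fixed size. -/
theorem measurable_comp_nat {α γ : Type*} [MeasurableSpace α] [MeasurableSpace γ] {N : α → ℕ}
    (hN : Measurable N) {f : ℕ → α → γ} (hf : ∀ m, Measurable (f m)) :
    Measurable fun x => f (N x) x :=
  (measurable_from_prod_countable_right (f := fun p : ℕ × α => f p.1 p.2) hf).comp
    (hN.prodMk measurable_id)

variable [Fintype Ω] [MeasurableSpace S] {ν : Measure S} {n : ℕ}
  [Nonempty Ω] [IsProbabilityMeasure ν]

open Classical in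
theorem IsGibbsOracle.measurable_countP_keptPoints (hdraw : IsGibbsOracle H β ν draw)
    (hβ : 0 < β) {a a' : ℕ → Cell} (κ : ℝ) {B : Set ℝ} (hB : MeasurableSet B) :
    Measurable fun ω : Randomness S => (keptPoints H σ β draw κ (fun t => ω (a t))
      fun t => (ω (a' t)).2).countP fun x => decide (x ∈ B) := by
  simp only [countP_keptPoints hβ]
  have hD : Measurable fun ω : Randomness S =>
      (tpaDraws H σ β draw fun i => ω (a i)).toNat - 1 :=
    (Measurable.of_discrete (f := fun D : ℕ∞ => D.toNat - 1)).comp (hdraw.measurable_tpaDraws hβ)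
  refine measurable_comp_nat hD (f := fun m ω => ∑ t ∈ Finset.range m,
    if tpaValue H σ β draw (fun t => ω (a t)) (t + 1) ∈ B ∧ (ω (a' t)).2 ≤ κ then 1 else 0)
    fun m => Finset.measurable_sum _ fun t _ => ?_
  exact Measurable.ite ((hdraw.measurable_runValue (a := a) hβ (t + 1) hB).inter
    (measurableSet_coin κ _)) measurable_const measurable_const

open Classical in
theorem IsGibbsOracle.measurable_countP_sortedMerged (hdraw : IsGibbsOracle H β ν draw)
    (hβ : 0 < β) (K : ℕ) (κ : ℝ) {B : Set ℝ} (hB : MeasurableSet B) :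
    Measurable fun ω : Randomness S =>
      (sortedMerged H σ β draw K κ ω).countP fun x => decide (x ∈ B) := by
  simp only [countP_sortedMerged]
  exact Finset.measurable_sum _ fun j _ => hdraw.measurable_countP_keptPoints hβ κ hB

theorem IsGibbsOracle.measurable_length_sortedMerged (hdraw : IsGibbsOracle H β ν draw)
    (hβ : 0 < β) (K : ℕ) (κ : ℝ) :
    Measurable fun ω : Randomness S => (sortedMerged H σ β draw K κ ω).length := by
  simpa using hdraw.measurable_countP_sortedMerged hβ K κ MeasurableSet.univ

theorem IsGibbsOracle.measurable_scheduleEntry (hdraw : IsGibbsOracle H β ν draw)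
    (hβ : 0 < β) (K : ℕ) (κ : ℝ) {d : ℕ} (hd : 1 ≤ d) (i : ℕ) :
    Measurable fun ω : Randomness S => scheduleEntry β d (sortedMerged H σ β draw K κ ω) i := by
  rcases i with _ | i
  · exact measurable_const
  have hlen := hdraw.measurable_length_sortedMerged hβ (σ := σ) K κ
  refine measurable_of_Iic fun x => ?_
  have h1 : (fun ω : Randomness S => scheduleEntry β d (sortedMerged H σ β draw K κ ω) (i + 1))
        ⁻¹' Set.Iic x
      = {ω | (i < (sortedMerged H σ β draw K κ ω).length / d ∧
            (i + 1) * d - 1 < (sortedMerged H σ β draw K κ ω).countP fun y => decide (y ≤ x))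
          ∨ (i = (sortedMerged H σ β draw K κ ω).length / d ∧ β ≤ x)
          ∨ ((sortedMerged H σ β draw K κ ω).length / d < i ∧ 0 ≤ x)} := by
    ext ω
    simp only [Set.mem_preimage, Set.mem_Iic, Set.mem_ofPred_eq]
    rcases lt_trichotomy i ((sortedMerged H σ β draw K κ ω).length / d) with h | h | h
    · rw [scheduleEntry_succ h, List.getD_eq_getElem _ _ (mul_sub_one_lt_length hd h),
        getElem_le_iff_lt_countP (pairwise_sortedMerged K κ ω)]
      simp [h, h.ne, h.not_gt]
    · have : scheduleEntry β d (sortedMerged H σ β draw K κ ω) (i + 1) = β := by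
        rw [h, scheduleEntry_last]
      rw [this]
      simp [← h]
    · rw [scheduleEntry_of_gt (by omega)]
      simp [h, h.ne', h.not_gt]
  rw [h1]
  have hc : Measurable fun ω : Randomness S =>
      (sortedMerged H σ β draw K κ ω).countP fun y => decide (y ≤ x) :=
    hdraw.measurable_countP_sortedMerged hβ K κ (B := Set.Iic x) measurableSet_Iic
  have hdiv : Measurable fun ω : Randomness S => (sortedMerged H σ β draw K κ ω).length / d :=
    (Measurable.of_discrete (f := fun m : ℕ => m / d)).comp hlen
  refine ((measurableSet_lt measurable_const hdiv).inter
    (measurableSet_lt measurable_const hc)).union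
    (((measurableSet_eq_fun measurable_const hdiv).inter (MeasurableSet.const _)).union
    ((measurableSet_lt hdiv measurable_const).inter (MeasurableSet.const _)))

theorem lintegral_length_sortedMerged_le (hH : HasRange H n σ) (hβ : 0 < β)
    (hdraw : IsGibbsOracle H β ν draw) (K : ℕ) {κ : ℝ} (hκ : κ ≤ 1) :
    ∫⁻ ω, ((sortedMerged H σ β draw K κ ω).length : ℝ≥0∞) ∂randomnessLaw ν
      ≤ K * (ENNReal.ofReal κ * ENNReal.ofReal (remaining H σ β (tpaStart β σ))) := by
  simp only [length_sortedMerged]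
  push_cast
  rw [lintegral_finsetSum]
  · refine (Finset.sum_le_sum fun j _ => lintegral_length_keptPoints_le (a := Cell.main j)
      (a' := Cell.thin j) hH hβ hdraw (fun x y h => (Cell.main.inj h).2) (fun x y h => by cases h)
      hκ).trans ?_
    simp
  · intro j _
    have := hdraw.measurable_countP_keptPoints (σ := σ) hβ (a := Cell.main j) (a' := Cell.thin j)
      κ MeasurableSet.univ
    simp only [Set.mem_univ, decide_true, List.countP_true] at this
    exact (Measurable.of_discrete (f := fun m : ℕ => (m : ℝ≥0∞))).comp this

open Classical in
theorem lintegral_pow_countP_sortedMerged_le (hH : HasRange H n σ) (hβ : 0 < β)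
    (hdraw : IsGibbsOracle H β ν draw) (K : ℕ) {κ s α l : ℝ} (hκ : 0 ≤ κ) (hκ' : κ ≤ 1)
    (hs : 0 ≤ s) (hs' : s ≤ 1) (hα : 0 ≤ α) (hl : 0 ≤ l)
    (hq : α + l ≤ remaining H σ β (tpaStart β σ)) :
    ∫⁻ ω, ENNReal.ofReal s ^ (sortedMerged H σ β draw K κ ω).countP
        (fun x => decide (x ∈ remaining H σ β ⁻¹' Set.Ioc α (α + l))) ∂randomnessLaw ν
      ≤ ENNReal.ofReal (Real.exp (-(κ * K * (1 - s)) * l)) := by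
  have hB : MeasurableSet (remaining H σ β ⁻¹' Set.Ioc α (α + l)) :=
    continuous_remaining.measurable measurableSet_Ioc
  simp only [countP_sortedMerged, ← Finset.prod_pow_eq_pow_sum]
  rw [randomnessLaw_eq, lintegral_prod_of_dependsOn (T := runCells) (cellLaw ν) (Finset.range K)
    (f := fun j ω => ENNReal.ofReal s ^ (keptPoints H σ β draw κ (fun t => ω (.main j t))
      fun t => (ω (.thin j t)).2).countP
        (fun x => decide (x ∈ remaining H σ β ⁻¹' Set.Ioc α (α + l)))) pairwise_disjoint_runCells]
  · refine (Finset.prod_le_prod' fun j _ => lintegral_pow_countP_keptPoints_le (a := Cell.main j)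
      (a' := Cell.thin j) (s := s) hH hβ hdraw (fun x y h => (Cell.main.inj h).2)
      (fun x y h => by cases h) (fun x y h => (Cell.thin.inj h).2) hκ hκ' hs hs' hα hl hq).trans ?_
    rw [Finset.prod_const, Finset.card_range, ← ENNReal.ofReal_pow (Real.exp_nonneg _),
      ← Real.exp_nat_mul]
    refine (ENNReal.ofReal_le_ofReal (le_of_eq ?_))
    congr 1
    ring
  · intro j
    exact (Measurable.of_discrete (f := fun m : ℕ => ENNReal.ofReal s ^ m)).comp
      (hdraw.measurable_countP_keptPoints hβ (a := Cell.main j) (a' := Cell.thin j) κ hB)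
  · intro j x y hxy
    have := dependsOn_keptPoints (H := H) (σ := σ) (β := β) (draw := draw) κ j hxy
    simp only at this
    simp only [this]

open Classical in
-- Markov's inequality for (2/3)^count. The total rate is κK, and 1 - 2/3 is the factor 1/3 in the
-- exponent.
theorem measure_countP_sortedMerged_lt_le (hH : HasRange H n σ) (hβ : 0 < β)
    (hdraw : IsGibbsOracle H β ν draw) (K d : ℕ) {κ α l : ℝ} (hκ : 0 ≤ κ) (hκ' : κ ≤ 1)
    (hα : 0 ≤ α) (hl : 0 ≤ l) (hq : α + l ≤ remaining H σ β (tpaStart β σ)) :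
    randomnessLaw ν {ω | (sortedMerged H σ β draw K κ ω).countP
        (fun x => decide (x ∈ remaining H σ β ⁻¹' Set.Ioc α (α + l))) < d}
      ≤ ENNReal.ofReal (Real.exp (-(κ * K / 3) * l) * (3 / 2) ^ d) := by
  have h1 := lintegral_pow_countP_sortedMerged_le (s := 2 / 3) hH hβ hdraw K hκ hκ' (by norm_num)
    (by norm_num) hα hl hq
  have hB : MeasurableSet (remaining H σ β ⁻¹' Set.Ioc α (α + l)) :=
    continuous_remaining.measurable measurableSet_Ioc
  have hm := (Measurable.of_discrete (f := fun m : ℕ => ENNReal.ofReal (2 / 3) ^ m)).comp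
    (hdraw.measurable_countP_sortedMerged (σ := σ) hβ K κ hB)
  have h2 := mul_meas_ge_le_lintegral (μ := randomnessLaw ν) hm (ENNReal.ofReal (2 / 3) ^ d)
  have h3 : ENNReal.ofReal (2 / 3) ^ d * ENNReal.ofReal ((3 / 2) ^ d) = 1 := by
    rw [← ENNReal.ofReal_pow (by norm_num), ← ENNReal.ofReal_mul (by positivity), ← mul_pow]
    norm_num
  calc _ ≤ randomnessLaw ν {ω | ENNReal.ofReal (2 / 3) ^ d
        ≤ ((fun m : ℕ => ENNReal.ofReal (2 / 3) ^ m) ∘ fun ω =>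
          (sortedMerged H σ β draw K κ ω).countP
            (fun x => decide (x ∈ remaining H σ β ⁻¹' Set.Ioc α (α + l)))) ω} := by
        refine measure_mono fun ω hω => ?_
        have h23 : ENNReal.ofReal (2 / 3) ≤ 1 := by
          rw [← ENNReal.ofReal_one]
          exact ENNReal.ofReal_le_ofReal (by norm_num)
        exact pow_le_pow_right_of_le_one' h23 (le_of_lt hω)
    _ = (ENNReal.ofReal (2 / 3) ^ d * randomnessLaw ν {ω | ENNReal.ofReal (2 / 3) ^ d
        ≤ ((fun m : ℕ => ENNReal.ofReal (2 / 3) ^ m) ∘ fun ω =>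
          (sortedMerged H σ β draw K κ ω).countP
            (fun x => decide (x ∈ remaining H σ β ⁻¹' Set.Ioc α (α + l)))) ω})
          * ENNReal.ofReal ((3 / 2) ^ d) := by
        rw [mul_right_comm, h3, one_mul]
    _ ≤ ENNReal.ofReal (Real.exp (-(κ * K * (1 - 2 / 3)) * l)) * ENNReal.ofReal ((3 / 2) ^ d) := by
        gcongr
        exact h2.trans h1
    _ = _ := by
        rw [← ENNReal.ofReal_mul (Real.exp_nonneg _)]
        congr 4
        ring

open Classical in
/-- A long gap of the schedule contains a block that few points hit. -/
theorem exists_countP_lt_of_gap (hH : HasRange H n σ) (hβ : 0 < β) {d : ℕ} (hd : 1 ≤ d)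
    {l : List ℝ} (hs : l.Pairwise (· ≤ ·)) (hl : ∀ x ∈ l, x ∈ Set.Icc 0 β) {h m : ℝ} (hh : 0 < h)
    (hm : 0 ≤ m) {i : ℕ} (hi : i < l.length / d + 1)
    (hgap : (m + 1) * h < |remaining H σ β (scheduleEntry β d l (i + 1))
      - remaining H σ β (scheduleEntry β d l i)|) :
    ∃ j ∈ Finset.range (⌊remaining H σ β (tpaStart β σ) / h⌋₊ + 1),
      j * h + m * h ≤ remaining H σ β (tpaStart β σ) ∧
      l.countP (fun x => decide (x ∈ remaining H σ β ⁻¹' Set.Ioc (j * h) (j * h + m * h))) < d := by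
  set q := remaining H σ β (tpaStart β σ)
  set t := scheduleEntry β d l i
  set t' := scheduleEntry β d l (i + 1)
  have ht : t ∈ Set.Icc 0 β := scheduleEntry_mem hβ.le hd hl i
  have ht' : t' ∈ Set.Icc 0 β := scheduleEntry_mem hβ.le hd hl (i + 1)
  set lo := min (remaining H σ β t) (remaining H σ β t') with hlo
  set hi' := max (remaining H σ β t) (remaining H σ β t') with hhi
  have hlo0 : 0 ≤ lo := le_min (remaining_nonneg hH ht) (remaining_nonneg hH ht')
  have hhiq : hi' ≤ q := max_le (remaining_le_start hH ht) (remaining_le_start hH ht')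
  have hgap' : lo + (m + 1) * h < hi' := by
    rw [← max_sub_min_eq_abs] at hgap
    linarith
  -- The block starts at the first grid point not below lo. This rounding loses less than h, which
  -- is why the gap has to exceed (m+1)h to contain a block of length m h.
  have hj1 : lo ≤ ⌈lo / h⌉₊ * h := (div_le_iff₀ hh).1 (Nat.le_ceil _)
  have hj2 : (⌈lo / h⌉₊ : ℝ) * h < lo + h := by
    have := (lt_div_iff₀ hh).1 (show (⌈lo / h⌉₊ : ℝ) < (lo + h) / h by
      rw [add_div, div_self hh.ne']; exact Nat.ceil_lt_add_one (div_nonneg hlo0 hh.le))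
    exact this
  have hjq : (⌈lo / h⌉₊ : ℝ) * h + m * h < hi' := by linarith
  refine ⟨⌈lo / h⌉₊, Finset.mem_range.2 (Nat.lt_succ_of_le (Nat.le_floor ?_)), by linarith, ?_⟩
  · rw [le_div_iff₀ hh]
    have := mul_nonneg hm hh.le
    linarith
  refine countP_lt_of_between (β := β) hd hs hi fun x _ hx => ?_
  simp only [decide_eq_true_eq, Set.mem_preimage, Set.mem_Ioc] at hx
  have hx1 : lo < remaining H σ β x := by linarith
  have hx2 : remaining H σ β x < hi' := by linarith
  have htt : t ≤ t' := scheduleEntry_le_succ hd hs hl hβ.le hi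
  have mono : ∀ {u v}, 0 ≤ σ.toReal * (u - v) → remaining H σ β u ≤ remaining H σ β v :=
    fun h => remaining_le hH h
  change t < x ∧ x < t'
  constructor
  · by_contra! hle
    cases σ
    · have h1 := mono (u := x) (v := t) (by simp only [HamiltonianSign.toReal]; linarith)
      have h2 := mono (u := t) (v := t') (by simp only [HamiltonianSign.toReal]; linarith)
      rw [hlo, min_eq_left h2] at hx1
      linarith
    · have h1 := mono (u := t) (v := x) (by simp only [HamiltonianSign.toReal]; linarith)
      have h2 := mono (u := t') (v := t) (by simp only [HamiltonianSign.toReal]; linarith)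
      rw [hhi, max_eq_left h2] at hx2
      linarith
  · by_contra! hle
    cases σ
    · have h1 := mono (u := t') (v := x) (by simp only [HamiltonianSign.toReal]; linarith)
      have h2 := mono (u := t) (v := t') (by simp only [HamiltonianSign.toReal]; linarith)
      rw [hhi, max_eq_right h2] at hx2
      linarith
    · have h1 := mono (u := x) (v := t') (by simp only [HamiltonianSign.toReal]; linarith)
      have h2 := mono (u := t') (v := t) (by simp only [HamiltonianSign.toReal]; linarith)
      rw [hlo, min_eq_right h2] at hx1
      linarith

variable (H σ β draw) in
/-- Outcomes for which all gaps of the schedule have logarithmic length at most `η`. -/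
def shortGaps (η : ℝ) (d K : ℕ) (κ : ℝ) : Set (Randomness S) :=
  {ω | ∀ i < (sortedMerged H σ β draw K κ ω).length / d + 1,
    |remaining H σ β (scheduleEntry β d (sortedMerged H σ β draw K κ ω) (i + 1))
      - remaining H σ β (scheduleEntry β d (sortedMerged H σ β draw K κ ω) i)| ≤ η}

theorem IsGibbsOracle.measurableSet_shortGaps (hdraw : IsGibbsOracle H β ν draw)
    (hβ : 0 < β) (η : ℝ) {d : ℕ} (hd : 1 ≤ d) (K : ℕ) (κ : ℝ) :
    MeasurableSet (shortGaps H σ β draw η d K κ) := by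
  have hlen := hdraw.measurable_length_sortedMerged hβ (σ := σ) K κ
  have hdiv : Measurable fun ω : Randomness S => (sortedMerged H σ β draw K κ ω).length / d + 1 :=
    (Measurable.of_discrete (f := fun m : ℕ => m / d + 1)).comp hlen
  have hent := fun i => (continuous_remaining (H := H) (σ := σ) (β := β)).measurable.comp
    (hdraw.measurable_scheduleEntry (σ := σ) hβ K κ hd i)
  rw [shortGaps, Set.ofPred_forall]
  refine MeasurableSet.iInter fun i => ?_
  have : {ω : Randomness S | i < (sortedMerged H σ β draw K κ ω).length / d + 1 →
      |remaining H σ β (scheduleEntry β d (sortedMerged H σ β draw K κ ω) (i + 1))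
      - remaining H σ β (scheduleEntry β d (sortedMerged H σ β draw K κ ω) i)| ≤ η}
      = {ω | i < (sortedMerged H σ β draw K κ ω).length / d + 1}ᶜ ∪
        {ω | |remaining H σ β (scheduleEntry β d (sortedMerged H σ β draw K κ ω) (i + 1))
      - remaining H σ β (scheduleEntry β d (sortedMerged H σ β draw K κ ω) i)| ≤ η} := by
    ext ω
    simp only [Set.mem_ofPred_eq, Set.mem_union, Set.mem_compl_iff]
    tauto
  rw [this]
  exact (measurableSet_lt measurable_const hdiv).compl.union
    (measurableSet_le (((hent (i + 1)).sub (hent i)).abs) measurable_const)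

/-- Union bound over the at most q/h + 1 grid points at which a poorly hit block can start. -/
theorem measure_compl_shortGaps_le (hH : HasRange H n σ) (hβ : 0 < β)
    (hdraw : IsGibbsOracle H β ν draw) {d : ℕ} (hd : 1 ≤ d) (K : ℕ) {κ h m : ℝ} (hκ : 0 ≤ κ)
    (hκ' : κ ≤ 1) (hh : 0 < h) (hm : 0 ≤ m) :
    randomnessLaw ν (shortGaps H σ β draw ((m + 1) * h) d K κ)ᶜ
      ≤ ENNReal.ofReal ((remaining H σ β (tpaStart β σ) / h + 1)
        * (Real.exp (-(κ * K / 3) * (m * h)) * (3 / 2) ^ d)) := by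
  classical
  set q := remaining H σ β (tpaStart β σ)
  have hq : 0 ≤ q := remaining_nonneg hH (tpaStart_mem hβ σ)
  set B : ℕ → Set (Randomness S) := fun j => {ω | j * h + m * h ≤ q ∧
    (sortedMerged H σ β draw K κ ω).countP
      (fun x => decide (x ∈ remaining H σ β ⁻¹' Set.Ioc (j * h) (j * h + m * h))) < d} with hB
  have hae : ((shortGaps H σ β draw ((m + 1) * h) d K κ)ᶜ : Set (Randomness S))
      ≤ᵐ[randomnessLaw ν] (⋃ j ∈ Finset.range (⌊q / h⌋₊ + 1), B j : Set (Randomness S)) := by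
    filter_upwards [ae_randomness_mem] with ω hω hbad
    simp only [shortGaps, Set.compl_def, Set.mem_ofPred_eq] at hbad
    change ω ∈ ⋃ j ∈ Finset.range (⌊q / h⌋₊ + 1), B j
    obtain ⟨i, hi, hgap⟩ : ∃ i < (sortedMerged H σ β draw K κ ω).length / d + 1,
        (m + 1) * h < |remaining H σ β (scheduleEntry β d (sortedMerged H σ β draw K κ ω) (i + 1))
          - remaining H σ β (scheduleEntry β d (sortedMerged H σ β draw K κ ω) i)| := by
      by_contra! hcon
      exact hbad hcon
    obtain ⟨j, hj, h1, h2⟩ := exists_countP_lt_of_gap hH hβ hd (pairwise_sortedMerged K κ ω)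
      (mem_sortedMerged hH hβ hω) hh hm hi hgap
    exact Set.mem_biUnion hj ⟨h1, h2⟩
  calc _ ≤ randomnessLaw ν (⋃ j ∈ Finset.range (⌊q / h⌋₊ + 1), B j) := measure_mono_ae hae
    _ ≤ ∑ j ∈ Finset.range (⌊q / h⌋₊ + 1), randomnessLaw ν (B j) := measure_biUnion_finset_le _ _
    _ ≤ ∑ _j ∈ Finset.range (⌊q / h⌋₊ + 1),
        ENNReal.ofReal (Real.exp (-(κ * K / 3) * (m * h)) * (3 / 2) ^ d) := by
        refine Finset.sum_le_sum fun j _ => ?_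
        by_cases hjq : j * h + m * h ≤ q
        · refine (measure_mono fun ω hω => hω.2).trans
            (measure_countP_sortedMerged_lt_le hH hβ hdraw K d hκ hκ' (by positivity)
              (by positivity) hjq)
        · have : B j = ∅ := by ext ω; simp [hB, hjq]
          simp [this]
    _ ≤ _ := by
        rw [Finset.sum_const, Finset.card_range, nsmul_eq_mul, ← ENNReal.ofReal_natCast,
          ← ENNReal.ofReal_mul (Nat.cast_nonneg _)]
        refine ENNReal.ofReal_le_ofReal (mul_le_mul_of_nonneg_right ?_ (by positivity))
        push_cast
        exact add_le_add_left (Nat.floor_le (by positivity)) 1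

end Merged

/-! ### The curvature of the log-partition function along a schedule -/

section Curvature

theorem two_mul_sub_div_add_le_log {x : ℝ} (hx : 1 ≤ x) : 2 * ((x - 1) / (x + 1)) ≤ Real.log x := by
  set t := (x - 1) / (x + 1) with ht
  have ht0 : 0 ≤ t := div_nonneg (by linarith) (by linarith)
  have ht1 : t < 1 := (div_lt_one (by linarith)).2 (by linarith)
  have h := Real.hasSum_log_sub_log_of_abs_lt_one (by rwa [abs_of_nonneg ht0])
  have h1 := h.summable.sum_le_tsum (Finset.range 1) fun i _ => by positivity
  rw [h.tsum_eq] at h1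
  have h2 : Real.log (1 + t) - Real.log (1 - t) = Real.log x := by
    rw [← Real.log_div (by linarith) (by linarith)]
    congr 1
    rw [ht]
    have : x + 1 ≠ 0 := by linarith
    field_simp
    ring
  rw [← h2]
  simpa using h1

/-- The logarithmic mean of A and B is at most their arithmetic mean. -/
theorem sub_div_add_le_half_log {A B : ℝ} (hA : 0 < A) (hAB : A ≤ B) :
    B - A ≤ (A + B) / 2 * Real.log (B / A) := by
  have h := two_mul_sub_div_add_le_log ((one_le_div hA).2 hAB)
  have h1 : B - A = (A + B) / 2 * (2 * ((B / A - 1) / (B / A + 1))) := by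
    have : B + A ≠ 0 := by linarith
    field_simp
    ring
  rw [h1]
  exact mul_le_mul_of_nonneg_left h (by linarith)

/-- From 1 - e^{-u} = 2 sinh(u/2) e^{-u/2} and sinh x ≥ x for x ≥ 0. -/
theorem log_sub_half_le_log_one_sub_exp {u : ℝ} (hu : 0 < u) :
    Real.log u - u / 2 ≤ Real.log (1 - Real.exp (-u)) := by
  have h1 : u / 2 ≤ Real.sinh (u / 2) := Real.self_le_sinh_iff.2 (by linarith)
  have h2 : 1 - Real.exp (-u) = 2 * Real.sinh (u / 2) * Real.exp (-(u / 2)) := by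
    rw [Real.sinh_eq, mul_div_cancel₀ _ (two_ne_zero), sub_mul, ← Real.exp_add, ← Real.exp_add]
    ring_nf
    rw [Real.exp_zero]
    ring
  have h3 : u * Real.exp (-(u / 2)) ≤ 1 - Real.exp (-u) := by
    rw [h2]
    gcongr
    linarith
  have h4 := Real.log_le_log (by positivity) h3
  rwa [Real.log_mul hu.ne' (Real.exp_pos _).ne', Real.log_exp, ← sub_eq_add_neg] at h4

theorem log_six_le : Real.log 6 ≤ 28 / 15 := by
  rw [Real.log_le_iff_le_exp (by norm_num)]
  refine le_of_pow_le_pow_left₀ (n := 15) (by norm_num) (Real.exp_nonneg _) ?_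
  rw [← Real.exp_nat_mul]
  have h1 : Real.exp ((15 : ℕ) * (28 / 15)) = Real.exp 1 ^ 28 := by
    rw [← Real.exp_nat_mul]; norm_num
  rw [h1]
  calc (6 : ℝ) ^ 15 ≤ 2.7 ^ 28 := by norm_num
    _ ≤ Real.exp 1 ^ 28 := by
      gcongr
      linarith [Real.exp_one_gt_d9]

/-- As ln is concave, the two ends suffice. The rational bounds are fitted to them: 1/3 = 11/5 -
28/15 at v = 1/6 and 7/3 = 11/5 + 2/15 at v = 7/6. -/
theorem two_mul_le_add_log {v : ℝ} (h1 : 1 / 6 ≤ v) (h2 : v ≤ 7 / 6) :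
    2 * v ≤ 11 / 5 + Real.log v := by
  have hc := strictConcaveOn_log_Ioi.concaveOn.right
    (show (1 / 6 : ℝ) ∈ Set.Ioi 0 by norm_num) (show (7 / 6 : ℝ) ∈ Set.Ioi 0 by norm_num)
    (show 0 ≤ 7 / 6 - v by linarith) (show 0 ≤ v - 1 / 6 by linarith) (by ring)
  have hv : (7 / 6 - v) • (1 / 6 : ℝ) + (v - 1 / 6) • (7 / 6 : ℝ) = v := by
    simp only [smul_eq_mul]; ring
  rw [hv] at hc
  simp only [smul_eq_mul] at hc
  have h3 : -(28 / 15) ≤ Real.log (1 / 6) := by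
    rw [one_div, Real.log_inv]
    linarith [log_six_le]
  have h4 : 2 / 15 ≤ Real.log (7 / 6) :=
    le_trans (by norm_num) (two_mul_sub_div_add_le_log (x := 7 / 6) (by norm_num))
  have h5 := mul_le_mul_of_nonneg_left h3 (by linarith : 0 ≤ 7 / 6 - v)
  have h6 := mul_le_mul_of_nonneg_left h4 (by linarith : 0 ≤ v - 1 / 6)
  linarith

/-- Summing increments which are bounded by the increments of `u`, and, where `M` is positive, by
those of a multiple of `log M`. -/
theorem sum_le_of_log_increments {u M D : ℕ → ℝ} {l : ℕ} {η N : ℝ} (hη : 0 < η) (hη1 : η ≤ 1)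
    (hN : 1 ≤ N) (hu0 : u 0 = 0) (hu : ∀ i < l, u i ≤ u (i + 1)) (hgap : ∀ i < l, u (i + 1) ≤ u i + η)
    (hM : ∀ i ≤ l, 1 - Real.exp (-u i) ≤ M i) (hMN : ∀ i ≤ l, M i ≤ N)
    (hD : ∀ i < l, D i ≤ u (i + 1) - u i)
    (hD' : ∀ i < l, 0 < M i → D i ≤ η / 2 * (Real.log (M (i + 1)) - Real.log (M i))) :
    ∑ i ∈ Finset.range l, D i ≤ η / 2 * (11 / 5 + Real.log N - Real.log η + 7 / 12 * η) := by
  have hS : ∀ i ≤ l, ∑ k ∈ Finset.range i, D k ≤ u i := by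
    intro i
    induction i with
    | zero => simp [hu0]
    | succ i ih =>
      intro hi
      rw [Finset.sum_range_succ]
      linarith [ih (by omega), hD i (by omega)]
  have humono : ∀ i j, i ≤ j → j ≤ l → u i ≤ u j := by
    intro i j hij
    induction j, hij using Nat.le_induction with
    | base => intro _; exact le_rfl
    | succ j _ ih => intro hj; exact (ih (by omega)).trans (hu j (by omega))
  have hlogη : Real.log η ≤ 0 := Real.log_nonpos hη.le hη1
  have hlogN : 0 ≤ Real.log N := Real.log_nonneg hN
  -- Let j be the first index with u j ≥ η/6; then u j ≤ 7η/6. Up to j the increments are bounded by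
  -- those of u, in total u j. After j the logarithms telescope to ln N - ln M_j, and M_j ≥ 1 -
  -- e^{-u j} keeps this finite. With v = u j / η in [1/6, 7/6] the two parts combine through
  -- `two_mul_le_add_log`. If no such j exists, the whole sum is at most η/6.
  by_cases hex : ∃ j, j ≤ l ∧ η / 6 ≤ u j
  · classical
    let j := Nat.find hex
    obtain ⟨hjl, hj⟩ : j ≤ l ∧ η / 6 ≤ u j := Nat.find_spec hex
    have hj0 : j ≠ 0 := by
      intro h0
      rw [h0, hu0] at hj
      linarith
    obtain ⟨i, hi⟩ := Nat.exists_eq_succ_of_ne_zero hj0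
    have hji : u i < η / 6 := by
      by_contra! h
      exact Nat.find_min hex (show i < Nat.find hex by change i < j; omega) ⟨by omega, h⟩
    have hjη : u j ≤ 7 / 6 * η := by
      have := hgap i (by omega)
      rw [hi, Nat.succ_eq_add_one]
      linarith
    have huj : 0 < u j := by linarith
    have hMpos : ∀ k, j ≤ k → k ≤ l → 0 < M k := by
      intro k hjk hk
      refine lt_of_lt_of_le ?_ (hM k hk)
      have := humono j k hjk hk
      have : Real.exp (-u k) < 1 := by rw [Real.exp_lt_one_iff]; linarith
      linarith
    have hS2 : ∀ k, j ≤ k → k ≤ l → ∑ i ∈ Finset.range k, D i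
        ≤ u j + η / 2 * (Real.log (M k) - Real.log (M j)) := by
      intro k hjk
      induction k, hjk using Nat.le_induction with
      | base => intro h; simpa using hS j h
      | succ k hjk ih =>
        intro hk
        rw [Finset.sum_range_succ]
        have := hD' k (by omega) (hMpos k hjk (by omega))
        linarith [ih (by omega)]
    have h1 := hS2 l hjl le_rfl
    have h2 : Real.log (M l) ≤ Real.log N := Real.log_le_log (hMpos l hjl le_rfl) (hMN l le_rfl)
    have h3 : Real.log (u j) - u j / 2 ≤ Real.log (M j) :=
      (log_sub_half_le_log_one_sub_exp huj).trans (Real.log_le_log (by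
        have : Real.exp (-u j) < 1 := by rw [Real.exp_lt_one_iff]; linarith
        linarith) (hM j hjl))
    have h4 := two_mul_le_add_log (v := u j / η) (by rw [le_div_iff₀ hη]; linarith)
      (by rw [div_le_iff₀ hη]; linarith)
    rw [Real.log_div huj.ne' hη.ne'] at h4
    have h5 : u j = η / 2 * (2 * (u j / η)) := by field_simp
    have h6 : Real.log (M l) - Real.log (M j) ≤ Real.log N - Real.log (u j) + 7 / 12 * η := by
      linarith
    have h7 := mul_le_mul_of_nonneg_left h6 (by linarith : 0 ≤ η / 2)
    have h8 := mul_le_mul_of_nonneg_left h4 (by linarith : 0 ≤ η / 2)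
    linarith
  · push Not at hex
    have h1 := hS l le_rfl
    have h2 := hex l le_rfl
    have h3 : η / 6 ≤ η / 2 * (11 / 5 + Real.log N - Real.log η + 7 / 12 * η) := by
      have : (1 : ℝ) / 3 ≤ 11 / 5 + Real.log N - Real.log η + 7 / 12 * η := by linarith
      have := mul_le_mul_of_nonneg_left this (by linarith : 0 ≤ η / 2)
      linarith
    linarith

/-! ### Convexity of the logarithm of a weighted exponential sum -/

section Weighted

variable {Ω : Type*} [Fintype Ω] [Nonempty Ω] {w k : Ω → ℝ} {n : ℕ}

/-- The weighted exponential sum `∑ w_x exp (b k_x)`. -/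
def expSum (w k : Ω → ℝ) (b : ℝ) : ℝ := ∑ x, w x * Real.exp (b * k x)

/-- The logarithmic derivative of `expSum`. -/
def expMean (w k : Ω → ℝ) (b : ℝ) : ℝ := (∑ x, w x * k x * Real.exp (b * k x)) / expSum w k b

theorem expSum_pos (hw : ∀ x, 0 < w x) (b : ℝ) : 0 < expSum w k b :=
  Finset.sum_pos (fun x _ => mul_pos (hw x) (Real.exp_pos _)) Finset.univ_nonempty

theorem expMean_mul (hw : ∀ x, 0 < w x) (b : ℝ) :
    expMean w k b * expSum w k b = ∑ x, w x * k x * Real.exp (b * k x) :=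
  div_mul_cancel₀ _ (expSum_pos hw b).ne'

/-- The graph of `log expSum` lies above its tangents. -/
theorem mul_expMean_le (hw : ∀ x, 0 < w x) (b c : ℝ) :
    (c - b) * expMean w k b ≤ Real.log (expSum w k c) - Real.log (expSum w k b) := by
  have hb := expSum_pos (k := k) hw b
  rw [← Real.log_div (expSum_pos hw c).ne' hb.ne',
    Real.le_log_iff_exp_le (div_pos (expSum_pos hw c) hb), le_div_iff₀ hb]
  set m := expMean w k b
  have h1 : ∀ x, w x * Real.exp (b * k x) * (Real.exp ((c - b) * m) * ((c - b) * (k x - m) + 1))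
      ≤ w x * Real.exp (c * k x) := fun x => by
    have h2 := Real.add_one_le_exp ((c - b) * (k x - m))
    have h3 : Real.exp (c * k x)
        = Real.exp (b * k x) * (Real.exp ((c - b) * m) * Real.exp ((c - b) * (k x - m))) := by
      rw [← Real.exp_add, ← Real.exp_add]
      congr 1
      ring
    rw [h3, mul_assoc]
    have := (hw x).le
    gcongr
  have h4 := Finset.sum_le_sum fun x (_ : x ∈ Finset.univ) => h1 x
  have h5 : ∑ x, w x * Real.exp (b * k x) * (Real.exp ((c - b) * m) * ((c - b) * (k x - m) + 1))
      = Real.exp ((c - b) * m) * ((c - b) * ((∑ x, w x * k x * Real.exp (b * k x))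
        - m * expSum w k b) + expSum w k b) := by
    simp only [expSum, Finset.mul_sum, ← Finset.sum_sub_distrib, ← Finset.sum_add_distrib]
    exact Finset.sum_congr rfl fun x _ => by ring
  rw [h5, ← expMean_mul hw, sub_self, mul_zero, zero_add] at h4
  exact h4

theorem expMean_le (hw : ∀ x, 0 < w x) (hk : ∀ x, k x ≤ n) (b : ℝ) : expMean w k b ≤ n := by
  rw [expMean, div_le_iff₀ (expSum_pos hw b), expSum, Finset.mul_sum]
  refine Finset.sum_le_sum fun x _ => ?_
  have := mul_le_mul_of_nonneg_left (hk x) (mul_pos (hw x) (Real.exp_pos (b * k x))).le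
  linarith

theorem expMean_nonneg (hw : ∀ x, 0 < w x) (hk : ∀ x, 0 ≤ k x) (b : ℝ) : 0 ≤ expMean w k b :=
  div_nonneg (Finset.sum_nonneg fun x _ =>
    mul_nonneg (mul_nonneg (hw x).le (hk x)) (Real.exp_nonneg _)) (expSum_pos hw b).le

/-- The left side is (S(b) - S(a))/S(b) for the sum S. Terms with k = 0 cancel in the difference,
and in every other term k ≥ 1. This is where integrality of the Hamiltonian enters. -/
theorem one_sub_exp_le_expMean (hw : ∀ x, 0 < w x) (hk : ∀ x, k x = 0 ∨ 1 ≤ k x) (a b : ℝ) :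
    1 - Real.exp (-(Real.log (expSum w k b) - Real.log (expSum w k a))) ≤ expMean w k b := by
  have ha := expSum_pos (k := k) hw a
  have hb := expSum_pos (k := k) hw b
  rw [neg_sub, Real.exp_sub, Real.exp_log ha, Real.exp_log hb, expMean, one_sub_div hb.ne']
  refine div_le_div_of_nonneg_right ?_ hb.le
  rw [expSum, expSum, ← Finset.sum_sub_distrib]
  refine Finset.sum_le_sum fun x _ => ?_
  rcases hk x with h | h
  · simp [h]
  · have h1 := mul_le_mul_of_nonneg_left h (mul_pos (hw x) (Real.exp_pos (b * k x))).le
    have h2 := (mul_pos (hw x) (Real.exp_pos (a * k x))).le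
    linarith

/-- The total curvature of `log expSum` along a schedule with short gaps. -/
theorem sum_curvature_le (hw : ∀ x, 0 < w x) (hk : ∀ x, k x = 0 ∨ 1 ≤ k x) (hkn : ∀ x, k x ≤ n)
    (hn : 1 ≤ n) {t : ℕ → ℝ} {l : ℕ} {η : ℝ} (hη : 0 < η) (hη1 : η ≤ 1)
    (ht : ∀ i < l, t i ≤ t (i + 1))
    (hgap : ∀ i < l, Real.log (expSum w k (t (i + 1))) - Real.log (expSum w k (t i)) ≤ η) :
    ∑ i ∈ Finset.range l, (Real.log (expSum w k (t i)) + Real.log (expSum w k (t (i + 1)))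
        - 2 * Real.log (expSum w k ((t i + t (i + 1)) / 2)))
      ≤ η / 2 * (11 / 5 + Real.log n - Real.log η + 7 / 12 * η) := by
  have hk0 : ∀ x, 0 ≤ k x := fun x => by rcases hk x with h | h <;> linarith
  set f : ℝ → ℝ := fun b => Real.log (expSum w k b) with hf
  have htan : ∀ b c, (c - b) * expMean w k b ≤ f c - f b := mul_expMean_le hw
  have hmono : ∀ {b c}, b ≤ c → f b ≤ f c := fun {b c} hbc => by
    have h1 := htan b c
    have h2 := mul_nonneg (sub_nonneg.2 hbc) (expMean_nonneg hw hk0 b)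
    linarith
  refine sum_le_of_log_increments (u := fun i => f (t i) - f (t 0))
    (M := fun i => expMean w k (t i)) hη hη1 (by exact_mod_cast hn) (sub_self _)
    (fun i hi => sub_le_sub_right (hmono (ht i hi)) _) (fun i hi => ?_)
    (fun i _ => one_sub_exp_le_expMean hw hk (t 0) (t i)) (fun i _ => expMean_le hw hkn _)
    (fun i hi => ?_) fun i hi hMi => ?_
  · have := hgap i hi
    simp only [hf]
    linarith
  · have h1 := hmono (b := t i) (c := (t i + t (i + 1)) / 2) (by linarith [ht i hi])
    simp only [hf] at h1 ⊢
    linarith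
  · set a := t i
    set b := t (i + 1)
    have hab : a ≤ b := ht i hi
    set m := (a + b) / 2 with hm
    change f a + f b - 2 * f m ≤ _
    rcases hab.eq_or_lt with h0 | h0
    · have hma : m = a := by rw [hm, ← h0]; ring
      rw [← h0, hma]
      simp only [sub_self, mul_zero]
      linarith
    -- Let A ≤ B be the increments of f over the two halves. The tangents at a and b give B/A ≤
    -- M(b)/M(a), and D = B - A ≤ (A+B)/2 · ln(B/A) with A + B ≤ η.
    have hA : (b - a) / 2 * expMean w k a ≤ f m - f a := by
      have := htan a m
      rw [show m - a = (b - a) / 2 by rw [hm]; ring] at this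
      exact this
    have hB : f b - f m ≤ (b - a) / 2 * expMean w k b := by
      have := htan b m
      rw [show m - b = -((b - a) / 2) by rw [hm]; ring] at this
      linarith
    have hAB : f m - f a ≤ f b - f m := by
      have h1 := htan m a
      have h2 := htan m b
      rw [show a - m = -((b - a) / 2) by rw [hm]; ring] at h1
      rw [show b - m = (b - a) / 2 by rw [hm]; ring] at h2
      linarith
    have hhalf : 0 < (b - a) / 2 := by linarith
    have hApos : 0 < f m - f a := lt_of_lt_of_le (mul_pos hhalf hMi) hA
    have hMb : 0 < expMean w k b := by
      have : 0 < (b - a) / 2 * expMean w k b := by linarith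
      exact pos_of_mul_pos_right this hhalf.le
    have h1 := sub_div_add_le_half_log hApos hAB
    have hratio : (f b - f m) / (f m - f a) ≤ expMean w k b / expMean w k a := by
      rw [div_le_div_iff₀ hApos hMi]
      calc (f b - f m) * expMean w k a ≤ (b - a) / 2 * expMean w k b * expMean w k a := by
            gcongr
        _ = expMean w k b * ((b - a) / 2 * expMean w k a) := by ring
        _ ≤ expMean w k b * (f m - f a) := by gcongr
    have hlog0 : 0 ≤ Real.log ((f b - f m) / (f m - f a)) :=
      Real.log_nonneg ((one_le_div hApos).2 hAB)
    have hlog : Real.log ((f b - f m) / (f m - f a))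
        ≤ Real.log (expMean w k b) - Real.log (expMean w k a) := by
      rw [← Real.log_div hMb.ne' hMi.ne']
      exact Real.log_le_log (div_pos (hApos.trans_le hAB) hApos) hratio
    have hle : (f m - f a + (f b - f m)) / 2 ≤ η / 2 := by
      have := hgap i hi
      change f b - f a ≤ η at this
      linarith
    have h2 := mul_le_mul hle hlog hlog0 (by linarith)
    linarith

end Weighted

/-- For η = 5/(2L), ln n + ln 2 is L - 2 and ln(L/5) ≤ L/5 - 1, so the bracket is at most 6L/5 - 4/5
+ 35/(24L). The last two terms sum to at most 0 since L ≥ 2.69, and η/2 · 6L/5 = 3/2. -/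
theorem logRange_bound {n : ℕ} (hn : 1 ≤ n) {L : ℝ} (hL : L = 2 + Real.log (2 * n)) :
    2.69 ≤ L ∧ 5 / (2 * L) / 2 * (11 / 5 + Real.log n - Real.log (5 / (2 * L))
      + 7 / 12 * (5 / (2 * L))) ≤ 3 / 2 := by
  have hn' : (1 : ℝ) ≤ n := by exact_mod_cast hn
  have hlogn : 0 ≤ Real.log n := Real.log_nonneg hn'
  rw [Real.log_mul two_ne_zero (by linarith)] at hL
  have h2 := Real.log_two_gt_d9
  have hL0 : 2.69 ≤ L := by linarith
  refine ⟨hL0, ?_⟩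
  have hLpos : 0 < L := by linarith
  have h3 : Real.log (5 / (2 * L)) = -(Real.log (L / 5) + Real.log 2) := by
    rw [← Real.log_mul (by positivity) two_ne_zero, ← Real.log_inv]
    congr 1
    field_simp
  have h4 := Real.log_le_sub_one_of_pos (show 0 < L / 5 by positivity)
  rw [h3]
  have h5 : 11 / 5 + Real.log n - -(Real.log (L / 5) + Real.log 2) + 7 / 12 * (5 / (2 * L))
      ≤ 6 / 5 * L - 4 / 5 + 35 / 24 / L := by
    have : 7 / 12 * (5 / (2 * L)) = 35 / 24 / L := by field_simp; norm_num
    rw [this]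
    linarith
  have h6 : 35 / 24 / L ≤ 4 / 5 := by
    rw [div_le_iff₀ hLpos]
    linarith
  calc _ ≤ 5 / (2 * L) / 2 * (6 / 5 * L) := by
        gcongr
        linarith
    _ = 3 / 2 := by field_simp; norm_num

/-- The total curvature of the log-partition function along a schedule with short gaps. -/
theorem sum_log_partitionFunction_curvature_le {Ω : Type*} [Fintype Ω] [Nonempty Ω] {H : Ω → ℝ}
    {σ : HamiltonianSign} {n : ℕ} (hH : HasRange H n σ) (hn : 1 ≤ n) {β : ℝ} {t : ℕ → ℝ} {l : ℕ}
    (ht : ∀ i < l, t i ≤ t (i + 1))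
    (hgap : ∀ i < l, |remaining H σ β (t (i + 1)) - remaining H σ β (t i)|
      ≤ 5 / (2 * (2 + Real.log (2 * n)))) :
    ∑ i ∈ Finset.range l, (Real.log (partitionFunction H (t i))
        + Real.log (partitionFunction H (t (i + 1)))
        - 2 * Real.log (partitionFunction H ((t i + t (i + 1)) / 2))) ≤ 3 / 2 := by
  obtain ⟨hL, hbound⟩ := logRange_bound hn rfl
  set L := 2 + Real.log (2 * n)
  refine le_trans ?_ hbound
  have hη : 0 < 5 / (2 * L) := div_pos (by norm_num) (by linarith)
  have hη1 : 5 / (2 * L) ≤ 1 := by rw [div_le_one (by linarith)]; linarith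
  have hgap' : ∀ i < l, |Real.log (partitionFunction H (t (i + 1)))
      - Real.log (partitionFunction H (t i))| ≤ 5 / (2 * L) := fun i hi => by
    have := hgap i hi
    rwa [remaining, remaining, sub_sub_sub_cancel_right] at this
  cases σ
  · have hZ : ∀ b, partitionFunction H b = expSum (fun _ => 1) (fun x => -H x) b := fun b => by
      simp [partitionFunction, expSum]
    simp only [hZ] at hgap' ⊢
    refine sum_curvature_le (fun _ => one_pos) (fun x => ?_) (fun x => ?_) hn hη hη1 ht
      fun i hi => (le_abs_self _).trans (hgap' i hi)
    · obtain ⟨j, -, hj⟩ := hH x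
      rcases Nat.eq_zero_or_pos j with h | h
      · left; simp [hj, h]
      · right; rw [hj, neg_neg]; exact_mod_cast h
    · obtain ⟨j, hjn, hj⟩ := hH x
      rw [hj, neg_neg]; exact_mod_cast hjn
  -- For H ≥ 0 the partition function decreases. In the variable β - b, with weights e^{-βH}, it
  -- becomes an increasing exponential sum, and the schedule is read backwards.
  · have hZ : ∀ b, partitionFunction H b = expSum (fun x => Real.exp (-β * H x)) H (β - b) :=
      fun b => by
        simp only [partitionFunction, expSum, ← Real.exp_add]
        exact Finset.sum_congr rfl fun x _ => by ring_nf
    simp only [hZ] at hgap' ⊢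
    have := sum_curvature_le (w := fun x => Real.exp (-β * H x)) (k := H)
      (t := fun i => β - t (l - i)) (l := l) (fun x => Real.exp_pos _) (fun x => ?_) (fun x => ?_)
      hn hη hη1 (fun i hi => ?_) (fun i hi => ?_)
    · refine le_trans (le_of_eq ?_) this
      rw [← Finset.sum_range_reflect]
      refine Finset.sum_congr rfl fun i hi => ?_
      have hi' := Finset.mem_range.1 hi
      rw [show l - 1 - i + 1 = l - i by omega, show l - (i + 1) = l - 1 - i by omega]
      have : (β - t (l - i) + (β - t (l - 1 - i))) / 2 = β - (t (l - 1 - i) + t (l - i)) / 2 := by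
        ring
      rw [this]
      ring
    · obtain ⟨j, -, hj⟩ := hH x
      rcases Nat.eq_zero_or_pos j with h | h
      · left; simp [hj, h]
      · right; rw [hj]; exact_mod_cast h
    · obtain ⟨j, hjn, hj⟩ := hH x
      rw [hj]; exact_mod_cast hjn
    · have := ht (l - (i + 1)) (by omega)
      rw [show l - (i + 1) + 1 = l - i by omega] at this
      linarith
    · have := hgap' (l - (i + 1)) (by omega)
      rw [show l - (i + 1) + 1 = l - i by omega, abs_sub_comm] at this
      exact (le_abs_self _).trans this

end Curvature

/-! ### The estimation phase for a fixed schedule -/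

section Estimation

variable {Ω S : Type*} {H : Ω → ℝ} {β : ℝ} {draw : ℝ → S → Ω}

variable (H draw) in
/-- The product of the values `exp (-(u i - v i) H X)` with `X` drawn from `π_{v i}`, in repetition
`a`, with the draws numbered from `s` on. -/
def prodEst (l s : ℕ) (u v : ℕ → ℝ) (a : ℕ) (ω : Randomness S) : ℝ :=
  ∏ i ∈ Finset.range l, Real.exp (-(u i - v i) * H (draw (v i) (ω (.est a (i + s))).1))

theorem prodEst_pos (l s : ℕ) (u v : ℕ → ℝ) (a : ℕ) (ω : Randomness S) :
    0 < prodEst H draw l s u v a ω :=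
  Finset.prod_pos fun _ _ => Real.exp_pos _

/-- The square is a product of the same kind, so second moments are again ratios of partition
functions. -/
theorem prodEst_sq (l s : ℕ) (u v : ℕ → ℝ) (a : ℕ) (ω : Randomness S) :
    prodEst H draw l s u v a ω ^ 2 = prodEst H draw l s (fun i => 2 * u i - v i) v a ω := by
  rw [prodEst, prodEst, ← Finset.prod_pow]
  refine Finset.prod_congr rfl fun i _ => ?_
  rw [← Real.exp_nat_mul]
  congr 1
  push_cast
  ring

theorem dependsOn_prodEst (l s : ℕ) (u v : ℕ → ℝ) (a : ℕ) :
    DependsOn (prodEst H draw l s u v a) {c | ∃ i, c = Cell.est a i} := by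
  intro x y hxy
  refine Finset.prod_congr rfl fun i _ => ?_
  rw [hxy (.est a (i + s)) ⟨_, rfl⟩]

variable [Fintype Ω] [MeasurableSpace S] {ν : Measure S}

theorem IsGibbsOracle.measurable_exp_draw (hdraw : IsGibbsOracle H β ν draw) (x b : ℝ) :
    Measurable fun s : S => Real.exp (x * H (draw b s)) :=
  Real.measurable_exp.comp (((hdraw.measurable_comp H).comp
    (by fun_prop : Measurable fun s : S => (b, s))).const_mul x)

theorem IsGibbsOracle.measurable_prodEst (hdraw : IsGibbsOracle H β ν draw) (l s : ℕ)
    (u v : ℕ → ℝ) (a : ℕ) : Measurable (prodEst H draw l s u v a) :=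
  Finset.measurable_prod _ fun i _ => (hdraw.measurable_exp_draw (-(u i - v i)) (v i)).comp
    (by fun_prop : Measurable fun ω : Randomness S => (ω (.est a (i + s))).1)

variable [Nonempty Ω] [IsProbabilityMeasure ν]

theorem lintegral_comp_cell_fst (c : Cell) {f : S → ℝ≥0∞} (hf : Measurable f) :
    ∫⁻ ω, f (ω c).1 ∂randomnessLaw ν = ∫⁻ x, f x ∂ν := by
  rw [randomnessLaw_eq, ← lintegral_map (f := fun p : S × ℝ => f p.1)
    (g := fun ω : Randomness S => ω c) (hf.comp measurable_fst) (measurable_pi_apply c),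
    Measure.infinitePi_map_eval, cellLaw,
    lintegral_prod (fun p : S × ℝ => f p.1) (hf.comp measurable_fst).aemeasurable]
  simp

/-- The mean of `prodEst`. -/
def meanEst (H : Ω → ℝ) (l : ℕ) (u v : ℕ → ℝ) : ℝ :=
  ∏ i ∈ Finset.range l, partitionFunction H (u i) / partitionFunction H (v i)

theorem meanEst_pos (l : ℕ) (u v : ℕ → ℝ) : 0 < meanEst H l u v :=
  Finset.prod_pos fun _ _ => div_pos (partitionFunction_pos H _) (partitionFunction_pos H _)

theorem lintegral_prodEst (hdraw : IsGibbsOracle H β ν draw) (l s : ℕ) (u : ℕ → ℝ) {v : ℕ → ℝ}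
    (hv : ∀ i, v i ∈ Set.Icc 0 β) (a : ℕ) :
    ∫⁻ ω, ENNReal.ofReal (prodEst H draw l s u v a ω) ∂randomnessLaw ν
      = ENNReal.ofReal (meanEst H l u v) := by
  unfold prodEst meanEst
  simp only [ENNReal.ofReal_prod_of_nonneg fun i _ => Real.exp_nonneg _]
  rw [ENNReal.ofReal_prod_of_nonneg fun i _ => (div_pos (partitionFunction_pos H (u i))
    (partitionFunction_pos H (v i))).le]
  have hm : ∀ i, Measurable fun x : S =>
      ENNReal.ofReal (Real.exp (-(u i - v i) * H (draw (v i) x))) := fun i =>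
    ENNReal.measurable_ofReal.comp (hdraw.measurable_exp_draw _ _)
  rw [randomnessLaw_eq, lintegral_prod_of_dependsOn (T := fun i => {Cell.est a (i + s)})
    (cellLaw ν) (Finset.range l) (f := fun i (ω : Randomness S) =>
      ENNReal.ofReal (Real.exp (-(u i - v i) * H (draw (v i) (ω (.est a (i + s))).1))))]
  · refine Finset.prod_congr rfl fun i _ => ?_
    rw [← randomnessLaw_eq, lintegral_comp_cell_fst (Cell.est a (i + s)) (hm i),
      hdraw.lintegral_exp (hv i)]
  · intro i j hij
    simp only [Function.onFun, Set.disjoint_singleton, ne_eq, Cell.est.injEq, true_and]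
    omega
  · intro i
    exact (hm i).comp (by fun_prop : Measurable fun ω : Randomness S => (ω (.est a (i + s))).1)
  · intro i x y hxy
    simp only [hxy (.est a (i + s)) rfl]

theorem lintegral_prodEst_mul (hdraw : IsGibbsOracle H β ν draw) (l s : ℕ) (u : ℕ → ℝ) {v : ℕ → ℝ}
    (hv : ∀ i, v i ∈ Set.Icc 0 β) {a b : ℕ} (hab : a ≠ b) :
    ∫⁻ ω, ENNReal.ofReal (prodEst H draw l s u v a ω * prodEst H draw l s u v b ω)
        ∂randomnessLaw ν
      = ENNReal.ofReal (meanEst H l u v * meanEst H l u v) := by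
  simp only [ENNReal.ofReal_mul (prodEst_pos (H := H) (draw := draw) l s u v a _).le]
  have hm := fun a => ENNReal.measurable_ofReal.comp (hdraw.measurable_prodEst l s u v a)
  have := lintegral_mul_of_dependsOn (T := {c | ∃ i, c = Cell.est a i}) (cellLaw ν) (hm a) (hm b)
    (fun x y hxy => by simp only [Function.comp, dependsOn_prodEst l s u v a hxy])
    (fun x y hxy => by
      simp only [Function.comp]
      rw [dependsOn_prodEst l s u v b fun i hi => hxy i ?_]
      obtain ⟨i, rfl⟩ := hi
      rintro ⟨j, hj⟩
      exact hab (Cell.est.inj hj).1.symm)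
  simp only [Function.comp, ← randomnessLaw_eq] at this
  rw [this, lintegral_prodEst hdraw l s u hv, lintegral_prodEst hdraw l s u hv,
    ← ENNReal.ofReal_mul (meanEst_pos l u v).le]

/-- The relative second moment of `prodEst`. -/
def relMoment (H : Ω → ℝ) (l : ℕ) (u v : ℕ → ℝ) : ℝ :=
  meanEst H l (fun i => 2 * u i - v i) v / meanEst H l u v ^ 2

/-- The relative variance of the average of `r` repetitions. -/
theorem lintegral_sq_average_le (hdraw : IsGibbsOracle H β ν draw) (l s : ℕ) (u : ℕ → ℝ)
    {v : ℕ → ℝ} (hv : ∀ i, v i ∈ Set.Icc 0 β) {r : ℕ} (hr : 1 ≤ r) {R : ℝ} (hR : 1 ≤ R)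
    (hmom : relMoment H l u v ≤ R) :
    ∫⁻ ω, ENNReal.ofReal ((((∑ a ∈ Finset.range r, prodEst H draw l s u v a ω) / r)
        / meanEst H l u v - 1) ^ 2) ∂randomnessLaw ν ≤ ENNReal.ofReal ((R - 1) / r) := by
  set m := meanEst H l u v
  have hm : 0 < m := meanEst_pos l u v
  have hr' : (0 : ℝ) < r := by exact_mod_cast hr
  set P := prodEst H draw l s u v
  have hP : ∀ a ω, 0 < P a ω := fun a ω => prodEst_pos l s u v a ω
  have hPm : ∀ a, Measurable (P a) := fun a => hdraw.measurable_prodEst l s u v a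
  set X : Randomness S → ℝ := fun ω => ((∑ a ∈ Finset.range r, P a ω) / r) / m
  have hX0 : ∀ ω, 0 ≤ X ω := fun ω =>
    div_nonneg (div_nonneg (Finset.sum_nonneg fun a _ => (hP a ω).le) hr'.le) hm.le
  have hXm : Measurable X :=
    ((Finset.measurable_sum _ fun a _ => hPm a).div_const _).div_const _
  have h1 : ∫⁻ ω, ENNReal.ofReal (X ω) ∂randomnessLaw ν = 1 := by
    have : ∀ ω, ENNReal.ofReal (X ω)
        = ∑ a ∈ Finset.range r, ENNReal.ofReal (P a ω) * ENNReal.ofReal (1 / (r * m)) := fun ω => by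
      rw [← Finset.sum_mul, ← ENNReal.ofReal_sum_of_nonneg fun a _ => (hP a ω).le,
        ← ENNReal.ofReal_mul (Finset.sum_nonneg fun a _ => (hP a ω).le)]
      congr 1
      simp only [X]
      field_simp
    simp only [this]
    rw [lintegral_finsetSum _ fun a _ => ((hPm a).ennreal_ofReal).mul_const _]
    have h2 : ∀ a, ∫⁻ ω, ENNReal.ofReal (P a ω) * ENNReal.ofReal (1 / (r * m)) ∂randomnessLaw ν
        = ENNReal.ofReal (1 / r) := fun a => by
      rw [lintegral_mul_const _ (hPm a).ennreal_ofReal, lintegral_prodEst hdraw l s u hv,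
        ← ENNReal.ofReal_mul hm.le]
      congr 1
      field_simp
    simp only [h2, Finset.sum_const, Finset.card_range, nsmul_eq_mul]
    rw [← ENNReal.ofReal_natCast, ← ENNReal.ofReal_mul hr'.le, mul_one_div_cancel hr'.ne',
      ENNReal.ofReal_one]
  have h2 : ∫⁻ ω, ENNReal.ofReal (X ω ^ 2) ∂randomnessLaw ν
      ≤ ENNReal.ofReal (1 + (R - 1) / r) := by
    have : ∀ ω, ENNReal.ofReal (X ω ^ 2) = ∑ a ∈ Finset.range r, ∑ b ∈ Finset.range r,
        ENNReal.ofReal (P a ω * P b ω) * ENNReal.ofReal (1 / (r * m) ^ 2) := fun ω => by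
      have h0 : ∀ a b, 0 ≤ P a ω * P b ω := fun a b => (mul_pos (hP a ω) (hP b ω)).le
      simp only [← Finset.sum_mul, ← ENNReal.ofReal_sum_of_nonneg fun b _ => h0 _ b]
      rw [← ENNReal.ofReal_sum_of_nonneg fun a _ => Finset.sum_nonneg fun b _ => h0 a b,
        ← ENNReal.ofReal_mul (Finset.sum_nonneg fun a _ => Finset.sum_nonneg fun b _ => h0 a b)]
      congr 1
      simp only [X, ← Finset.mul_sum, ← Finset.sum_mul]
      field_simp
    simp only [this]
    have hPP : ∀ a b, Measurable fun ω => ENNReal.ofReal (P a ω * P b ω) := fun a b =>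
      ((hPm a).mul (hPm b)).ennreal_ofReal
    rw [lintegral_finsetSum _ fun a _ => Finset.measurable_sum _ fun b _ => (hPP a b).mul_const _]
    -- Distinct repetitions are independent and contribute 1/r² each; a diagonal term contributes at
    -- most R/r². The excess is thus (R-1)/r.
    have hab : ∀ a b, ∫⁻ ω, ENNReal.ofReal (P a ω * P b ω) * ENNReal.ofReal (1 / (r * m) ^ 2)
          ∂randomnessLaw ν
        ≤ ENNReal.ofReal ((1 + if a = b then R - 1 else 0) / r ^ 2) := fun a b => by
      rw [lintegral_mul_const _ (hPP a b)]
      by_cases h : a = b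
      · subst h
        simp only [if_true, ← pow_two, P, prodEst_sq]
        rw [lintegral_prodEst hdraw l s _ hv, ← ENNReal.ofReal_mul (meanEst_pos _ _ _).le]
        refine ENNReal.ofReal_le_ofReal ?_
        have : meanEst H l (fun i => 2 * u i - v i) v ≤ R * m ^ 2 := by
          rwa [relMoment, div_le_iff₀ (by positivity)] at hmom
        calc _ ≤ R * m ^ 2 * (1 / (r * m) ^ 2) := by gcongr
          _ = _ := by field_simp; ring
      · rw [lintegral_prodEst_mul hdraw l s u hv h, ← ENNReal.ofReal_mul (by positivity), if_neg h]
        refine ENNReal.ofReal_le_ofReal (le_of_eq ?_)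
        change m * m * _ = _
        field_simp
        ring
    have hnn : ∀ a b : ℕ, 0 ≤ (1 + if a = b then R - 1 else 0) / (r : ℝ) ^ 2 := fun a b => by
      split_ifs
      · exact div_nonneg (by linarith) (by positivity)
      · positivity
    calc _ ≤ ∑ a ∈ Finset.range r, ∑ b ∈ Finset.range r,
          ENNReal.ofReal ((1 + if a = b then R - 1 else 0) / r ^ 2) := by
          refine Finset.sum_le_sum fun a _ => ?_
          rw [lintegral_finsetSum _ fun b _ => (hPP a b).mul_const _]
          exact Finset.sum_le_sum fun b _ => hab a b
      _ = ENNReal.ofReal (∑ a ∈ Finset.range r, ∑ b ∈ Finset.range r,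
          (1 + if a = b then R - 1 else 0) / (r : ℝ) ^ 2) := by
          rw [ENNReal.ofReal_sum_of_nonneg fun a _ => Finset.sum_nonneg fun b _ => hnn a b]
          exact Finset.sum_congr rfl fun a _ =>
            (ENNReal.ofReal_sum_of_nonneg fun b _ => hnn a b).symm
      _ ≤ _ := by
          refine ENNReal.ofReal_le_ofReal (le_of_eq ?_)
          have : ∀ a ∈ Finset.range r, ∑ b ∈ Finset.range r,
              (1 + if a = b then R - 1 else 0) / (r : ℝ) ^ 2 = (r + (R - 1)) / r ^ 2 := by
            intro a ha
            rw [← Finset.sum_div, Finset.sum_add_distrib, Finset.sum_ite_eq, if_pos ha]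
            simp
          rw [Finset.sum_congr rfl this]
          simp only [Finset.sum_const, Finset.card_range, nsmul_eq_mul]
          field_simp
  -- The expansion of (X-1)² with mean E X = 1, arranged without subtraction in `ℝ≥0∞`.
  have h3 : ∫⁻ ω, ENNReal.ofReal ((X ω - 1) ^ 2) ∂randomnessLaw ν + 2
      = ∫⁻ ω, ENNReal.ofReal (X ω ^ 2) ∂randomnessLaw ν + 1 := by
    have e1 : ∫⁻ ω, (ENNReal.ofReal ((X ω - 1) ^ 2) + 2 * ENNReal.ofReal (X ω)) ∂randomnessLaw ν
        = ∫⁻ ω, (ENNReal.ofReal (X ω ^ 2) + 1) ∂randomnessLaw ν := by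
      refine lintegral_congr fun ω => ?_
      rw [← ENNReal.ofReal_one, show (2 : ℝ≥0∞) = ENNReal.ofReal 2 by simp,
        ← ENNReal.ofReal_mul zero_le_two, ← ENNReal.ofReal_add (sq_nonneg _)
          (mul_nonneg zero_le_two (hX0 ω)), ← ENNReal.ofReal_add (sq_nonneg _) zero_le_one]
      congr 1
      ring
    rw [lintegral_add_right _ (hXm.ennreal_ofReal.const_mul _),
      lintegral_const_mul _ hXm.ennreal_ofReal, h1, mul_one,
      lintegral_add_right _ measurable_const, lintegral_const, measure_univ, mul_one] at e1
    exact e1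
  have h4 : ∫⁻ ω, ENNReal.ofReal ((X ω - 1) ^ 2) ∂randomnessLaw ν + 2
      ≤ ENNReal.ofReal ((R - 1) / r) + 2 := by
    rw [h3]
    have hnn : 0 ≤ (R - 1) / r := div_nonneg (by linarith) hr'.le
    calc _ ≤ ENNReal.ofReal (1 + (R - 1) / r) + 1 := by gcongr
      _ = _ := by
        rw [ENNReal.ofReal_add zero_le_one hnn, ENNReal.ofReal_one, add_comm 1, add_assoc,
          one_add_one_eq_two]
  exact (ENNReal.add_le_add_iff_right (by simp)).1 h4

end Estimation

/-! ### Relative errors of a quotient and numerical bounds for the number of repetitions -/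

section Ratio

/-- If both relative errors are small, then so is that of the quotient. -/
theorem quotient_bounds {x y ε : ℝ} (hε : 0 < ε) (hε' : ε ≤ 1 / 10) (hy : 0 < y)
    (h : 221 / 100 * ((x - 1) ^ 2 + (y - 1) ^ 2) < ε ^ 2) :
    1 / (1 + ε) ≤ x / y ∧ x / y ≤ 1 + ε := by
  -- Both claims are the inequality (x-1) - (1+ε)(y-1) ≤ ε, once with x and y exchanged.
  -- Cauchy–Schwarz gives the factor 1 + (1+ε)² ≤ 1 + 1.1² = 2.21.
  have key : ∀ a b : ℝ, 221 / 100 * (a ^ 2 + b ^ 2) < ε ^ 2 → a - (1 + ε) * b < ε := by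
    intro a b hab
    refine lt_of_abs_lt (sq_lt_sq₀ (abs_nonneg _) hε.le |>.1 ?_)
    rw [sq_abs]
    have h1 : (a - (1 + ε) * b) ^ 2 ≤ (1 + (1 + ε) ^ 2) * (a ^ 2 + b ^ 2) := by
      have := sq_nonneg ((1 + ε) * a + b)
      linarith
    have h2 : (1 + (1 + ε) ^ 2) * (a ^ 2 + b ^ 2) ≤ 221 / 100 * (a ^ 2 + b ^ 2) := by
      refine mul_le_mul_of_nonneg_right ?_ (by positivity)
      nlinarith
    linarith
  constructor
  · rw [div_le_div_iff₀ (by linarith) hy]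
    have := key (y - 1) (x - 1) (by linarith)
    linarith
  · rw [div_le_iff₀ hy]
    have := key (x - 1) (y - 1) h
    linarith

theorem exp_three_halves_le : Real.exp (3 / 2) ≤ 4.49 := by
  have h1 : Real.exp (3 / 2) ^ 2 = Real.exp 1 ^ 3 := by
    rw [← Real.exp_nat_mul, ← Real.exp_nat_mul]; norm_num
  have h2 : Real.exp 1 ^ 3 ≤ 2.72 ^ 3 := by
    gcongr
    linarith [Real.exp_one_lt_d9]
  have : Real.exp (3 / 2) ^ 2 ≤ 4.49 ^ 2 := by
    rw [h1]; exact h2.trans (by norm_num)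
  exact le_of_sq_le_sq this (by norm_num)

theorem sqrt_one_add_sub_one_eq {ε : ℝ} (hε : 0 < ε) : √(1 + ε) - 1 = ε / (√(1 + ε) + 1) := by
  have h := Real.sq_sqrt (show 0 ≤ 1 + ε by linarith)
  have : √(1 + ε) + 1 ≠ 0 := by positivity
  field_simp
  linarith

theorem numReps_lower {ε : ℝ} (hε : 0 < ε) : 68.7 / ε ^ 2 ≤ numReps ε := by
  refine le_trans ?_ (Nat.le_ceil _)
  have h1 : 1 ≤ √(1 + ε) := Real.one_le_sqrt.2 (by linarith)
  have h10 : (3.162 : ℝ) ≤ √10 := Real.le_sqrt_of_sq_le (by norm_num)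
  have he := Real.exp_one_gt_d9
  -- Rationalising turns the count into 2e√10 (√(1+ε) + 1)²/ε². Here the square is at least 4, and 8
  -- · 2.7182 · 3.162 exceeds 68.7.
  rw [sqrt_one_add_sub_one_eq hε, div_pow, div_div_eq_mul_div]
  gcongr
  have h2 : (2.7182 : ℝ) * 3.162 ≤ Real.exp 1 * √10 := by gcongr; linarith
  have h3 : (4 : ℝ) ≤ (√(1 + ε) + 1) ^ 2 := by nlinarith
  have h4 : 2 * ((2.7182 : ℝ) * 3.162) * 4 ≤ 2 * (Real.exp 1 * √10) * (√(1 + ε) + 1) ^ 2 := by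
    gcongr
  linarith

theorem numReps_upper {ε : ℝ} (hε : 0 < ε) (hε' : ε ≤ 1 / 10) : numReps ε ≤ 72.2 / ε ^ 2 := by
  have h1 : √(1 + ε) ≤ 1.0489 := Real.sqrt_le_iff.2 ⟨by norm_num, by linarith⟩
  have h10 : √10 ≤ (3.16228 : ℝ) := Real.sqrt_le_iff.2 ⟨by norm_num, by norm_num⟩
  have he := Real.exp_one_lt_d9
  have h0 : 0 ≤ 2 * Real.exp 1 * √10 / (√(1 + ε) - 1) ^ 2 := by positivity
  refine (Nat.ceil_lt_add_one h0).le.trans ?_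
  rw [sqrt_one_add_sub_one_eq hε, div_pow, div_div_eq_mul_div, div_add_one (by positivity)]
  gcongr
  have h2 : Real.exp 1 * √10 ≤ 2.71829 * 3.16228 := by gcongr; linarith
  have h3 : (√(1 + ε) + 1) ^ 2 ≤ (1.0489 + 1) ^ 2 := by gcongr
  have h4 : 2 * (Real.exp 1 * √10) * (√(1 + ε) + 1) ^ 2
      ≤ 2 * (2.71829 * 3.16228) * (1.0489 + 1) ^ 2 := by gcongr
  have h5 : ε ^ 2 ≤ (1 / 10) ^ 2 := by gcongr
  linarith

end Ratio

/-! ### Failure probability of the estimation phase for a fixed schedule -/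

section EstimationFailure

variable {Ω S : Type*} {H : Ω → ℝ} {β : ℝ} {draw : ℝ → S → Ω}

/-- The midpoint of an interval of a schedule. -/
def midpoints (t : ℕ → ℝ) (i : ℕ) : ℝ := (t i + t (i + 1)) / 2

variable (H draw) in
/-- The output of the estimation phase for the schedule `t 0, …, t l` and `r` repetitions. -/
def estOutput (l r : ℕ) (t : ℕ → ℝ) (ω : Randomness S) : ℝ :=
  ((∑ a ∈ Finset.range r, prodEst H draw l 0 (midpoints t) t a ω) / r)
    / ((∑ a ∈ Finset.range r, prodEst H draw l 1 (midpoints t) (fun i => t (i + 1)) a ω) / r)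

variable [Fintype Ω] [MeasurableSpace S] {ν : Measure S} [Nonempty Ω] [IsProbabilityMeasure ν]

/-- Reflection in the midpoint exchanges the ends of an interval. Hence v may be its left end (for
W) or its right end (for V), with the same relative second moment. -/
theorem relMoment_midpoints (l : ℕ) (t v : ℕ → ℝ)
    (hv : ∀ i, partitionFunction H (2 * midpoints t i - v i) * partitionFunction H (v i)
      = partitionFunction H (t i) * partitionFunction H (t (i + 1))) :
    relMoment H l (midpoints t) v = Real.exp (∑ i ∈ Finset.range l,
      (Real.log (partitionFunction H (t i)) + Real.log (partitionFunction H (t (i + 1)))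
        - 2 * Real.log (partitionFunction H ((t i + t (i + 1)) / 2)))) := by
  rw [relMoment, meanEst, meanEst, ← Finset.prod_pow, ← Finset.prod_div_distrib, Real.exp_sum]
  refine Finset.prod_congr rfl fun i _ => ?_
  have hp := fun b => partitionFunction_pos H b
  have hvp := (hp (v i)).ne'
  have hm := (hp (midpoints t i)).ne'
  rw [Real.exp_sub, Real.exp_add, Real.exp_log (hp _), Real.exp_log (hp _),
    two_mul (Real.log _), Real.exp_add, Real.exp_log (hp _), ← hv]
  change _ = _ / (partitionFunction H (midpoints t i) * partitionFunction H (midpoints t i))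
  field_simp

/-- The midpoint values cancel between W and V, and the remaining ratios telescope; this is the
purpose of pairing the two products. -/
theorem meanEst_div_meanEst (l : ℕ) (t : ℕ → ℝ) :
    meanEst H l (midpoints t) t / meanEst H l (midpoints t) (fun i => t (i + 1))
      = partitionFunction H (t l) / partitionFunction H (t 0) := by
  rw [meanEst, meanEst, ← Finset.prod_div_distrib]
  have hp := fun b => (partitionFunction_pos H b).ne'
  have h0 := hp (t 0)
  induction l with
  | zero => simp [h0]
  | succ l ih =>
    rw [Finset.prod_range_succ, ih]
    have h1 := hp (t l)
    have h2 := hp (t (l + 1))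
    have h3 := hp (midpoints t l)
    field_simp

/-- The event that an estimate of `Z(β) / Z(0)` is not within a factor `1 + ε`. -/
def failure (H : Ω → ℝ) (β ε x : ℝ) : Prop :=
  ¬ (1 / (1 + ε) ≤ x / (partitionFunction H β / partitionFunction H 0) ∧
    x / (partitionFunction H β / partitionFunction H 0) ≤ 1 + ε)

theorem measure_failure_estOutput_le (hdraw : IsGibbsOracle H β ν draw) {ε : ℝ} (hε : 0 < ε)
    (hε' : ε ≤ 1 / 10) {l : ℕ} {t : ℕ → ℝ} (ht : ∀ i, t i ∈ Set.Icc 0 β) (ht0 : t 0 = 0)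
    (htl : t l = β)
    (hcurv : ∑ i ∈ Finset.range l,
      (Real.log (partitionFunction H (t i)) + Real.log (partitionFunction H (t (i + 1)))
        - 2 * Real.log (partitionFunction H ((t i + t (i + 1)) / 2))) ≤ 3 / 2) :
    randomnessLaw ν {ω | failure H β ε (estOutput H draw l (numReps ε) t ω)}
      ≤ ENNReal.ofReal 0.24 := by
  have hr0 := numReps_lower hε
  have hrpos : (0 : ℝ) < numReps ε := lt_of_lt_of_le (by positivity) hr0
  have hr : 1 ≤ numReps ε := by exact_mod_cast hrpos
  set r := numReps ε
  set R : ℝ := 4.49 with hR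
  have hmom1 : relMoment H l (midpoints t) t ≤ R := by
    rw [relMoment_midpoints l t t fun i => by
      rw [mul_comm]; congr 2; simp only [midpoints]; ring]
    exact (Real.exp_le_exp.2 hcurv).trans exp_three_halves_le
  have hmom2 : relMoment H l (midpoints t) (fun i => t (i + 1)) ≤ R := by
    rw [relMoment_midpoints l t (fun i => t (i + 1)) fun i => by
      congr 2; simp only [midpoints]; ring]
    exact (Real.exp_le_exp.2 hcurv).trans exp_three_halves_le
  have hW := lintegral_sq_average_le hdraw l 0 (midpoints t) ht hr (by norm_num [hR]) hmom1
  have hV := lintegral_sq_average_le hdraw l 1 (midpoints t) (v := fun i => t (i + 1))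
    (fun i => ht (i + 1)) hr (by norm_num [hR]) hmom2
  set X : Randomness S → ℝ := fun ω =>
    ((∑ a ∈ Finset.range r, prodEst H draw l 0 (midpoints t) t a ω) / r)
      / meanEst H l (midpoints t) t with hX
  set Y : Randomness S → ℝ := fun ω =>
    ((∑ a ∈ Finset.range r, prodEst H draw l 1 (midpoints t) (fun i => t (i + 1)) a ω) / r)
      / meanEst H l (midpoints t) (fun i => t (i + 1)) with hY
  have hXm : Measurable X := ((Finset.measurable_sum _ fun a _ =>
    hdraw.measurable_prodEst l 0 (midpoints t) t a).div_const _).div_const _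
  have hYm : Measurable Y := ((Finset.measurable_sum _ fun a _ =>
    hdraw.measurable_prodEst l 1 (midpoints t) (fun i => t (i + 1)) a).div_const _).div_const _
  have hYpos : ∀ ω, 0 < Y ω := fun ω => div_pos (div_pos (Finset.sum_pos (fun a _ =>
    prodEst_pos _ _ _ _ _ _) ⟨0, Finset.mem_range.2 (by omega)⟩) hrpos) (meanEst_pos _ _ _)
  have hout : ∀ ω, estOutput H draw l r t ω / (partitionFunction H β / partitionFunction H 0)
      = X ω / Y ω := fun ω => by
    rw [← htl, ← ht0, ← meanEst_div_meanEst, estOutput, hX, hY]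
    simp only
    rw [div_div_div_comm]
  have hsub : {ω | failure H β ε (estOutput H draw l r t ω)}
      ⊆ {ω | ENNReal.ofReal (ε ^ 2 / (221 / 100))
        ≤ ENNReal.ofReal ((X ω - 1) ^ 2) + ENNReal.ofReal ((Y ω - 1) ^ 2)} := by
    intro ω hω
    by_contra h
    simp only [Set.mem_ofPred_eq, not_le] at h
    rw [← ENNReal.ofReal_add (sq_nonneg _) (sq_nonneg _),
      ENNReal.ofReal_lt_ofReal_iff (by positivity), lt_div_iff₀ (by norm_num)] at h
    refine hω ?_
    rw [hout]
    exact quotient_bounds hε hε' (hYpos ω) (by linarith)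
  have hXm' : Measurable fun ω => ENNReal.ofReal ((X ω - 1) ^ 2) :=
    ((hXm.sub_const 1).pow_const 2).ennreal_ofReal
  have hYm' : Measurable fun ω => ENNReal.ofReal ((Y ω - 1) ^ 2) :=
    ((hYm.sub_const 1).pow_const 2).ennreal_ofReal
  refine (measure_mono hsub).trans ?_
  have hne : ENNReal.ofReal (ε ^ 2 / (221 / 100)) ≠ 0 := by
    rw [ne_eq, ENNReal.ofReal_eq_zero, not_le]; positivity
  refine (meas_ge_le_lintegral_div (hXm'.add hYm').aemeasurable hne ENNReal.ofReal_ne_top).trans ?_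
  -- W and V share draws and need not be independent; only the sum of their relative variances is
  -- used.
  have hsum : ∫⁻ ω, (ENNReal.ofReal ((X ω - 1) ^ 2) + ENNReal.ofReal ((Y ω - 1) ^ 2))
      ∂randomnessLaw ν ≤ ENNReal.ofReal (2 * ((R - 1) / r)) := by
    rw [lintegral_add_left hXm', two_mul, ENNReal.ofReal_add]
    · exact add_le_add hW hV
    all_goals exact div_nonneg (by norm_num [hR]) hrpos.le
  calc _ ≤ ENNReal.ofReal (2 * ((R - 1) / r)) / ENNReal.ofReal (ε ^ 2 / (221 / 100)) := by
        gcongr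
        exact hsum
    _ = ENNReal.ofReal (2 * ((R - 1) / r) / (ε ^ 2 / (221 / 100))) :=
        (ENNReal.ofReal_div_of_pos (by positivity)).symm
    _ ≤ ENNReal.ofReal 0.24 := by
        refine ENNReal.ofReal_le_ofReal ?_
        -- With R = 4.49, a bound for e^{3/2}, the value is 2 · 3.49 · 2.21 / (r ε²) with r ε² ≥
        -- 68.7, which is below 0.24.
        have h1 : 68.7 ≤ r * ε ^ 2 := by rwa [div_le_iff₀ (by positivity)] at hr0
        have h2 : 2 * ((R - 1) / r) / (ε ^ 2 / (221 / 100))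
            = (2 * (R - 1) * (221 / 100)) / (r * ε ^ 2) := by field_simp
        rw [h2, div_le_iff₀ (by positivity)]
        norm_num [hR] at h1 ⊢
        linarith

end EstimationFailure

/-! ### The parameters of the algorithm as functions of the size of the preliminary runs -/

section Parameters

variable (n : ℕ) (c : ℝ) (N : ℕ)

/-- The spacing when the preliminary runs have `N` points. -/
def spacingOf : ℕ := ⌈22 * Real.log (100 * (2 + Real.log (2 * n)) * (N / c + 1 / 2))⌉₊

/-- The rate when the preliminary runs have `N` points. -/
def rateOf : ℝ := 2 / 3 * spacingOf n c N * (2 + Real.log (2 * n))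

/-- The number of main runs when the preliminary runs have `N` points. -/
def runsOf : ℕ := ⌈rateOf n c N⌉₊

variable {n c}

theorem one_lt_argument (hn : 1 ≤ n) (hc : 0 < c) :
    1 < 100 * (2 + Real.log (2 * n)) * (N / c + 1 / 2) := by
  have hL := (logRange_bound hn rfl).1
  have hN : (0 : ℝ) ≤ N / c := by positivity
  have : (100 : ℝ) * 2.69 * (0 + 1 / 2) ≤ 100 * (2 + Real.log (2 * n)) * (N / c + 1 / 2) := by
    gcongr
  linarith

theorem one_le_spacingOf (hn : 1 ≤ n) (hc : 0 < c) : 1 ≤ spacingOf n c N :=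
  Nat.one_le_ceil_iff.2 (mul_pos (by norm_num) (Real.log_pos (one_lt_argument N hn hc)))

theorem rateOf_pos (hn : 1 ≤ n) (hc : 0 < c) : 0 < rateOf n c N := by
  have hL := (logRange_bound hn rfl).1
  have hd : (1 : ℝ) ≤ spacingOf n c N := by exact_mod_cast one_le_spacingOf N hn hc
  unfold rateOf
  positivity

theorem rateOf_div_mul_runsOf (hn : 1 ≤ n) (hc : 0 < c) :
    rateOf n c N / runsOf n c N * runsOf n c N = rateOf n c N := by
  have : (runsOf n c N : ℝ) ≠ 0 := by
    have := Nat.ceil_pos.2 (rateOf_pos N hn hc)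
    exact_mod_cast this.ne'
  exact div_mul_cancel₀ _ this

theorem rateOf_div_nonneg (hn : 1 ≤ n) (hc : 0 < c) : 0 ≤ rateOf n c N / runsOf n c N :=
  div_nonneg (rateOf_pos N hn hc).le (Nat.cast_nonneg _)

theorem rateOf_div_le_one : rateOf n c N / runsOf n c N ≤ 1 :=
  div_le_one_of_le₀ (Nat.le_ceil _) (Nat.cast_nonneg _)

theorem log_three_halves_le : Real.log (3 / 2) ≤ 9 / 22 := by
  rw [Real.log_le_iff_le_exp (by norm_num)]
  refine le_of_pow_le_pow_left₀ (n := 22) (by norm_num) (Real.exp_nonneg _) ?_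
  have h1 : Real.exp (9 / 22) ^ 22 = Real.exp 1 ^ 9 := by
    rw [← Real.exp_nat_mul, ← Real.exp_nat_mul]; norm_num
  rw [h1]
  calc (3 / 2 : ℝ) ^ 22 ≤ 2.7 ^ 9 := by norm_num
    _ ≤ Real.exp 1 ^ 9 := by
      gcongr
      linarith [Real.exp_one_gt_d9]

/-- A block has length 9/(4L) and the rate is (2/3)dL, so the exponent is -d/2. As ln(3/2) ≤ 9/22,
the product is at most e^{-d/11}, and d ≥ 22 ln y makes this at most y^{-2}. -/
theorem exp_mul_pow_spacingOf_le (hn : 1 ≤ n) (hc : 0 < c) :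
    Real.exp (-(rateOf n c N / 3) * (9 * (1 / (4 * (2 + Real.log (2 * n))))))
        * (3 / 2) ^ spacingOf n c N
      ≤ ((100 * (2 + Real.log (2 * n)) * (N / c + 1 / 2)) ^ 2)⁻¹ := by
  have hL := (logRange_bound hn rfl).1
  have hy := one_lt_argument N hn hc
  set L := 2 + Real.log (2 * n)
  set y := 100 * L * (N / c + 1 / 2)
  have hd : 22 * Real.log y ≤ spacingOf n c N := Nat.le_ceil _
  have hL0 : L ≠ 0 := by linarith
  have h1 : -(rateOf n c N / 3) * (9 * (1 / (4 * L))) = -(spacingOf n c N / 2 : ℝ) := by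
    rw [rateOf]
    change -(2 / 3 * (spacingOf n c N : ℝ) * L / 3) * _ = _
    field_simp
    ring
  have h2 : (3 / 2 : ℝ) ^ spacingOf n c N = Real.exp (spacingOf n c N * Real.log (3 / 2)) := by
    rw [Real.exp_nat_mul, Real.exp_log (by norm_num)]
  have h3 : (y ^ 2)⁻¹ = Real.exp (-(2 * Real.log y)) := by
    rw [Real.exp_neg, two_mul, Real.exp_add, Real.exp_log (by linarith), pow_two]
  rw [h1, h2, h3, ← Real.exp_add, Real.exp_le_exp]
  have h4 := mul_le_mul_of_nonneg_left log_three_halves_le (Nat.cast_nonneg (α := ℝ)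
    (spacingOf n c N))
  linarith

end Parameters

/-! ### The preliminary runs -/

section Pilot

variable {Ω S : Type*} {H : Ω → ℝ} {σ : HamiltonianSign} {β : ℝ} {draw : ℝ → S → Ω}

/-- The cells of the preliminary runs. -/
def pilotCells : Set Cell := {c | ∃ j t, c = .pilot j t}

/-- The cells of the estimation phase. -/
def estCells : Set Cell := {c | ∃ a i, c = .est a i}

theorem dependsOn_pilotSize : DependsOn (pilotSize H σ β draw) pilotCells := by
  intro x y hxy
  have h : ∀ j t, x (.pilot j t) = y (.pilot j t) := fun j t => hxy _ ⟨j, t, rfl⟩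
  simp only [pilotSize, h]

theorem dependsOn_sortedMerged (K : ℕ) (κ : ℝ) :
    DependsOn (sortedMerged H σ β draw K κ) {c | ∃ j t, c = .main j t ∨ c = .thin j t} := by
  intro x y hxy
  have h1 : ∀ j t, x (.main j t) = y (.main j t) := fun j t => hxy _ ⟨j, t, Or.inl rfl⟩
  have h2 : ∀ j t, x (.thin j t) = y (.thin j t) := fun j t => hxy _ ⟨j, t, Or.inr rfl⟩
  simp only [sortedMerged, mergedPoints, h1, h2]

variable [Fintype Ω] [MeasurableSpace S] {ν : Measure S} {n : ℕ}
  [Nonempty Ω] [IsProbabilityMeasure ν]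

theorem measure_splice (T : Set Cell) {A : Set (Randomness S)} (hA : MeasurableSet A) :
    randomnessLaw ν A
      = ∫⁻ x, randomnessLaw ν {y | splice T (x, y) ∈ A} ∂randomnessLaw ν := by
  have h := lintegral_splice T (cellLaw ν) (f := A.indicator 1) (measurable_one.indicator hA)
  rw [← randomnessLaw_eq, lintegral_indicator_one hA] at h
  rw [h]
  refine lintegral_congr fun x => ?_
  have hB : MeasurableSet {y | splice T (x, y) ∈ A} :=
    (measurable_splice T).comp (measurable_const.prodMk measurable_id) hA
  rw [← lintegral_indicator_one hB]
  rfl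

theorem IsGibbsOracle.measurable_length_tpaPoints (hdraw : IsGibbsOracle H β ν draw) (hβ : 0 < β)
    (a : ℕ → Cell) :
    Measurable fun ω : Randomness S => (tpaPoints H σ β draw fun t => ω (a t)).length := by
  simp only [length_tpaPoints hβ]
  exact (Measurable.of_discrete (f := fun D : ℕ∞ => D.toNat - 1)).comp
    (hdraw.measurable_tpaDraws hβ)

theorem IsGibbsOracle.measurable_pilotSize (hdraw : IsGibbsOracle H β ν draw) (hβ : 0 < β) :
    Measurable (pilotSize H σ β draw) :=
  Finset.measurable_sum _ fun j _ => hdraw.measurable_length_tpaPoints hβ (Cell.pilot j)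

theorem lintegral_pilotSize_le (hH : HasRange H n σ) (hβ : 0 < β)
    (hdraw : IsGibbsOracle H β ν draw) :
    ∫⁻ ω, (pilotSize H σ β draw ω : ℝ≥0∞) ∂randomnessLaw ν
      ≤ ENNReal.ofReal (5 * remaining H σ β (tpaStart β σ)) := by
  unfold pilotSize
  push_cast
  have hm : ∀ j, Measurable fun ω : Randomness S =>
      ((tpaPoints H σ β draw fun t => ω (.pilot j t)).length : ℝ≥0∞) := fun j =>
    (Measurable.of_discrete (f := fun m : ℕ => (m : ℝ≥0∞))).comp
      (hdraw.measurable_length_tpaPoints hβ (Cell.pilot j))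
  rw [lintegral_finsetSum _ fun j _ => hm j]
  calc _ ≤ ∑ _j ∈ Finset.range 5, ENNReal.ofReal (remaining H σ β (tpaStart β σ)) := by
        refine Finset.sum_le_sum fun j _ => ?_
        have h1 := lintegral_tpaDraws_le (a := Cell.pilot j) (a' := Cell.thin j) hH hβ hdraw
          (fun x y h => (Cell.pilot.inj h).2) (fun x y h => by cases h)
        have h2 : ∫⁻ ω, ((1 : ℝ≥0∞) + (tpaPoints H σ β draw fun t => ω (.pilot j t)).length)
            ∂randomnessLaw ν ≤ 1 + ENNReal.ofReal (remaining H σ β (tpaStart β σ)) := by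
          refine (le_of_eq (lintegral_congr_ae ?_)).trans h1
          filter_upwards [ae_tpaDraws_ne_top (a := Cell.pilot j) (a' := Cell.thin j) hH hβ hdraw
            (fun x y h => (Cell.pilot.inj h).2) (fun x y h => by cases h)] with ω hω
          rw [← length_tpaPoints_add_one hβ hω]
          push_cast
          rw [add_comm]
        rw [lintegral_add_left measurable_const, lintegral_const, measure_univ, mul_one] at h2
        exact (ENNReal.add_le_add_iff_left ENNReal.one_ne_top).1 h2
    _ = _ := by
        rw [Finset.sum_const, Finset.card_range, ENNReal.ofReal_mul (by norm_num), nsmul_eq_mul]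
        norm_num

/-- The generating function at s = 1/e with κ = 1, for the block (0, q] and five independent runs;
5(1 - 1/e) ≥ 3 because 1/e ≤ 2/5. -/
theorem lintegral_exp_neg_pilotSize_le (hH : HasRange H n σ) (hβ : 0 < β)
    (hdraw : IsGibbsOracle H β ν draw) :
    ∫⁻ ω, ENNReal.ofReal (Real.exp (-pilotSize H σ β draw ω)) ∂randomnessLaw ν
      ≤ ENNReal.ofReal (Real.exp (-(3 * remaining H σ β (tpaStart β σ)))) := by
  classical
  set q := remaining H σ β (tpaStart β σ)
  have hq : 0 ≤ q := remaining_nonneg hH (tpaStart_mem hβ σ)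
  have hs : Real.exp (-1) ≤ 1 := Real.exp_le_one_iff.2 (by norm_num)
  have hs' : Real.exp (-1) ≤ 2 / 5 := by
    rw [Real.exp_neg, inv_le_comm₀ (Real.exp_pos _) (by norm_num)]
    linarith [Real.exp_one_gt_d9]
  have h1 : ∀ ω : Randomness S, ENNReal.ofReal (Real.exp (-pilotSize H σ β draw ω))
      = ∏ j ∈ Finset.range 5, ENNReal.ofReal (Real.exp (-1)) ^
          (tpaPoints H σ β draw fun t => ω (.pilot j t)).length := fun ω => by
    rw [Finset.prod_pow_eq_pow_sum, ← ENNReal.ofReal_pow (Real.exp_nonneg _), ← Real.exp_nat_mul,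
      mul_neg_one]
    rfl
  simp only [h1]
  rw [randomnessLaw_eq, lintegral_prod_of_dependsOn (T := fun j => {c | ∃ t, c = Cell.pilot j t})
    (cellLaw ν) (Finset.range 5) (f := fun j (ω : Randomness S) => ENNReal.ofReal (Real.exp (-1)) ^
      (tpaPoints H σ β draw fun t => ω (.pilot j t)).length)]
  · calc _ ≤ ∏ _j ∈ Finset.range 5, ENNReal.ofReal (Real.exp (-(1 * (1 - Real.exp (-1))) * q)) := by
          refine Finset.prod_le_prod' fun j _ => ?_
          refine le_trans (lintegral_mono fun ω => ?_) (lintegral_pow_countP_keptPoints_le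
            (a := Cell.pilot j) (a' := Cell.thin j) (s := Real.exp (-1)) (κ := 1) (α := 0) (l := q)
            hH hβ hdraw (fun x y h => (Cell.pilot.inj h).2) (fun x y h => by cases h)
            (fun x y h => (Cell.thin.inj h).2) zero_le_one le_rfl (Real.exp_nonneg _) hs le_rfl hq
            (zero_add q).le)
          refine pow_le_pow_right_of_le_one' (ENNReal.ofReal_le_one.2 hs)
            (List.countP_le_length.trans ?_)
          rw [keptPoints, List.length_map]
          exact List.length_filter_le _ _
      _ ≤ _ := by
          rw [Finset.prod_const, Finset.card_range, ← ENNReal.ofReal_pow (Real.exp_nonneg _),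
            ← Real.exp_nat_mul]
          refine ENNReal.ofReal_le_ofReal (Real.exp_le_exp.2 ?_)
          push_cast
          nlinarith
  · intro i j hij
    refine Set.disjoint_left.2 ?_
    rintro c ⟨t, rfl⟩ ⟨u, h⟩
    exact hij (Cell.pilot.inj h).1
  · intro j
    exact (Measurable.of_discrete (f := fun m : ℕ => ENNReal.ofReal (Real.exp (-1)) ^ m)).comp
      (hdraw.measurable_length_tpaPoints hβ (Cell.pilot j))
  · intro j x y hxy
    have h : ∀ t, x (.pilot j t) = y (.pilot j t) := fun t => hxy _ ⟨t, rfl⟩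
    simp only [h]

/-- The number of points of the preliminary runs is rarely so small that the failure bound for the
schedule is large. -/
theorem lintegral_schedule_failure_le (hH : HasRange H n σ) (hn : 1 ≤ n) (hβ : 0 < β)
    (hdraw : IsGibbsOracle H β ν draw) {c : ℝ} (hc : 0 < c) (hc' : c ≤ 5) :
    ∫⁻ ω, ENNReal.ofReal ((remaining H σ β (tpaStart β σ) / (1 / (4 * (2 + Real.log (2 * n)))) + 1)
        * ((100 * (2 + Real.log (2 * n)) * (pilotSize H σ β draw ω / c + 1 / 2)) ^ 2)⁻¹)
        ∂randomnessLaw ν ≤ ENNReal.ofReal 0.01 := by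
  have hL := (logRange_bound hn rfl).1
  set L := 2 + Real.log (2 * n)
  set q := remaining H σ β (tpaStart β σ)
  have hq : 0 ≤ q := remaining_nonneg hH (tpaStart_mem hβ σ)
  set C : ℝ := (4 * L * q + 1) / (10 ^ 4 * L ^ 2) with hC
  have hC0 : 0 ≤ C := by positivity
  -- It suffices to treat c = 5. If N ≥ q, then (q/5 + 1/2)² ≥ (1 + 0.8q)/4. If N ≤ q, the inverse
  -- square is at most 4, which is at most 4e^{q-N}; the exponential moment of N controls this case.
  have hpt : ∀ N : ℕ, (q / (1 / (4 * L)) + 1) * ((100 * L * (N / c + 1 / 2)) ^ 2)⁻¹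
      ≤ C * (4 / (1 + 0.8 * q)) + C * (4 * Real.exp q) * Real.exp (-N) := by
    intro N
    have h1 : (q / (1 / (4 * L)) + 1) * ((100 * L * (N / c + 1 / 2)) ^ 2)⁻¹
        = C * ((N / c + 1 / 2) ^ 2)⁻¹ := by
      rw [hC]; field_simp; ring
    have h2 : (((N : ℝ) / c + 1 / 2) ^ 2)⁻¹ ≤ (((N : ℝ) / 5 + 1 / 2) ^ 2)⁻¹ := by gcongr
    have h3 : (((N : ℝ) / 5 + 1 / 2) ^ 2)⁻¹ ≤ 4 / (1 + 0.8 * q) + 4 * Real.exp q * Real.exp (-N) := by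
      rcases le_total q N with h | h
      · have : (((N : ℝ) / 5 + 1 / 2) ^ 2)⁻¹ ≤ 4 / (1 + 0.8 * q) := by
          rw [inv_le_comm₀ (by positivity) (by positivity), inv_div]
          nlinarith
        have h5 : 0 ≤ 4 * Real.exp q * Real.exp (-N) := by positivity
        linarith
      · have h4 : (((N : ℝ) / 5 + 1 / 2) ^ 2)⁻¹ ≤ 4 := by
          rw [inv_le_comm₀ (by positivity) (by norm_num)]
          have : (0 : ℝ) ≤ N := Nat.cast_nonneg N
          nlinarith
        have h5 : 4 * 1 ≤ 4 * (Real.exp q * Real.exp (-N)) := by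
          rw [← Real.exp_add]
          gcongr
          exact Real.one_le_exp (by linarith)
        have h6 : 0 ≤ 4 / (1 + 0.8 * q) := by positivity
        linarith
    rw [h1, mul_assoc C, ← mul_add]
    exact mul_le_mul_of_nonneg_left (h2.trans h3) hC0
  calc _ ≤ ∫⁻ ω, (ENNReal.ofReal (C * (4 / (1 + 0.8 * q))) + ENNReal.ofReal (C * (4 * Real.exp q))
          * ENNReal.ofReal (Real.exp (-pilotSize H σ β draw ω))) ∂randomnessLaw ν := by
        refine lintegral_mono fun ω => ?_
        rw [← ENNReal.ofReal_mul (by positivity), ← ENNReal.ofReal_add (by positivity)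
          (by positivity)]
        exact ENNReal.ofReal_le_ofReal (hpt _)
    _ ≤ ENNReal.ofReal (C * (4 / (1 + 0.8 * q))) + ENNReal.ofReal (C * (4 * Real.exp q))
          * ENNReal.ofReal (Real.exp (-(3 * q))) := by
        have hm : Measurable fun ω : Randomness S =>
            ENNReal.ofReal (Real.exp (-pilotSize H σ β draw ω)) :=
          (Measurable.of_discrete (f := fun m : ℕ => ENNReal.ofReal (Real.exp (-m)))).comp
            (hdraw.measurable_pilotSize hβ)
        rw [lintegral_add_left measurable_const, lintegral_const, measure_univ, mul_one,
          lintegral_const_mul _ hm]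
        gcongr
        exact lintegral_exp_neg_pilotSize_le hH hβ hdraw
    _ ≤ _ := by
        rw [← ENNReal.ofReal_mul (by positivity), ← ENNReal.ofReal_add (by positivity)
          (by positivity)]
        refine ENNReal.ofReal_le_ofReal ?_
        -- So the improbable case N ≤ q costs no more than the typical one: e^{-2q} ≤ 1/(1 + 2q) ≤
        -- 1/(1 + 0.8q).
        have h1 : Real.exp q * Real.exp (-(3 * q)) ≤ 1 / (1 + 0.8 * q) := by
          rw [← Real.exp_add, show q + -(3 * q) = -(2 * q) by ring, Real.exp_neg, ← one_div]
          gcongr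
          linarith [Real.add_one_le_exp (2 * q)]
        have h2 : C * (4 / (1 + 0.8 * q)) + C * (4 * Real.exp q) * Real.exp (-(3 * q))
            ≤ C * (8 / (1 + 0.8 * q)) := by
          calc _ = C * (4 * (1 / (1 + 0.8 * q)) + 4 * (Real.exp q * Real.exp (-(3 * q)))) := by ring
            _ ≤ C * (4 * (1 / (1 + 0.8 * q)) + 4 * (1 / (1 + 0.8 * q))) := by gcongr
            _ = _ := by ring
        refine h2.trans ?_
        rw [hC, div_mul_div_comm, div_le_iff₀ (by positivity)]
        nlinarith [mul_nonneg hq (by linarith : 0 ≤ L), mul_nonneg hq (mul_nonneg (by linarith : 0 ≤ L) (by linarith : 0 ≤ L - 2)), mul_nonneg (by linarith : 0 ≤ L) (by linarith : 0 ≤ L - 2)]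

end Pilot

/-! ### The accuracy of the output -/

section Accuracy

variable {Ω S : Type*} {H : Ω → ℝ} {σ : HamiltonianSign} {n : ℕ} {β c : ℝ} {draw : ℝ → S → Ω}

variable (H σ n β c draw) in
/-- The sorted points if the preliminary runs have `N` points. -/
def sortedOf (N : ℕ) (ω : Randomness S) : List ℝ :=
  sortedMerged H σ β draw (runsOf n c N) (rateOf n c N / runsOf n c N) ω

theorem param_eq (ω : Randomness S) (i : ℕ) :
    param H σ n β c draw ω i = scheduleEntry β (spacingOf n c (pilotSize H σ β draw ω))
      (sortedOf H σ n β c draw (pilotSize H σ β draw ω) ω) i := rfl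

theorem numIntervals_eq (ω : Randomness S) :
    numIntervals H σ n β c draw ω = (sortedOf H σ n β c draw (pilotSize H σ β draw ω) ω).length
      / spacingOf n c (pilotSize H σ β draw ω) + 1 := by
  simp only [numIntervals, schedule, List.length_cons, List.length_append, length_everyNth,
    List.length_nil, Nat.add_sub_cancel]
  rfl

theorem output_eq (ε : ℝ) (ω : Randomness S) :
    output H σ n β ε c draw ω = estOutput H draw (numIntervals H σ n β c draw ω) (numReps ε)
      (param H σ n β c draw ω) ω := by
  have hW : ∀ a, prodW H σ n β c draw ω a = prodEst H draw (numIntervals H σ n β c draw ω) 0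
      (midpoints (param H σ n β c draw ω)) (param H σ n β c draw ω) a ω := fun a =>
    Finset.prod_congr rfl fun i _ => by
      rw [estSample, halfLength, midpoints, add_zero]
      congr 2
      ring
  have hV : ∀ a, prodV H σ n β c draw ω a = prodEst H draw (numIntervals H σ n β c draw ω) 1
      (midpoints (param H σ n β c draw ω)) (fun i => param H σ n β c draw ω (i + 1)) a ω :=
    fun a => Finset.prod_congr rfl fun i _ => by
      rw [estSample, halfLength, midpoints]
      congr 2
      ring
  simp only [output, meanW, meanV, estOutput, hW, hV]

theorem dependsOn_pilotSize' : DependsOn (pilotSize H σ β draw) estCellsᶜ :=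
  fun _ _ hxy => dependsOn_pilotSize fun c ⟨j, t, h⟩ => hxy c fun ⟨a, i, h'⟩ => by
    cases h.symm.trans h'

theorem dependsOn_sortedOf (N : ℕ) : DependsOn (sortedOf H σ n β c draw N) estCellsᶜ :=
  fun _ _ hxy => dependsOn_sortedMerged _ _ fun c ⟨j, t, h⟩ => hxy c fun ⟨a, i, h'⟩ => by
    rcases h with h | h <;> cases h.symm.trans h'

theorem dependsOn_sortedOf' (N : ℕ) : DependsOn (sortedOf H σ n β c draw N) pilotCellsᶜ :=
  fun _ _ hxy => dependsOn_sortedMerged _ _ fun c ⟨j, t, h⟩ => hxy c fun ⟨a, i, h'⟩ => by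
    rcases h with h | h <;> cases h.symm.trans h'

theorem dependsOn_estOutput (l r : ℕ) (t : ℕ → ℝ) :
    DependsOn (estOutput H draw l r t) estCellsᶜᶜ := by
  intro x y hxy
  have h : ∀ s u v a, prodEst H draw l s u v a x = prodEst H draw l s u v a y := fun s u v a =>
    dependsOn_prodEst l s u v a fun c ⟨i, hi⟩ => hxy c (by rw [compl_compl]; exact ⟨a, i, hi⟩)
  simp only [estOutput, h]

/-- The schedule does not read the estimation cells. With all other cells frozen at x, the output is
therefore the estimate for a fixed schedule. -/
theorem output_splice (ε : ℝ) (x y : Randomness S) :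
    output H σ n β ε c draw (splice estCellsᶜ (x, y))
      = estOutput H draw (numIntervals H σ n β c draw x) (numReps ε) (param H σ n β c draw x) y := by
  have h1 : pilotSize H σ β draw (splice estCellsᶜ (x, y)) = pilotSize H σ β draw x :=
    DependsOn.splice_left dependsOn_pilotSize'
  have h2 : ∀ N, sortedOf H σ n β c draw N (splice estCellsᶜ (x, y)) = sortedOf H σ n β c draw N x :=
    fun N => DependsOn.splice_left (dependsOn_sortedOf N)
  have h3 : param H σ n β c draw (splice estCellsᶜ (x, y)) = param H σ n β c draw x :=
    funext fun i => by rw [param_eq, param_eq, h1, h2]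
  rw [output_eq, numIntervals_eq, h3, h1, h2, ← numIntervals_eq,
    DependsOn.splice_right (dependsOn_estOutput _ _ _)]

variable [Fintype Ω] [MeasurableSpace S] {ν : Measure S} [Nonempty Ω] [IsProbabilityMeasure ν]

theorem IsGibbsOracle.measurable_numIntervals (hdraw : IsGibbsOracle H β ν draw) (hβ : 0 < β) :
    Measurable (numIntervals H σ n β c draw) := by
  rw [show numIntervals H σ n β c draw = _ from funext numIntervals_eq]
  exact measurable_comp_nat (hdraw.measurable_pilotSize hβ)
    (f := fun N ω => (sortedOf H σ n β c draw N ω).length / spacingOf n c N + 1) fun N =>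
    (Measurable.of_discrete (f := fun m : ℕ => m / spacingOf n c N + 1)).comp
      (hdraw.measurable_length_sortedMerged hβ _ _)

theorem IsGibbsOracle.measurable_param (hdraw : IsGibbsOracle H β ν draw) (hβ : 0 < β)
    (hn : 1 ≤ n) (hc : 0 < c) (i : ℕ) :
    Measurable fun ω : Randomness S => param H σ n β c draw ω i := by
  simp only [param_eq]
  exact measurable_comp_nat (hdraw.measurable_pilotSize hβ)
    (f := fun N ω => scheduleEntry β (spacingOf n c N) (sortedOf H σ n β c draw N ω) i) fun N =>
      hdraw.measurable_scheduleEntry hβ _ _ (one_le_spacingOf N hn hc) i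

theorem IsGibbsOracle.measurable_output (hdraw : IsGibbsOracle H β ν draw) (hβ : 0 < β)
    (hn : 1 ≤ n) (hc : 0 < c) (ε : ℝ) : Measurable (output H σ n β ε c draw) := by
  have hp := hdraw.measurable_param (σ := σ) hβ hn hc
  have hδ : ∀ i, Measurable fun ω : Randomness S => halfLength H σ n β c draw ω i := fun i =>
    ((hp (i + 1)).sub (hp i)).div_const 2
  have hs : ∀ a i, Measurable fun ω : Randomness S => H (estSample H σ n β c draw ω a i) :=
    fun a i => (hdraw.measurable_comp H).comp
      ((hp i).prodMk (by fun_prop : Measurable fun ω : Randomness S => (ω (.est a i)).1))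
  refine ((Finset.measurable_sum _ fun a _ => ?_).div_const _).div
    ((Finset.measurable_sum _ fun a _ => ?_).div_const _)
  · exact measurable_comp_nat (hdraw.measurable_numIntervals hβ)
      (f := fun l ω => ∏ i ∈ Finset.range l, Real.exp (-halfLength H σ n β c draw ω i *
        H (estSample H σ n β c draw ω a i))) fun l => Finset.measurable_prod _ fun i _ =>
      Real.measurable_exp.comp ((hδ i).neg.mul (hs a i))
  · exact measurable_comp_nat (hdraw.measurable_numIntervals hβ)
      (f := fun l ω => ∏ i ∈ Finset.range l, Real.exp (halfLength H σ n β c draw ω i *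
        H (estSample H σ n β c draw ω a (i + 1)))) fun l => Finset.measurable_prod _ fun i _ =>
      Real.measurable_exp.comp ((hδ i).mul (hs a (i + 1)))

variable (H σ n β c draw) in
/-- Outcomes for which the algorithm uses a schedule with short gaps. -/
def goodSchedule : Set (Randomness S) :=
  {ω | ω ∈ shortGaps H σ β draw ((9 + 1) * (1 / (4 * (2 + Real.log (2 * n)))))
    (spacingOf n c (pilotSize H σ β draw ω)) (runsOf n c (pilotSize H σ β draw ω))
    (rateOf n c (pilotSize H σ β draw ω) / runsOf n c (pilotSize H σ β draw ω))}

theorem IsGibbsOracle.measurableSet_goodSchedule (hdraw : IsGibbsOracle H β ν draw) (hβ : 0 < β)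
    (hn : 1 ≤ n) (hc : 0 < c) : MeasurableSet (goodSchedule H σ n β c draw) :=
  measurableSet_setOfPred.2 (measurable_comp_nat (hdraw.measurable_pilotSize hβ)
    (f := fun N ω => ω ∈ shortGaps H σ β draw ((9 + 1) * (1 / (4 * (2 + Real.log (2 * n)))))
      (spacingOf n c N) (runsOf n c N) (rateOf n c N / runsOf n c N)) fun N =>
    measurableSet_setOfPred.1 (hdraw.measurableSet_shortGaps hβ _ (one_le_spacingOf N hn hc) _ _))

theorem measure_compl_goodSchedule_le (hH : HasRange H n σ) (hn : 1 ≤ n) (hβ : 0 < β)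
    (hdraw : IsGibbsOracle H β ν draw) (hc : 0 < c) (hc' : c ≤ 5) :
    randomnessLaw ν (goodSchedule H σ n β c draw)ᶜ ≤ ENNReal.ofReal 0.01 := by
  have hL := (logRange_bound hn rfl).1
  rw [measure_splice pilotCells (hdraw.measurableSet_goodSchedule hβ hn hc).compl]
  refine le_trans (lintegral_mono fun x => ?_)
    (lintegral_schedule_failure_le hH hn hβ hdraw hc hc')
  set N := pilotSize H σ β draw x
  have h1 : {y | splice pilotCells (x, y) ∈ (goodSchedule H σ n β c draw)ᶜ}
      = (shortGaps H σ β draw ((9 + 1) * (1 / (4 * (2 + Real.log (2 * n)))))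
        (spacingOf n c N) (runsOf n c N) (rateOf n c N / runsOf n c N))ᶜ := by
    ext y
    have hN : pilotSize H σ β draw (splice pilotCells (x, y)) = N :=
      DependsOn.splice_left dependsOn_pilotSize
    have hsort : sortedMerged H σ β draw (runsOf n c N) (rateOf n c N / runsOf n c N)
        (splice pilotCells (x, y))
        = sortedMerged H σ β draw (runsOf n c N) (rateOf n c N / runsOf n c N) y :=
      DependsOn.splice_right (dependsOn_sortedOf' N)
    simp only [goodSchedule, shortGaps, Set.mem_compl_iff, Set.mem_ofPred_eq, hN, hsort]
  rw [h1]
  -- The grid has h = 1/(4L) and m = 9, so the admitted gap 10h equals 5/(2L), the length that the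
  -- curvature bound allows.
  refine (measure_compl_shortGaps_le hH hβ hdraw (one_le_spacingOf N hn hc) _
    (rateOf_div_nonneg N hn hc) (rateOf_div_le_one N) (by positivity) (by norm_num)).trans
    (ENNReal.ofReal_le_ofReal ?_)
  have hq : 0 ≤ remaining H σ β (tpaStart β σ) := remaining_nonneg hH (tpaStart_mem hβ σ)
  rw [rateOf_div_mul_runsOf N hn hc]
  exact mul_le_mul_of_nonneg_left (exp_mul_pow_spacingOf_le N hn hc) (by positivity)

theorem measure_failure_output_le (hH : HasRange H n σ) (hn : 1 ≤ n) (hβ : 0 < β)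
    (hdraw : IsGibbsOracle H β ν draw) (hc : 0 < c) (hc' : c ≤ 5) {ε : ℝ} (hε : 0 < ε)
    (hε' : ε ≤ 1 / 10) :
    randomnessLaw ν {ω | failure H β ε (output H σ n β ε c draw ω)} ≤ ENNReal.ofReal (1 / 4) := by
  have hL := (logRange_bound hn rfl).1
  have hm : MeasurableSet {ω | failure H β ε (output H σ n β ε c draw ω)} := by
    have hout := (hdraw.measurable_output (σ := σ) hβ hn hc ε).div_const
      (partitionFunction H β / partitionFunction H 0)
    exact ((measurableSet_le measurable_const hout).inter
      (measurableSet_le hout measurable_const)).compl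
  rw [measure_splice estCellsᶜ hm]
  have hgood := hdraw.measurableSet_goodSchedule (σ := σ) hβ hn hc
  -- Given the cells outside the estimation phase, failure has probability at most 0.24 for a good
  -- schedule and at most 1 for a bad one.
  calc _ ≤ ∫⁻ x, (ENNReal.ofReal 0.24 + (goodSchedule H σ n β c draw)ᶜ.indicator 1 x)
          ∂randomnessLaw ν := by
        refine lintegral_mono_ae ?_
        filter_upwards [ae_randomness_mem] with x hx
        by_cases hxg : x ∈ goodSchedule H σ n β c draw
        · refine le_trans ?_ le_self_add
          simp only [output_splice]
          set N := pilotSize H σ β draw x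
          have hd := one_le_spacingOf N hn hc
          have hmem : ∀ y ∈ sortedOf H σ n β c draw N x, y ∈ Set.Icc 0 β :=
            mem_sortedMerged hH hβ hx
          refine measure_failure_estOutput_le hdraw hε hε'
            (fun i => scheduleEntry_mem hβ.le hd hmem i) rfl ?_
            (sum_log_partitionFunction_curvature_le hH hn (β := β) (σ := σ) (fun i hi => ?_)
              fun i hi => ?_)
          · rw [numIntervals_eq]
            exact scheduleEntry_last
          · rw [numIntervals_eq] at hi
            exact scheduleEntry_le_succ hd (pairwise_sortedMerged _ _ _) hmem hβ.le hi
          · rw [numIntervals_eq] at hi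
            refine (hxg i hi).trans (le_of_eq ?_)
            field_simp
            norm_num
        · refine le_trans prob_le_one (le_trans ?_ le_add_self)
          rw [Set.indicator_of_mem (Set.mem_compl hxg)]
          exact le_rfl
    _ ≤ ENNReal.ofReal 0.24 + ENNReal.ofReal 0.01 := by
        rw [lintegral_add_left measurable_const, lintegral_const, measure_univ, mul_one,
          lintegral_indicator_one hgood.compl]
        gcongr
        exact measure_compl_goodSchedule_le hH hn hβ hdraw hc hc'
    _ = _ := by
        rw [← ENNReal.ofReal_add (by norm_num) (by norm_num)]
        norm_num

theorem isApproximation_output (hH : HasRange H n σ) (hn : 1 ≤ n) (hβ : 0 < β)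
    (hdraw : IsGibbsOracle H β ν draw) (hc : 0 < c) (hc' : c ≤ 5) {ε : ℝ} (hε : 0 < ε)
    (hε' : ε ≤ 1 / 10) :
    IsApproximation (randomnessLaw ν) (output H σ n β ε c draw)
      (partitionFunction H β / partitionFunction H 0) ε := by
  have h := measure_failure_output_le (σ := σ) hH hn hβ hdraw hc hc' hε hε'
  have hout := (hdraw.measurable_output (σ := σ) hβ hn hc ε).div_const
    (partitionFunction H β / partitionFunction H 0)
  set A := {ω | 1 / (1 + ε) ≤ output H σ n β ε c draw ω /
      (partitionFunction H β / partitionFunction H 0) ∧ output H σ n β ε c draw ω /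
      (partitionFunction H β / partitionFunction H 0) ≤ 1 + ε}
  have hA : MeasurableSet A := (measurableSet_le measurable_const hout).inter
      (measurableSet_le hout measurable_const)
  change randomnessLaw ν Aᶜ ≤ _ at h
  change 3 / 4 ≤ randomnessLaw ν A
  have h1 : (3 / 4 : ℝ≥0∞) = 1 - ENNReal.ofReal (1 / 4) := by
    rw [← ENNReal.ofReal_one, ← ENNReal.ofReal_sub _ (by norm_num)]
    norm_num [ENNReal.ofReal_div_of_pos]
  rw [h1, ← compl_compl A, prob_compl_eq_one_sub hA.compl]
  exact tsub_le_tsub_left h 1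

theorem IsApproximation.const_mul {R : Type*} [MeasurableSpace R] {P : Measure R} {X : R → ℝ}
    {x y ε : ℝ} (h : IsApproximation P X (x / y) ε) :
    IsApproximation P (fun ω => y * X ω) x ε := by
  have : ∀ ω, y * X ω / x = X ω / (x / y) := fun ω => by rw [div_div_eq_mul_div, mul_comm]
  simpa only [IsApproximation, this] using h

end Accuracy

/-! ### The expected number of oracle draws -/

section Cost

variable {Ω S : Type*} {H : Ω → ℝ} {σ : HamiltonianSign} {n : ℕ} {β : ℝ} {draw : ℝ → S → Ω}

theorem toENNReal_finsetSum {ι : Type*} (s : Finset ι) (f : ι → ℕ∞) :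
    ((∑ i ∈ s, f i : ℕ∞) : ℝ≥0∞) = ∑ i ∈ s, (f i : ℝ≥0∞) :=
  map_sum ENat.toENNRealRingHom f s

/-- The logarithm lies below its tangent at N/5 = q, which makes the bound affine in N and ready for
E N ≤ 5q. The constant part of the tangent term stands on the left so that no negative number has to
pass to `ℝ≥0∞`. -/
theorem runsOf_le (hn : 1 ≤ n) {q : ℝ} (hq : 0 ≤ q) (N : ℕ) :
    (runsOf n 5 N : ℝ) + 44 / 3 * (2 + Real.log (2 * n)) / (q + 1 / 2) * q
      ≤ (2 / 3 * (22 * Real.log (100 * (2 + Real.log (2 * n)) * (q + 1 / 2)) + 1)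
          * (2 + Real.log (2 * n)) + 1)
        + 44 / 3 * (2 + Real.log (2 * n)) / (q + 1 / 2) / 5 * N := by
  have hL := (logRange_bound hn rfl).1
  have hx := one_lt_argument N hn (show (0 : ℝ) < 5 by norm_num)
  have h1 : (runsOf n 5 N : ℝ) ≤ rateOf n 5 N + 1 :=
    (Nat.ceil_lt_add_one (rateOf_pos N hn (by norm_num)).le).le
  have h2 : (spacingOf n 5 N : ℝ)
      ≤ 22 * Real.log (100 * (2 + Real.log (2 * n)) * (N / 5 + 1 / 2)) + 1 :=
    (Nat.ceil_lt_add_one (mul_nonneg (by norm_num) (Real.log_nonneg hx.le))).le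
  rw [rateOf] at h1
  set L := 2 + Real.log (2 * n)
  have h3 : Real.log (100 * L * (N / 5 + 1 / 2))
      ≤ Real.log (100 * L * (q + 1 / 2)) + (N / 5 - q) / (q + 1 / 2) := by
    have h4 := Real.log_le_sub_one_of_pos (x := (N / 5 + 1 / 2) / (q + 1 / 2)) (by positivity)
    rw [Real.log_div (by positivity) (by positivity)] at h4
    rw [Real.log_mul (x := 100 * L) (by positivity) (by positivity),
      Real.log_mul (x := 100 * L) (by positivity) (by positivity)]
    have h5 : ((N : ℝ) / 5 + 1 / 2) / (q + 1 / 2) - 1 = (N / 5 - q) / (q + 1 / 2) := by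
      field_simp
      ring
    linarith
  calc (runsOf n 5 N : ℝ) + 44 / 3 * L / (q + 1 / 2) * q
      ≤ 2 / 3 * (22 * (Real.log (100 * L * (q + 1 / 2)) + (N / 5 - q) / (q + 1 / 2)) + 1) * L + 1
        + 44 / 3 * L / (q + 1 / 2) * q := by
        refine add_le_add_left (h1.trans (add_le_add_left ?_ 1)) _
        gcongr
        linarith
    _ = _ := by
        field_simp
        ring

theorem four_le_logRange (hn : 4 ≤ n) : 4 ≤ 2 + Real.log (2 * n) := by
  have h1 : (4 : ℝ) ≤ n := by exact_mod_cast hn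
  have h2 : Real.log (2 ^ 3) ≤ Real.log (2 * n) :=
    Real.log_le_log (by norm_num) (by linarith)
  rw [Real.log_pow] at h2
  push_cast at h2
  linarith [Real.log_two_gt_d9]

/-- The margin 14.9 - 44/3 absorbs (2/3)L + 1, because L ≥ 4 makes the logarithm at least 5: 100 · 4
· (1/2) = 200 exceeds e^5. -/
theorem runsOf_mean_le (hn : 4 ≤ n) {q : ℝ} (hq : 0 ≤ q) :
    2 / 3 * (22 * Real.log (100 * (2 + Real.log (2 * n)) * (q + 1 / 2)) + 1)
        * (2 + Real.log (2 * n)) + 1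
      ≤ (2 + Real.log (2 * n)) * (14.9 * Real.log (100 * (2 + Real.log (2 * n)) * (q + 1))) := by
  have hL := four_le_logRange hn
  set L := 2 + Real.log (2 * n)
  have h1 : Real.log (100 * L * (q + 1 / 2)) ≤ Real.log (100 * L * (q + 1)) :=
    Real.log_le_log (by positivity) (by gcongr; norm_num)
  have h2 : 5 ≤ Real.log (100 * L * (q + 1 / 2)) := by
    rw [Real.le_log_iff_exp_le (by positivity)]
    have h3 : Real.exp 5 = Real.exp 1 ^ 5 := by rw [← Real.exp_nat_mul]; norm_num
    have h4 : Real.exp 1 ^ 5 ≤ 2.8 ^ 5 := by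
      gcongr
      linarith [Real.exp_one_lt_d9]
    have h5 : (100 : ℝ) * 4 * (0 + 1 / 2) ≤ 100 * L * (q + 1 / 2) := by gcongr
    norm_num at h4 h5 ⊢
    linarith
  set y := Real.log (100 * L * (q + 1 / 2))
  have h6 : L * (14.9 * y) ≤ L * (14.9 * Real.log (100 * L * (q + 1))) := by gcongr
  refine le_trans ?_ h6
  nlinarith

variable [Fintype Ω] [MeasurableSpace S] {ν : Measure S} [Nonempty Ω] [IsProbabilityMeasure ν]

theorem lintegral_numRuns_le (hH : HasRange H n σ) (hn : 4 ≤ n) (hβ : 0 < β)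
    (hdraw : IsGibbsOracle H β ν draw) {q : ℝ} (hq : q = remaining H σ β (tpaStart β σ)) :
    ∫⁻ ω, (runsOf n 5 (pilotSize H σ β draw ω) : ℝ≥0∞) ∂randomnessLaw ν
      ≤ ENNReal.ofReal ((2 + Real.log (2 * n))
        * (14.9 * Real.log (100 * (2 + Real.log (2 * n)) * (q + 1)))) := by
  have hq0 : 0 ≤ q := hq ▸ remaining_nonneg hH (tpaStart_mem hβ σ)
  have hL := four_le_logRange hn
  have hA := runsOf_mean_le hn hq0
  have hr := runsOf_le (by omega : 1 ≤ n) hq0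
  have hlog : 0 ≤ Real.log (100 * (2 + Real.log (2 * n)) * (q + 1 / 2)) :=
    Real.log_nonneg (by nlinarith)
  set L := 2 + Real.log (2 * n)
  set A := 2 / 3 * (22 * Real.log (100 * L * (q + 1 / 2)) + 1) * L + 1
  have hA0 : 0 ≤ A := by positivity
  set B := 44 / 3 * L / (q + 1 / 2)
  have hB0 : 0 ≤ B := by positivity
  have hm := hdraw.measurable_pilotSize hβ (σ := σ)
  have hm1 : Measurable fun ω => (pilotSize H σ β draw ω : ℝ≥0∞) :=
    (Measurable.of_discrete (f := fun m : ℕ => (m : ℝ≥0∞))).comp hm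
  refine le_trans ?_ (ENNReal.ofReal_le_ofReal hA)
  refine (ENNReal.add_le_add_iff_right (a := ENNReal.ofReal (B * q)) ENNReal.ofReal_ne_top).1 ?_
  calc _ = ∫⁻ ω, ((runsOf n 5 (pilotSize H σ β draw ω) : ℝ≥0∞) + ENNReal.ofReal (B * q))
          ∂randomnessLaw ν := by
        rw [lintegral_add_right _ measurable_const, lintegral_const, measure_univ, mul_one]
    _ ≤ ∫⁻ ω, (ENNReal.ofReal A + ENNReal.ofReal (B / 5) * pilotSize H σ β draw ω)
          ∂randomnessLaw ν := by
        refine lintegral_mono fun ω => ?_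
        rw [← ENNReal.ofReal_natCast, ← ENNReal.ofReal_natCast,
          ← ENNReal.ofReal_add (Nat.cast_nonneg _) (by positivity),
          ← ENNReal.ofReal_mul (by positivity), ← ENNReal.ofReal_add hA0 (by positivity)]
        exact ENNReal.ofReal_le_ofReal (hr _)
    _ ≤ ENNReal.ofReal A + ENNReal.ofReal (B / 5) * ENNReal.ofReal (5 * q) := by
        rw [lintegral_add_left measurable_const, lintegral_const, measure_univ, mul_one,
          lintegral_const_mul _ hm1]
        gcongr
        exact hq ▸ lintegral_pilotSize_le hH hβ hdraw
    _ = _ := by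
        rw [← ENNReal.ofReal_mul (by positivity)]
        congr 2
        ring

/-- Wald's identity as an inequality: the number of main runs is fixed by the preliminary cells, of
which the main runs are independent. -/
theorem lintegral_mainDraws_le (hH : HasRange H n σ) (hβ : 0 < β)
    (hdraw : IsGibbsOracle H β ν draw) :
    ∫⁻ ω, ∑ j ∈ Finset.range (runsOf n 5 (pilotSize H σ β draw ω)),
        (tpaDraws H σ β draw (fun t => ω (.main j t)) : ℝ≥0∞) ∂randomnessLaw ν
      ≤ (∫⁻ ω, (runsOf n 5 (pilotSize H σ β draw ω) : ℝ≥0∞) ∂randomnessLaw ν)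
        * (1 + ENNReal.ofReal (remaining H σ β (tpaStart β σ))) := by
  have hm : ∀ j, Measurable fun ω : Randomness S =>
      (tpaDraws H σ β draw (fun t => ω (.main j t)) : ℝ≥0∞) := fun j =>
    Measurable.of_discrete.comp (hdraw.measurable_tpaDraws hβ (a := Cell.main j))
  have hmN : Measurable fun ω => (runsOf n 5 (pilotSize H σ β draw ω) : ℝ≥0∞) :=
    (Measurable.of_discrete (f := fun m : ℕ => (runsOf n 5 m : ℝ≥0∞))).comp
      (hdraw.measurable_pilotSize hβ)
  have hF : Measurable fun ω : Randomness S =>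
      ∑ j ∈ Finset.range (runsOf n 5 (pilotSize H σ β draw ω)),
        (tpaDraws H σ β draw (fun t => ω (.main j t)) : ℝ≥0∞) :=
    measurable_comp_nat (hdraw.measurable_pilotSize hβ) (f := fun N ω =>
      ∑ j ∈ Finset.range (runsOf n 5 N),
        (tpaDraws H σ β draw (fun t => ω (.main j t)) : ℝ≥0∞)) fun N =>
      Finset.measurable_sum _ fun j _ => hm j
  rw [← lintegral_mul_const _ hmN]
  conv_lhs => rw [randomnessLaw_eq, lintegral_splice pilotCells (cellLaw ν) hF, ← randomnessLaw_eq]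
  refine lintegral_mono fun x => ?_
  have h1 : ∀ y, pilotSize H σ β draw (splice pilotCells (x, y)) = pilotSize H σ β draw x :=
    fun y => DependsOn.splice_left dependsOn_pilotSize
  have h2 : ∀ y : Randomness S, ∀ j t, splice pilotCells (x, y) (.main j t) = y (.main j t) :=
    fun y j t => splice_of_notMem fun ⟨_, _, h⟩ => by cases h
  simp only [h1, h2]
  rw [lintegral_finsetSum _ fun j _ => hm j]
  refine (Finset.sum_le_card_nsmul _ _ _ fun j _ => lintegral_tpaDraws_le (a := Cell.main j)
    (a' := Cell.thin j) hH hβ hdraw (fun x y h => (Cell.main.inj h).2)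
    (fun x y h => by cases h)).trans ?_
  rw [Finset.card_range, nsmul_eq_mul]

theorem lintegral_numIntervals_le (hH : HasRange H n σ) (hn : 1 ≤ n) (hβ : 0 < β)
    (hdraw : IsGibbsOracle H β ν draw) :
    ∫⁻ ω, ((numIntervals H σ n β 5 draw ω + 1 : ℕ) : ℝ≥0∞) ∂randomnessLaw ν
      ≤ ENNReal.ofReal (2 / 3 * (2 + Real.log (2 * n)) * remaining H σ β (tpaStart β σ) + 2) := by
  have hL := (logRange_bound hn rfl).1
  have hq : 0 ≤ remaining H σ β (tpaStart β σ) := remaining_nonneg hH (tpaStart_mem hβ σ)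
  set q := remaining H σ β (tpaStart β σ)
  have hF : Measurable fun ω : Randomness S => ((numIntervals H σ n β 5 draw ω + 1 : ℕ) : ℝ≥0∞) :=
    (Measurable.of_discrete (f := fun m : ℕ => ((m + 1 : ℕ) : ℝ≥0∞))).comp
      (hdraw.measurable_numIntervals hβ)
  conv_lhs => rw [randomnessLaw_eq, lintegral_splice pilotCells (cellLaw ν) hF, ← randomnessLaw_eq]
  have hx : ∀ x : Randomness S, ∫⁻ y, ((numIntervals H σ n β 5 draw (splice pilotCells (x, y)) + 1 :
      ℕ) : ℝ≥0∞) ∂randomnessLaw ν ≤ ENNReal.ofReal (2 / 3 * (2 + Real.log (2 * n)) * q + 2) := by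
    intro x
    have h1 : ∀ y, pilotSize H σ β draw (splice pilotCells (x, y)) = pilotSize H σ β draw x :=
      fun y => DependsOn.splice_left dependsOn_pilotSize
    set N := pilotSize H σ β draw x
    have hd := one_le_spacingOf N hn (show (0 : ℝ) < 5 by norm_num)
    have hd' : (0 : ℝ) < spacingOf n 5 N := by exact_mod_cast hd
    -- There are at most length/d + 1 intervals, and each repetition draws at one point more, hence
    -- the 2. The mean length is at most the rate times q, so d cancels.
    have hle : ∀ y, ((numIntervals H σ n β 5 draw (splice pilotCells (x, y)) + 1 : ℕ) : ℝ≥0∞)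
        ≤ ENNReal.ofReal (1 / spacingOf n 5 N) * ((sortedOf H σ n β 5 draw N y).length : ℝ≥0∞) + 2 := by
      intro y
      have h2 : sortedOf H σ n β 5 draw N (splice pilotCells (x, y)) = sortedOf H σ n β 5 draw N y :=
        DependsOn.splice_right (dependsOn_sortedOf' N)
      rw [numIntervals_eq, h1, h2, ← ENNReal.ofReal_natCast, ← ENNReal.ofReal_natCast,
        ← ENNReal.ofReal_mul (by positivity), ← ENNReal.ofReal_ofNat 2,
        ← ENNReal.ofReal_add (by positivity) (by norm_num)]
      refine ENNReal.ofReal_le_ofReal ?_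
      push_cast
      have := Nat.cast_div_le (α := ℝ) (m := (sortedOf H σ n β 5 draw N y).length)
        (n := spacingOf n 5 N)
      rw [one_div_mul_eq_div]
      linarith
    refine (lintegral_mono hle).trans ?_
    have hm : Measurable fun y => ((sortedOf H σ n β 5 draw N y).length : ℝ≥0∞) :=
      (Measurable.of_discrete (f := fun m : ℕ => (m : ℝ≥0∞))).comp
        (hdraw.measurable_length_sortedMerged hβ _ _)
    rw [lintegral_add_right _ measurable_const, lintegral_const, measure_univ, mul_one,
      lintegral_const_mul _ hm]
    have h3 := lintegral_length_sortedMerged_le (σ := σ) hH hβ hdraw (runsOf n 5 N)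
      (rateOf_div_le_one (n := n) (c := 5) N)
    have hκ := rateOf_div_nonneg N hn (show (0 : ℝ) < 5 by norm_num)
    calc _ ≤ ENNReal.ofReal (1 / spacingOf n 5 N) * (runsOf n 5 N *
            (ENNReal.ofReal (rateOf n 5 N / runsOf n 5 N) * ENNReal.ofReal q)) + 2 := by
          gcongr
          exact h3
      _ = _ := by
          rw [← ENNReal.ofReal_natCast, ← ENNReal.ofReal_mul hκ,
            ← ENNReal.ofReal_mul (Nat.cast_nonneg _), ← ENNReal.ofReal_mul (by positivity),
            ← ENNReal.ofReal_ofNat 2, ← ENNReal.ofReal_add (by positivity) (by norm_num)]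
          congr 2
          have h4 := rateOf_div_mul_runsOf N hn (show (0 : ℝ) < 5 by norm_num)
          rw [← mul_assoc (runsOf n 5 N : ℝ), mul_comm (runsOf n 5 N : ℝ), h4, rateOf]
          field_simp
  refine (lintegral_mono hx).trans ?_
  rw [lintegral_const, measure_univ, mul_one]

theorem lintegral_totalDraws_le (hH : HasRange H n σ) (hn : 4 ≤ n) (hβ : 0 < β)
    (hdraw : IsGibbsOracle H β ν draw) {ε : ℝ} (hε : 0 < ε) (hε' : ε ≤ 1 / 10) {q : ℝ}
    (hq : q = remaining H σ β (tpaStart β σ)) :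
    ∫⁻ ω, (totalDraws H σ n β ε 5 draw ω : ℝ≥0∞) ∂randomnessLaw ν
      ≤ ENNReal.ofReal ((q + 1) * (5 + (2 + Real.log (2 * n))
        * (14.9 * Real.log (100 * (2 + Real.log (2 * n)) * (q + 1)) + 48.2 / ε ^ 2))) := by
  have hq0 : 0 ≤ q := hq ▸ remaining_nonneg hH (tpaStart_mem hβ σ)
  have hn1 : 1 ≤ n := by omega
  have hL := four_le_logRange hn
  have h0 : ∀ ω, (totalDraws H σ n β ε 5 draw ω : ℝ≥0∞)
      = ∑ j ∈ Finset.range 5, (tpaDraws H σ β draw (fun t => ω (.pilot j t)) : ℝ≥0∞)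
      + ∑ j ∈ Finset.range (runsOf n 5 (pilotSize H σ β draw ω)),
        (tpaDraws H σ β draw (fun t => ω (.main j t)) : ℝ≥0∞)
      + numReps ε * ((numIntervals H σ n β 5 draw ω + 1 : ℕ) : ℝ≥0∞) := fun ω => by
    rw [totalDraws, ENat.toENNReal_add, ENat.toENNReal_add, toENNReal_finsetSum,
      toENNReal_finsetSum, ENat.toENNReal_coe, Nat.cast_mul]
    rfl
  have hm : ∀ j, Measurable fun ω : Randomness S =>
      (tpaDraws H σ β draw (fun t => ω (.pilot j t)) : ℝ≥0∞) := fun j =>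
    Measurable.of_discrete.comp (hdraw.measurable_tpaDraws hβ (a := Cell.pilot j))
  have hmI : Measurable fun ω : Randomness S =>
      ((numIntervals H σ n β 5 draw ω + 1 : ℕ) : ℝ≥0∞) :=
    (Measurable.of_discrete (f := fun m : ℕ => ((m + 1 : ℕ) : ℝ≥0∞))).comp
      (hdraw.measurable_numIntervals hβ)
  have hsum : Measurable fun ω : Randomness S =>
      ∑ j ∈ Finset.range 5, (tpaDraws H σ β draw (fun t => ω (.pilot j t)) : ℝ≥0∞) :=
    Finset.measurable_sum _ fun j _ => hm j
  simp only [h0]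
  rw [lintegral_add_right _ (hmI.const_mul _), lintegral_add_left hsum, lintegral_finsetSum _ fun j _ => hm j,
    lintegral_const_mul _ hmI]
  have h1 := Finset.sum_le_card_nsmul (Finset.range 5) _ _ fun j _ =>
    lintegral_tpaDraws_le (a := Cell.pilot j) (a' := Cell.thin j) hH hβ hdraw
      (fun x y h => (Cell.pilot.inj h).2) (fun x y h => by cases h)
  have h2 := (lintegral_mainDraws_le (n := n) hH hβ hdraw).trans
    (mul_le_mul_left (lintegral_numRuns_le hH hn hβ hdraw hq) _)
  have h3 := mul_le_mul_right (lintegral_numIntervals_le hH hn1 hβ hdraw) (numReps ε : ℝ≥0∞)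
  refine (add_le_add (add_le_add h1 h2) h3).trans ?_
  rw [← hq, Finset.card_range, nsmul_eq_mul]
  set L := 2 + Real.log (2 * n)
  have hlog : 0 ≤ Real.log (100 * L * (q + 1)) := Real.log_nonneg (by nlinarith)
  rw [← ENNReal.ofReal_one, ← ENNReal.ofReal_add zero_le_one hq0, ← ENNReal.ofReal_natCast,
    ← ENNReal.ofReal_natCast, ← ENNReal.ofReal_mul (by norm_num),
    ← ENNReal.ofReal_mul (by positivity), ← ENNReal.ofReal_mul (by positivity),
    ← ENNReal.ofReal_add (by positivity) (by positivity),
    ← ENNReal.ofReal_add (by positivity) (by positivity)]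
  refine ENNReal.ofReal_le_ofReal ?_
  have hr := numReps_upper hε hε'
  -- The constant 48.2 exceeds 72.2 · 2/3, and 2 · 72.2 ≤ 48.2 L since L ≥ 4.
  have h4 : (numReps ε : ℝ) * (2 / 3 * L * q + 2) ≤ (q + 1) * (L * (48.2 / ε ^ 2)) := by
    calc (numReps ε : ℝ) * (2 / 3 * L * q + 2) ≤ 72.2 / ε ^ 2 * (2 / 3 * L * q + 2) := by gcongr
      _ = (72.2 * (2 / 3 * L * q + 2)) / ε ^ 2 := by ring
      _ ≤ ((q + 1) * L * 48.2) / ε ^ 2 := by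
          refine div_le_div_of_nonneg_right ?_ (by positivity)
          nlinarith [mul_nonneg hq0 (by linarith : 0 ≤ L)]
      _ = _ := by ring
  push_cast
  linarith

end Cost

end PPAA

end

theorem mainTheorem1 {Ω S : Type*} [Fintype Ω] [Nonempty Ω] [MeasurableSpace S]
    (H : Ω → ℝ) (n : ℕ) (hn : 1 ≤ n) (σ : PPAA.HamiltonianSign) (hH : PPAA.HasRange H n σ)
    (β : ℝ) (hβ : 0 < β) (ε : ℝ) (hε : 0 < ε) (hε' : ε ≤ 1 / 10)
    (ν : MeasureTheory.Measure S) [MeasureTheory.IsProbabilityMeasure ν] (draw : ℝ → S → Ω)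
    (hdraw : PPAA.IsGibbsOracle H β ν draw) :
    (∀ c : ℝ, c = 1 ∨ c = 5 →
      PPAA.IsApproximation (PPAA.randomnessLaw ν) (PPAA.output H σ n β ε c draw)
        (PPAA.partitionFunction H β / PPAA.partitionFunction H 0) ε ∧
      PPAA.IsApproximation (PPAA.randomnessLaw ν)
        (fun ω => PPAA.partitionFunction H 0 * PPAA.output H σ n β ε c draw ω)
        (PPAA.partitionFunction H β) ε) ∧
    (4 ≤ n → ∀ q : ℝ,
      q = |Real.log (PPAA.partitionFunction H β / PPAA.partitionFunction H 0)| →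
      ∫⁻ ω, (PPAA.totalDraws H σ n β ε 5 draw ω : ENNReal) ∂(PPAA.randomnessLaw ν) ≤
        ENNReal.ofReal ((q + 1) * (5 + (2 + Real.log (2 * n)) *
          (14.9 * Real.log (100 * (2 + Real.log (2 * n)) * (q + 1)) + 48.2 / ε ^ 2)))) := by
  refine ⟨fun c hc => ?_, fun h4 q hq => ?_⟩
  · have h : PPAA.IsApproximation (PPAA.randomnessLaw ν) (PPAA.output H σ n β ε c draw)
        (PPAA.partitionFunction H β / PPAA.partitionFunction H 0) ε := by
      refine PPAA.isApproximation_output hH hn hβ hdraw ?_ ?_ hε hε' <;>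
        rcases hc with rfl | rfl <;> norm_num
    exact ⟨h, h.const_mul⟩
  · exact PPAA.lintegral_totalDraws_le hH h4 hβ hdraw hε hε'
      (hq.trans (PPAA.abs_log_div_eq hH hβ))
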